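/- **Setting.** Let $n \ge 1$ and let $\mathcal N$ be a set of $n$ agents. An instance $\mathcal I$ assigns to every agent $i$ a set of friends $F_i \subseteq \mathcal N \setminus \{i\}$; the other agents in $\mathcal N\setminus(F_i\cup\{i\})$ are the enemies of $i$. Under Enemies Aversion, agent $i$ assigns value $v_i(j) = 1$ to a friend $j$ and $v_i(j) = -n$ to an enemy $j$. For a partition $\pi$ of $\mathcal N$ into coalitions, let $\pi(i)$ be the coalition that contains $i$, let $u_i(\pi) = \sum_{j \in \pi(i)\setminus\{i\}} v_i(j)$, and let $\mathsf{ESW}(\pi) = \min_{i} u_i(\pi)$ be the egalitarian welfare of $\pi$. Let $\mathsf{opt}(\mathcal I) = \max_\pi \mathsf{ESW}(\pi)$. The strong friendship graph $G^{\mathit{sf}}$ has vertex set $\mathcal N$ and an edge $\{i,j\}$ whenever $j \in F_i$ and $i \in F_j$. A perfect packing of a graph by $K_2$'s and $K_3$'s is a partition of its vertex set into cliques of size $2$ or $3$. **Theorem.** Under Enemies Aversion there is an algorithm that, on every instance $\mathcal I$ with $n \ge 1$ agents, halts after a number of steps bounded by a polynomial in $n$ and returns a partition $\pi$ of the agents such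 that 1. $\mathsf{opt}(\mathcal I) \le (n-1)\cdot \mathsf{ESW}(\pi)$, i.e. $\pi$ is an $(n-1)$-approximation to the maximum egalitarian welfare; 2. if $\mathsf{opt}(\mathcal I) > 0$, then for every agent $i$ the coalition $\pi(i)$ contains at least one friend of $i$; 3. if $G^{\mathit{sf}}$ has a perfect packing by $K_2$'s and $K_3$'s, then $\pi$ is such a packing. Here an algorithm is a program for a random access machine with addition and truncated subtraction of natural numbers and unit cost per operation, which receives $n$ and the $n \times n$ zero-one matrix of the friendship relation and returns a label for every agent; agents with equal labels form a coalition. -/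

import Mathlib

/-! ## Friends and Enemies Games under Enemies Aversion -/

/-- A friends-and-enemies instance on the agents `0, …, n - 1`: every agent has a set of friends
among the other agents; all remaining other agents are her enemies. -/
structure FriendGame (n : ℕ) where
  friends : Fin n → Finset (Fin n)
  not_self : ∀ i, i ∉ friends i

/-- An outcome (coalition structure): a partition of the agents into nonempty disjoint
coalitions. `π.part i` is the coalition of agent `i`. -/
abbrev Outcome (n : ℕ) : Type := Finpartition (Finset.univ : Finset (Fin n))

namespace FriendGame

variable {n : ℕ}

/-- The value that agent `i` assigns to another agent `j` under Enemies Aversion: `1` for a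
friend, `-n` for an enemy. -/
def eaValue (I : FriendGame n) (i j : Fin n) : ℤ :=
  if j ∈ I.friends i then 1 else -(n : ℤ)

/-- The utility that agent `i` derives from the coalition `C`. -/
def utility (I : FriendGame n) (i : Fin n) (C : Finset (Fin n)) : ℤ :=
  ∑ j ∈ C \ {i}, I.eaValue i j

/-- The egalitarian welfare of an outcome: the minimum of the agents' utilities (a minimum over
a finite set, nonempty for `0 < n`). -/
noncomputable def esw (I : FriendGame n) (π : Outcome n) : ℤ :=
  ⨅ i : Fin n, I.utility i (π.part i)

/-- The maximum egalitarian welfare over all outcomes (a maximum over a nonempty finite set). -/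
noncomputable def opt (I : FriendGame n) : ℤ :=
  ⨆ π : Outcome n, I.esw π

/-- The strong friendship graph: the edges are the mutual friendships. -/
def strongGraph (I : FriendGame n) : SimpleGraph (Fin n) where
  Adj i j := j ∈ I.friends i ∧ i ∈ I.friends j
  symm := ⟨fun _ _ h => ⟨h.2, h.1⟩⟩
  loopless := ⟨fun i h => I.not_self i h.1⟩

/-- The outcome guarantees every agent at least one friend in her own coalition. -/
def OneFriend (I : FriendGame n) (π : Outcome n) : Prop :=
  ∀ i, ∃ j ∈ π.part i, j ∈ I.friends i

end FriendGame

/-- The partition `π` of the vertices is a perfect packing of `G` by `K₂`'s and `K₃`'s. -/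
def IsPerfectK2K3Packing {n : ℕ} (G : SimpleGraph (Fin n)) (π : Outcome n) : Prop :=
  ∀ C ∈ π.parts, G.IsNClique 2 C ∨ G.IsNClique 3 C

/-! ## The machine model

A random access machine, programmed in a structured language. The memory consists of registers
and of one-dimensional arrays of natural numbers, each named by a natural number; a fixed program
mentions finitely many of them. The arithmetic is addition and truncated subtraction only, so in
`t` steps numbers gain only `O(t)` bits and polynomial time for this machine coincides with
polynomial time for Turing machines. -/

namespace Ram

/-- A memory state. -/
structure State where
  reg : ℕ → ℕ
  arr : ℕ → ℕ → ℕ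

/-- Expressions: constants, registers, array reads, addition and truncated subtraction. -/
inductive Expr where
  | const (c : ℕ)
  | reg (x : ℕ)
  | arr (a : ℕ) (index : Expr)
  | add (e₁ e₂ : Expr)
  | sub (e₁ e₂ : Expr)

namespace Expr

/-- The value of an expression in a state. -/
def eval (s : State) : Expr → ℕ
  | const c => c
  | reg x => s.reg x
  | arr a e => s.arr a (e.eval s)
  | add e₁ e₂ => e₁.eval s + e₂.eval s
  | sub e₁ e₂ => e₁.eval s - e₂.eval s

/-- The number of steps needed to evaluate an expression: one for each operation in it. -/
def cost : Expr → ℕ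
  | const _ => 1
  | reg _ => 1
  | arr _ e => e.cost + 1
  | add e₁ e₂ => e₁.cost + e₂.cost + 1
  | sub e₁ e₂ => e₁.cost + e₂.cost + 1

end Expr

/-- Programs. A test counts as true if its value is nonzero. -/
inductive Prog where
  | skip
  | assign (x : ℕ) (e : Expr)
  | write (a : ℕ) (index e : Expr)
  | seq (p q : Prog)
  | branch (test : Expr) (p q : Prog)
  | loop (test : Expr) (p : Prog)

namespace State

/-- The state after storing `v` in register `x`. -/
def setReg (s : State) (x v : ℕ) : State :=
  { s with reg := Function.update s.reg x v }

/-- The state after storing `v` in cell `k` of array `a`. -/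
def setArr (s : State) (a k v : ℕ) : State :=
  { s with arr := Function.update s.arr a (Function.update (s.arr a) k v) }

end State

/-- `Exec p s t s'`: started in the state `s`, the program `p` halts after exactly `t` steps, in
the state `s'`. -/
inductive Exec : Prog → State → ℕ → State → Prop where
  | skip (s : State) : Exec Prog.skip s 1 s
  | assign (s : State) (x : ℕ) (e : Expr) :
      Exec (Prog.assign x e) s (e.cost + 1) (s.setReg x (e.eval s))
  | write (s : State) (a : ℕ) (k e : Expr) :
      Exec (Prog.write a k e) s (k.cost + e.cost + 1) (s.setArr a (k.eval s) (e.eval s))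
  | seq {p q : Prog} {s s' s'' : State} {t t' : ℕ} :
      Exec p s t s' → Exec q s' t' s'' → Exec (Prog.seq p q) s (t + t') s''
  | branch_true {b : Expr} {p q : Prog} {s s' : State} {t : ℕ} :
      b.eval s ≠ 0 → Exec p s t s' → Exec (Prog.branch b p q) s (b.cost + 1 + t) s'
  | branch_false {b : Expr} {p q : Prog} {s s' : State} {t : ℕ} :
      b.eval s = 0 → Exec q s t s' → Exec (Prog.branch b p q) s (b.cost + 1 + t) s'
  | loop_true {b : Expr} {p : Prog} {s s' s'' : State} {t t' : ℕ} :
      b.eval s ≠ 0 → Exec p s t s' → Exec (Prog.loop b p) s' t' s'' →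
        Exec (Prog.loop b p) s (b.cost + 1 + t + t') s''
  | loop_false {b : Expr} {p : Prog} {s : State} :
      b.eval s = 0 → Exec (Prog.loop b p) s (b.cost + 1) s

/-- The initial state on the input `I`: register `0` holds the number `n` of agents, array `0`
holds the friendship relation as an `n × n` matrix of zeros and ones stored row by row, and the
rest of the memory is `0`. -/
def input {n : ℕ} (I : FriendGame n) : State where
  reg x := if x = 0 then n else 0
  arr a k := if a = 0 ∧ ∃ i j : Fin n, k = i * n + j ∧ j ∈ I.friends i then 1 else 0

/-- The state `s` holds the outcome `π`: array `1` labels every agent, and two agents have the same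
label exactly if they are in the same coalition. -/
def Holds {n : ℕ} (s : State) (π : Outcome n) : Prop :=
  ∀ i j : Fin n, s.arr 1 i = s.arr 1 j ↔ π.part i = π.part j

end Ram

/-! An agent with an enemy in her coalition has negative utility, because one enemy costs `n` and
the other members are worth at most `n - 2`. An outcome of positive welfare therefore consists of
cliques of the strong friendship graph with at least two vertices, and these split into edges and
triangles. Conversely a packing by edges and triangles gives everyone utility at least 1, while
nobody can get more than `n - 1`. If there is no packing, the singletons are optimal. It remains to
find a packing in polynomial time.

The algorithm computes a maximum matching and, as long as some triangle can be removed so that fewer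
vertices stay exposed, removes it. Two facts make this correct. `Packable.exists_triangle`: a
packable set without perfect matching has such a triangle. `Packable.sdiff_triangle`: removing any
such triangle preserves packability. Both follow from comparing a packing with the fewest triangles
with a matching `g`. With matchings written as involutions, the symmetric difference consists of
orbits of two involutions, and an orbit that contains a fixed point is a path with exactly two ends
(`Linked.ends`). If a path joined two different triangles, exchanging the matchings along it would
save both (`TriMatch.eq_of_linked`). Hence every triangle owns a vertex exposed by `g`, and the
fewest triangles equal the fewest exposed vertices.

Maximum matchings are found without contracting blossoms. From an exposed root `r` the search
stores, for each reached vertex `x`, a matching that covers `r` and everything covered before,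
except `x`. New vertices come from rotating a stored matching along an edge, and from sliding along
an edge `vw` between reached vertices, which reaches all vertices of the odd cycle that this edge
closes. When nothing new is found, each component of the reached graph is odd and has at most one
vertex that is the root or is matched by `m` to an unreached vertex; a count in the style of Tutte
and Berge then shows that the search is complete (`Search.Good.complete`). By Berge's theorem this
decides whether the matching is maximum.

The programs are built from loops of length `n`, so the time bound comes for free (`Ram.Cmd.exec`).
What has to be shown is that `n` iterations suffice in each loop, by a quantity that grows or
shrinks in every useful iteration. -/

open Function
set_option linter.unusedSectionVars false

/-! ## Orbits of a pair of involutions -/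

section Orbits

variable {V : Type*}

/-- Two points are linked if one is reached from the other by applying `f` and `g`. -/
def Linked (f g : V → V) : V → V → Prop :=
  Relation.ReflTransGen fun a b => b = f a ∨ b = g a

namespace Linked

variable {f g : V → V} {x y z : V}

theorem refl (x : V) : Linked f g x x := Relation.ReflTransGen.refl

theorem trans (h : Linked f g x y) (h' : Linked f g y z) : Linked f g x z :=
  Relation.ReflTransGen.trans h h'

theorem left (h : Linked f g x y) : Linked f g x (f y) := Relation.ReflTransGen.tail h (Or.inl rfl)

theorem right (h : Linked f g x y) : Linked f g x (g y) :=
  Relation.ReflTransGen.tail h (Or.inr rfl)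

theorem symm (hf : Involutive f) (hg : Involutive g) (h : Linked f g x y) : Linked f g y x := by
  induction h with
  | refl => exact refl _
  | @tail b c _ hbc ih =>
    refine trans ?_ ih
    rcases hbc with rfl | rfl
    · simpa [hf b] using (refl (f := f) (g := g) (f b)).left
    · simpa [hg b] using (refl (f := f) (g := g) (g b)).right

theorem swap (h : Linked f g x y) : Linked g f x y := by
  induction h with
  | refl => exact refl _
  | tail _ hbc ih =>
    rcases hbc with rfl | rfl
    · exact ih.right
    · exact ih.left

theorem mem {U : Set V} (h : Linked f g x y) (hx : x ∈ U) (hf : ∀ u ∈ U, f u ∈ U)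
    (hg : ∀ u ∈ U, g u ∈ U) : y ∈ U := by
  induction h with
  | refl => exact hx
  | tail _ hbc ih => rcases hbc with rfl | rfl <;> simp_all

end Linked

/-- The orbit of a fixed point of `f` is a path: it has exactly one other end. -/
theorem Linked.ends [Finite V] {f g : V → V} (hf : Involutive f) (hg : Involutive g) {x : V}
    (hx : f x = x) :
    (∃ y, Linked f g x y ∧ y ≠ x ∧ f y = y ∧
      (∀ z, Linked f g x z → f z = z → z = x ∨ z = y) ∧ ∀ z, Linked f g x z → g z ≠ z) ∨
    (∃ y, Linked f g x y ∧ g y = y ∧ (∀ z, Linked f g x z → f z = z → z = x) ∧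
      ∀ z, Linked f g x z → g z = z → z = y) := by
  classical
  set F : Equiv.Perm V := hf.toPerm with hF
  -- The two involutions generate a dihedral group. As `f` inverts the rotation `H` and fixes `x`,
  -- the orbit is the set of all `(H ^ k) x`, where `f` acts by `k ↦ -k` and `g` by `k ↦ 1 - k`
  -- modulo the period. The ends are the solutions of `2k ≡ 0` and `2k ≡ 1`.
  set H : Equiv.Perm V := hg.toPerm * hf.toPerm with hH
  have hFF : F * F = 1 := Equiv.ext hf
  have hGG : hg.toPerm * hg.toPerm = 1 := Equiv.ext hg
  have hsemi : SemiconjBy F H H⁻¹ := by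
    have : H⁻¹ = F * hg.toPerm := by
      rw [hH, mul_inv_rev, inv_eq_of_mul_eq_one_left hFF, inv_eq_of_mul_eq_one_left hGG]
    unfold SemiconjBy
    rw [this, hH, mul_assoc]
  have hfk (k : ℤ) : f ((H ^ k) x) = (H ^ (-k)) x := by
    have := congrArg (fun p : Equiv.Perm V => p x) (hsemi.zpow_right k).eq
    simp only [Equiv.Perm.mul_apply, inv_zpow', hF, Function.Involutive.coe_toPerm, hx] at this
    exact this
  have hgk (k : ℤ) : g ((H ^ k) x) = (H ^ (1 - k)) x := by
    have h1 : g ((H ^ k) x) = H (f ((H ^ k) x)) := by simp [hH, hf _]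
    rw [h1, hfk, sub_eq_add_neg, zpow_add, zpow_one]
    rfl
  have hlink (k : ℤ) : Linked f g x ((H ^ k) x) := by
    induction k using Int.induction_on with
    | zero => exact Linked.refl _
    | succ i ih =>
      have := (ih.left).right
      rwa [hfk, hgk, sub_neg_eq_add, add_comm] at this
    | pred i ih =>
      have := (ih.right).left
      rw [hgk, hfk] at this
      convert this using 3
      ring
  have hall {z : V} (hz : Linked f g x z) : ∃ k : ℤ, z = (H ^ k) x := by
    induction hz with
    | refl => exact ⟨0, rfl⟩
    | tail _ hbc ih =>
      obtain ⟨k, rfl⟩ := ih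
      rcases hbc with rfl | rfl
      · exact ⟨-k, hfk k⟩
      · exact ⟨1 - k, hgk k⟩
  set p : ℤ := (MulAction.period H x : ℤ) with hp
  have hp0 : 0 < p := by
    have := MulAction.period_pos_of_orderOf_pos (isOfFinOrder_of_finite H).orderOf_pos x
    exact Int.natCast_pos.2 this
  have hper (i j : ℤ) : (H ^ i) x = (H ^ j) x ↔ p ∣ i - j := by
    rw [hp, ← MulAction.zpow_smul_eq_iff_period_dvd, sub_eq_neg_add, zpow_add, mul_smul,
      zpow_neg, inv_smul_eq_iff]
    rfl
  have hfix (k : ℤ) : f ((H ^ k) x) = (H ^ k) x ↔ p ∣ 2 * k := by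
    rw [hfk, eq_comm, hper, sub_neg_eq_add, two_mul]
  have gfix (k : ℤ) : g ((H ^ k) x) = (H ^ k) x ↔ p ∣ 2 * k - 1 := by
    rw [hgk, eq_comm, hper]
    ring_nf
  have hx0 : x = (H ^ (0 : ℤ)) x := rfl
  -- For `p = 2q` the first congruence has the solutions `0` and `q`, and the second has none; for
  -- `p = 2q + 1` the unique solutions are `0` and `q + 1`.
  obtain ⟨q, hq⟩ | ⟨q, hq⟩ := Int.even_or_odd p
  · left
    refine ⟨(H ^ q) x, hlink q, ?_, ?_, ?_, ?_⟩
    · intro h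
      rw [hx0] at h
      have h2 : (H ^ q) x = (H ^ (0 : ℤ)) x := h
      rw [hper] at h2
      have := Int.le_of_dvd (by omega) h2
      omega
    · rw [hfix]
      exact ⟨1, by omega⟩
    · intro z hz hfz
      obtain ⟨k, rfl⟩ := hall hz
      rw [hfix] at hfz
      obtain ⟨c, hc⟩ := hfz
      have hk : k = q * c := by
        have : 2 * k = 2 * (q * c) := by rw [hc, hq]; ring
        omega
      obtain ⟨e, he⟩ | ⟨e, he⟩ := Int.even_or_odd c
      · left
        have : (H ^ k) x = (H ^ (0 : ℤ)) x := by
          rw [hper]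
          exact ⟨e, by rw [hk, hq, he]; ring⟩
        exact this
      · right
        rw [hper]
        exact ⟨e, by rw [hk, hq, he]; ring⟩
    · intro z hz hgz
      obtain ⟨k, rfl⟩ := hall hz
      rw [gfix] at hgz
      obtain ⟨c, hc⟩ := hgz
      have : 2 * k - 1 = 2 * (q * c) := by rw [hc, hq]; ring
      omega
  · right
    refine ⟨(H ^ (q + 1)) x, hlink _, ?_, ?_, ?_⟩
    · rw [gfix]
      exact ⟨1, by omega⟩
    · intro z hz hfz
      obtain ⟨k, rfl⟩ := hall hz
      rw [hfix] at hfz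
      have h1 : p ∣ k := by
        refine Int.dvd_of_dvd_mul_right_of_gcd_one hfz ?_
        rw [hq, ← Int.isCoprime_iff_gcd_eq_one]
        exact ⟨1, -q, by ring⟩
      have : (H ^ k) x = (H ^ (0 : ℤ)) x := by rw [hper]; simpa using h1
      exact this
    · intro z hz hgz
      obtain ⟨k, rfl⟩ := hall hz
      rw [gfix] at hgz
      rw [hper]
      refine Int.dvd_of_dvd_mul_right_of_gcd_one (b := 2) ?_ ?_
      · have : (2 : ℤ) * (k - (q + 1)) = (2 * k - 1) - p := by rw [hq]; ring
        rw [this]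
        exact dvd_sub_self_right.2 hgz
      · rw [hq, ← Int.isCoprime_iff_gcd_eq_one]
        exact ⟨1, -q, by ring⟩

/-- An orbit with a fixed point of `f` and one of `g` contains no further ends. -/
theorem Linked.unique_of_mixed [Finite V] {f g : V → V} (hf : Involutive f) (hg : Involutive g)
    {x z : V} (hx : f x = x) (hz : g z = z) (h : Linked f g x z) {u : V} (hu : Linked f g x u) :
    (f u = u → u = x) ∧ (g u = u → u = z) := by
  rcases Linked.ends hf hg hx with ⟨y, -, -, -, -, h5⟩ | ⟨y, -, -, h3, h4⟩
  · exact (h5 z h hz).elim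
  · exact ⟨h3 u hu, fun hgu => (h4 u hu hgu).trans (h4 z h hz).symm⟩

/-- An orbit with two fixed points of `f` contains no further ends. -/
theorem Linked.unique_of_left [Finite V] {f g : V → V} (hf : Involutive f) (hg : Involutive g)
    {x z : V} (hx : f x = x) (hz : f z = z) (hne : x ≠ z) (h : Linked f g x z) {u : V}
    (hu : Linked f g x u) : (f u = u → u = x ∨ u = z) ∧ g u ≠ u := by
  rcases Linked.ends hf hg hx with ⟨y, -, -, -, h4, h5⟩ | ⟨y, -, -, h3, h4⟩
  · obtain rfl : z = y := (h4 z h hz).resolve_left hne.symm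
    exact ⟨h4 u hu, h5 u hu⟩
  · exact (hne (h3 z h hz).symm).elim

end Orbits

/-! ## Matchings as involutions -/

section Matchings

variable {V : Type*}

/-- `f` is a matching of the graph induced on `U`: `f x` is the partner of `x`, and `f x = x` if
`x` is exposed. -/
structure IsMatch (G : SimpleGraph V) (U : Finset V) (f : V → V) : Prop where
  invol : Involutive f
  adj : ∀ x, f x ≠ x → G.Adj x (f x)
  mem : ∀ x, f x ≠ x → x ∈ U

variable {G : SimpleGraph V} {U : Finset V} {f g : V → V}

namespace IsMatch

theorem mem_image (h : IsMatch G U f) {x : V} (hx : x ∈ U) : f x ∈ U := by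
  by_cases hfx : f x = x
  · rwa [hfx]
  · exact h.mem _ fun h' => hfx (h.invol.injective h')

theorem mono {W : Finset V} (h : IsMatch G U f) (hUW : U ⊆ W) : IsMatch G W f :=
  ⟨h.invol, h.adj, fun x hx => hUW (h.mem x hx)⟩

theorem linked_mem (hf : IsMatch G U f) (hg : IsMatch G U g) {x y : V} (h : Linked f g x y)
    (hx : x ∈ U) : y ∈ U :=
  h.mem (U := (U : Set V)) hx (fun _ => hf.mem_image) fun _ => hg.mem_image

/-- Exchanging one matching for another one on a union of orbits. -/
theorem flip (hf : IsMatch G U f) (hg : IsMatch G U g) (O : Set V) [DecidablePred (· ∈ O)]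
    (hOf : ∀ x ∈ O, f x ∈ O) (hOg : ∀ x ∈ O, g x ∈ O) :
    IsMatch G U fun x => if x ∈ O then g x else f x := by
  refine ⟨fun x => ?_, fun x hx => ?_, fun x hx => ?_⟩
  · by_cases hx : x ∈ O
    · simp [hx, hOg x hx, hg.invol x]
    · have : f x ∉ O := fun h => hx (by simpa [hf.invol x] using hOf _ h)
      simp [hx, this, hf.invol x]
  · by_cases hxO : x ∈ O
    · simp only [hxO, if_true] at hx ⊢; exact hg.adj x hx
    · simp only [hxO, if_false] at hx ⊢; exact hf.adj x hx
  · by_cases hxO : x ∈ O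
    · simp only [hxO, if_true] at hx; exact hg.mem x hx
    · simp only [hxO, if_false] at hx; exact hf.mem x hx

variable [DecidableEq V]

/-- Removing one edge from a matching. -/
theorem erase (hf : IsMatch G U f) (x : V) :
    IsMatch G U fun u => if u = x ∨ u = f x then u else f u := by
  refine ⟨fun u => ?_, fun u hu => ?_, fun u hu => ?_⟩
  · by_cases hu : u = x ∨ u = f x
    · simp [hu]
    · have : ¬ (f u = x ∨ f u = f x) := by
        rintro (h | h)
        · exact hu (Or.inr (by rw [← h, hf.invol]))
        · exact hu (Or.inl (hf.invol.injective h))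
      simp [hu, this, hf.invol u]
  · by_cases h : u = x ∨ u = f x
    · simp [h] at hu
    · simp only [h, if_false] at hu ⊢; exact hf.adj u hu
  · by_cases h : u = x ∨ u = f x
    · simp [h] at hu
    · simp only [h, if_false] at hu; exact hf.mem u hu

/-- Adding one edge between exposed vertices to a matching. -/
theorem add (hf : IsMatch G U f) {x y : V} (hx : f x = x) (hy : f y = y) (hxy : G.Adj x y)
    (hxU : x ∈ U) (hyU : y ∈ U) :
    IsMatch G U (update (update f x y) y x) := by
  have hne := hxy.ne
  have key (u : V) (h1 : u ≠ x) (h2 : u ≠ y) : f u ≠ x ∧ f u ≠ y :=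
    ⟨fun h => h1 (hf.invol.injective (h.trans hx.symm)),
      fun h => h2 (hf.invol.injective (h.trans hy.symm))⟩
  refine ⟨fun u => ?_, fun u hu => ?_, fun u hu => ?_⟩
  · rcases eq_or_ne u y with rfl | h2
    · simp [hne]
    · rcases eq_or_ne u x with rfl | h1
      · simp [hne]
      · simp [h1, h2, key u h1 h2, hf.invol u]
  · rcases eq_or_ne u y with rfl | h2
    · simpa using hxy.symm
    · rcases eq_or_ne u x with rfl | h1
      · simpa [hne] using hxy
      · simp only [ne_eq, h1, h2, not_false_eq_true, update_of_ne] at hu ⊢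
        exact hf.adj u hu
  · rcases eq_or_ne u y with rfl | h2
    · exact hyU
    · rcases eq_or_ne u x with rfl | h1
      · exact hxU
      · simp only [ne_eq, h1, h2, not_false_eq_true, update_of_ne] at hu
        exact hf.mem u hu

end IsMatch

/-- The number of exposed vertices. -/
def exposed [DecidableEq V] (U : Finset V) (f : V → V) : ℕ := (U.filter fun x => f x = x).card

/-- Relative to the matching `m` with the exposed vertex `r`, the matching `f` covers all the
vertices covered by `m`, and `r`, with the exception of `x`. -/
structure IsNear (G : SimpleGraph V) (U : Finset V) (m : V → V) (r : V) (f : V → V) (x : V) :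
    Prop extends IsMatch G U f where
  fixed : ∀ u, f u = u ↔ u = x ∨ (m u = u ∧ u ≠ r)

/-- Berge's theorem: a matching that is not maximum has an augmenting path. -/
theorem IsMatch.exists_augmentation [Finite V] [DecidableEq V] {m : V → V} (hm : IsMatch G U m)
    (hg : IsMatch G U g) (hlt : exposed U g < exposed U m) :
    ∃ r e x f, r ∈ U ∧ e ∈ U ∧ r ≠ e ∧ m r = r ∧ m e = e ∧ IsNear G U m r f x ∧ G.Adj x e := by
  classical
  obtain ⟨r, e, hrU, hr, hre, he, hlink, hends, hgO⟩ : ∃ r e, r ∈ U ∧ m r = r ∧ e ≠ r ∧ m e = e ∧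
      Linked m g r e ∧ (∀ z, Linked m g r z → m z = z → z = r ∨ z = e) ∧
      ∀ z, Linked m g r z → g z ≠ z := by
    -- If every path from a vertex exposed by `m` ended at a vertex exposed by `g`, the ends would
    -- inject the former vertices into the latter, against `hlt`. So some path joins two vertices
    -- exposed by `m`.
    by_contra hcon
    have hex (r : V) (hr : r ∈ U.filter fun x => m x = x) :
        ∃ y, Linked m g r y ∧ g y = y ∧ ∀ z, Linked m g r z → m z = z → z = r := by
      rw [Finset.mem_filter] at hr
      rcases Linked.ends hm.invol hg.invol hr.2 with ⟨y, h1, h2, h3, h4, h5⟩ | ⟨y, h1, h2, h3, h4⟩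
      · exact (hcon ⟨r, y, hr.1, hr.2, h2, h3, h1, h4, h5⟩).elim
      · exact ⟨y, h1, h2, h3⟩
    choose! φ h1 h2 h3 using hex
    refine hlt.not_ge (Finset.card_le_card_of_injOn φ (fun r hr => ?_) fun r hr r' hr' h => ?_)
    · have hr' := Finset.mem_filter.1 hr
      exact Finset.mem_filter.2 ⟨hm.linked_mem hg (h1 r hr) hr'.1, h2 r hr⟩
    · refine (h3 r hr r' ?_ (Finset.mem_filter.1 hr').2).symm
      exact (h1 r hr).trans (h ▸ (h1 r' hr').symm hm.invol hg.invol)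
  have heU := hm.linked_mem hg hlink hrU
  set O : Set V := {z | Linked m g r z} with hO
  have hflip := hm.flip hg O (fun x hx => Linked.left hx) (fun x hx => Linked.right hx)
  -- The last edge of the exchanged path, between `g e` and `e`, is dropped: what is left is near
  -- `m` and exposes `g e`, and the dropped edge is the augmenting one.
  have her := hflip.erase e
  refine ⟨r, e, g e, _, hrU, heU, hre.symm, hr, he, ⟨her, fun u => ?_⟩,
    (hg.adj e (hgO e hlink)).symm⟩
  have heO : e ∈ O := hlink
  simp only [heO, if_true]
  by_cases hu : u = e ∨ u = g e
  · simp only [hu, if_true, true_iff]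
    rcases hu with rfl | rfl
    · exact Or.inr ⟨he, hre⟩
    · exact Or.inl rfl
  · simp only [hu, if_false]
    rw [not_or] at hu
    by_cases huO : u ∈ O
    · simp only [huO, if_true, hgO u huO, hu.2, false_or, false_iff, not_and, not_not]
      intro h
      exact (hends u huO h).resolve_right hu.1
    · simp only [huO, if_false, hu.2, false_or, iff_self_and]
      rintro - rfl
      exact huO (Linked.refl _)

end Matchings

/-! ## Packings by edges and triangles -/

section Packings

variable {V : Type*} [DecidableEq V]

/-- `U` is partitioned into edges and `t` triangles of `G`. -/
inductive Packable (G : SimpleGraph V) : Finset V → ℕ → Prop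
  | empty : Packable G ∅ 0
  | edge {U e : Finset V} {t : ℕ} :
      Packable G U t → G.IsNClique 2 e → Disjoint e U → Packable G (e ∪ U) t
  | triangle {U e : Finset V} {t : ℕ} :
      Packable G U t → G.IsNClique 3 e → Disjoint e U → Packable G (e ∪ U) (t + 1)

variable {G : SimpleGraph V} {U W : Finset V} {f g : V → V} {t : ℕ}

namespace Packable

theorem union {s : ℕ} (hU : Packable G U t) (hW : Packable G W s) (h : Disjoint U W) :
    Packable G (U ∪ W) (t + s) := by
  induction hU with
  | empty => simpa
  | edge _ he hd ih =>
    rw [Finset.disjoint_union_left] at h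
    rw [Finset.union_assoc]
    exact (ih h.2).edge he (Finset.disjoint_union_right.2 ⟨hd, h.1⟩)
  | triangle _ he hd ih =>
    rw [Finset.disjoint_union_left] at h
    rw [Finset.union_assoc, add_right_comm]
    exact (ih h.2).triangle he (Finset.disjoint_union_right.2 ⟨hd, h.1⟩)

theorem of_edge {x y : V} (h : G.Adj x y) : Packable G {x, y} 0 := by
  have := (empty (G := G)).edge (e := {x, y})
    ⟨by simp [SimpleGraph.isClique_iff, Set.pairwise_insert, h, h.symm],
      Finset.card_pair h.ne⟩ (Finset.disjoint_empty_right _)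
  simpa using this

theorem of_triangles {T : Finset (Finset V)} (hT : ∀ τ ∈ T, G.IsNClique 3 τ)
    (hd : ∀ τ ∈ T, ∀ σ ∈ T, ∀ x, x ∈ τ → x ∈ σ → τ = σ) :
    Packable G (T.biUnion id) T.card := by
  induction T using Finset.induction_on with
  | empty => exact empty
  | insert τ T hτ ih =>
    rw [Finset.biUnion_insert, Finset.card_insert_of_notMem hτ]
    refine (ih (fun σ hσ => hT σ (Finset.mem_insert_of_mem hσ)) fun σ hσ ρ hρ => hd σ
      (Finset.mem_insert_of_mem hσ) ρ (Finset.mem_insert_of_mem hρ)).triangle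
      (hT τ (Finset.mem_insert_self _ _)) (Finset.disjoint_left.2 fun x hx hx' => ?_)
    obtain ⟨σ, hσ, hxσ⟩ := Finset.mem_biUnion.1 hx'
    exact hτ (hd τ (Finset.mem_insert_self _ _) σ (Finset.mem_insert_of_mem hσ) x hx hxσ ▸ hσ)

/-- Removing a vertex of one triangle. -/
theorem of_triangles_erase {T : Finset (Finset V)} (hT : ∀ τ ∈ T, G.IsNClique 3 τ)
    (hd : ∀ τ ∈ T, ∀ σ ∈ T, ∀ x, x ∈ τ → x ∈ σ → τ = σ) {τ : Finset V} {x : V} (hτ : τ ∈ T)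
    (hx : x ∈ τ) (h : Packable G ((T.erase τ).biUnion id) t) :
    Packable G ((T.biUnion id).erase x) t := by
  have h2 := h.edge ((hT τ hτ).erase_of_mem hx) (Finset.disjoint_left.2 fun u hu hu' => by
    obtain ⟨σ, hσ, huσ⟩ := Finset.mem_biUnion.1 hu'
    rw [Finset.mem_erase] at hσ hu
    exact hσ.1 (hd σ hσ.2 τ hτ u huσ hu.2))
  convert h2 using 1
  ext u
  simp only [Finset.mem_erase, Finset.mem_biUnion, Finset.mem_union, id]
  constructor
  · rintro ⟨hux, σ, hσ, huσ⟩
    by_cases h' : σ = τ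
    · exact Or.inl ⟨hux, h' ▸ huσ⟩
    · exact Or.inr ⟨σ, ⟨h', hσ⟩, huσ⟩
  · rintro (⟨hux, hu⟩ | ⟨σ, ⟨h', hσ⟩, huσ⟩)
    · exact ⟨hux, τ, hτ, hu⟩
    · exact ⟨fun h => h' (hd σ hσ τ hτ u huσ (h ▸ hx)), σ, hσ, huσ⟩

/-- Removing a vertex from each of two triangles. -/
theorem of_triangles_erase_erase {T : Finset (Finset V)} (hT : ∀ τ ∈ T, G.IsNClique 3 τ)
    (hd : ∀ τ ∈ T, ∀ σ ∈ T, ∀ x, x ∈ τ → x ∈ σ → τ = σ) {τ σ : Finset V} {x y : V}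
    (hτ : τ ∈ T) (hσ : σ ∈ T) (hne : τ ≠ σ) (hx : x ∈ τ) (hy : y ∈ σ) :
    Packable G (((T.biUnion id).erase x).erase y) (T.card - 2) := by
  have hd' : ∀ ρ ∈ T.erase τ, ∀ ρ' ∈ T.erase τ, ∀ x, x ∈ ρ → x ∈ ρ' → ρ = ρ' :=
    fun ρ hρ ρ' hρ' => hd ρ (Finset.mem_of_mem_erase hρ) ρ' (Finset.mem_of_mem_erase hρ')
  have hT' : ∀ ρ ∈ T.erase τ, G.IsNClique 3 ρ := fun ρ hρ => hT ρ (Finset.mem_of_mem_erase hρ)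
  have hσ' : σ ∈ T.erase τ := Finset.mem_erase.2 ⟨hne.symm, hσ⟩
  have h1 := of_triangles_erase hT' hd' hσ' hy (of_triangles (T := (T.erase τ).erase σ)
    (fun ρ hρ => hT' ρ (Finset.mem_of_mem_erase hρ)) fun ρ hρ ρ' hρ' =>
      hd' ρ (Finset.mem_of_mem_erase hρ) ρ' (Finset.mem_of_mem_erase hρ'))
  have hτU : ∀ u ∈ τ, u ∉ (T.erase τ).biUnion id := fun u hu hu' => by
    obtain ⟨ρ, hρ, huρ⟩ := Finset.mem_biUnion.1 hu'
    rw [Finset.mem_erase] at hρ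
    exact hρ.1 (hd ρ hρ.2 τ hτ u huρ hu)
  have h2 := h1.edge ((hT τ hτ).erase_of_mem hx) (Finset.disjoint_left.2 fun u hu hu' =>
    hτU u (Finset.mem_of_mem_erase hu) (Finset.mem_of_mem_erase hu'))
  have hyτ : y ∉ τ := fun h => hne (hd τ hτ σ hσ y h hy)
  have hxU := hτU x hx
  have hTτ : T.biUnion id = τ ∪ (T.erase τ).biUnion id := by
    conv_lhs => rw [← Finset.insert_erase hτ]
    rw [Finset.biUnion_insert, id]
  rw [Finset.card_erase_of_mem hσ', Finset.card_erase_of_mem hτ, Nat.sub_sub] at h2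
  convert h2 using 1
  rw [hTτ]
  ext u
  simp only [Finset.mem_erase, Finset.mem_union]
  constructor
  · rintro ⟨h1, h2, h3 | h3⟩ <;> simp [*]
  · rintro (⟨h1, h2⟩ | ⟨h1, h2⟩)
    · exact ⟨fun h => hyτ (h ▸ h2), h1, Or.inl h2⟩
    · exact ⟨h1, fun h => hxU (h ▸ h2), Or.inr h2⟩

/-- A matching together with a packing of its exposed vertices is a packing. -/
theorem of_isMatch (hf : IsMatch G U f) (h : Packable G (U.filter fun x => f x = x) t) :
    Packable G U t := by
  -- Matching edges are peeled off one at a time from a set `W` of covered vertices that is closed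
  -- under `f`.
  have key : ∀ n, ∀ W ⊆ U, W.card = n → (∀ x ∈ W, f x ∈ W ∧ f x ≠ x) →
      Packable G (W ∪ U.filter fun x => f x = x) t := by
    intro n
    induction n using Nat.strong_induction_on with
    | _ n ih =>
      intro W hWU hn hW
      rcases W.eq_empty_or_nonempty with rfl | ⟨x, hx⟩
      · simpa
      · obtain ⟨hfx, hne⟩ := hW x hx
        have hsub : ({x, f x} : Finset V) ⊆ W := by
          simp [Finset.insert_subset_iff, hx, hfx]
        have hlt : (W \ {x, f x}).card < n :=
          hn ▸ Finset.card_lt_card (Finset.sdiff_ssubset hsub ⟨x, by simp⟩)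
        have := ih _ hlt (W \ {x, f x}) (Finset.sdiff_subset.trans hWU) rfl ?_
        · have h2 := (of_edge (hf.adj x hne)).union this ?_
          · rw [← Finset.union_assoc, Finset.union_sdiff_of_subset hsub, zero_add] at h2
            exact h2
          · rw [Finset.disjoint_left]
            intro u hu
            simp only [Finset.mem_insert, Finset.mem_singleton] at hu
            rcases hu with rfl | rfl
            · simp [hne]
            · simp [hf.invol x, hne.symm]
        · intro u hu
          simp only [Finset.mem_sdiff, Finset.mem_insert, Finset.mem_singleton, not_or] at hu ⊢
          refine ⟨⟨(hW u hu.1).1, ?_, ?_⟩, (hW u hu.1).2⟩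
          · intro h'; exact hu.2.2 (by rw [← h', hf.invol])
          · intro h'; exact hu.2.1 (hf.invol.injective h')
  have := key _ (U.filter fun x => f x ≠ x) (Finset.filter_subset _ _) rfl ?_
  · rwa [Finset.union_comm, Finset.filter_union_filter_not_eq] at this
  · intro x hx
    rw [Finset.mem_filter] at hx ⊢
    exact ⟨⟨hf.mem_image hx.1, fun h' => hx.2 (hf.invol.injective h')⟩, hx.2⟩

/-- The edges and the triangles of a packing. -/
theorem exists_isMatch (h : Packable G U t) :
    ∃ (f : V → V) (T : Finset (Finset V)), IsMatch G U f ∧ T.card = t ∧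
      (∀ τ ∈ T, G.IsNClique 3 τ) ∧ (∀ τ ∈ T, ∀ σ ∈ T, ∀ x, x ∈ τ → x ∈ σ → τ = σ) ∧
      U.filter (fun x => f x = x) = T.biUnion id := by
  induction h with
  | empty =>
    exact ⟨id, ∅, ⟨fun _ => rfl, fun _ h => (h rfl).elim, fun _ h => (h rfl).elim⟩, rfl, by simp,
      by simp, by simp⟩
  | @edge U e t _ he hd ih =>
    obtain ⟨f, T, hf, hc, hT, hdT, hfix⟩ := ih
    obtain ⟨x, y, hxy, rfl⟩ := Finset.card_eq_two.1 he.card_eq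
    rw [Finset.disjoint_left] at hd
    have hxU : x ∉ U := hd (by simp)
    have hyU : y ∉ U := hd (by simp)
    have hfx : f x = x := by_contra fun h => hxU (hf.mem x h)
    have hfy : f y = y := by_contra fun h => hyU (hf.mem y h)
    have hadj : G.Adj x y := he.isClique (by simp) (by simp) hxy
    refine ⟨_, T, (hf.mono Finset.subset_union_right).add hfx hfy hadj (by simp) (by simp), hc, hT,
      hdT, ?_⟩
    rw [← hfix]
    ext u
    rcases eq_or_ne u y with rfl | h2
    · simp [hxy, hyU]
    · rcases eq_or_ne u x with rfl | h1
      · simp [hxy, hxy.symm, hxU]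
      · simp [h1, h2]
  | @triangle U e t _ he hd ih =>
    obtain ⟨f, T, hf, hc, hT, hdT, hfix⟩ := ih
    rw [Finset.disjoint_left] at hd
    have hne : e.Nonempty := Finset.card_pos.1 (by rw [he.card_eq]; norm_num)
    have hTU : ∀ τ ∈ T, ∀ x ∈ τ, x ∈ U := fun τ hτ x hx => by
      have : x ∈ T.biUnion id := Finset.mem_biUnion.2 ⟨τ, hτ, hx⟩
      rw [← hfix] at this
      exact (Finset.mem_filter.1 this).1
    have heT : e ∉ T := fun h => by
      obtain ⟨x, hx⟩ := hne
      exact hd hx (hTU e h x hx)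
    refine ⟨f, insert e T, hf.mono Finset.subset_union_right,
      by rw [Finset.card_insert_of_notMem heT, hc], ?_, ?_, ?_⟩
    · intro τ hτ
      rcases Finset.mem_insert.1 hτ with rfl | hτ
      · exact he
      · exact hT τ hτ
    · intro τ hτ σ hσ x hxτ hxσ
      rcases Finset.mem_insert.1 hτ with h1 | h1 <;> rcases Finset.mem_insert.1 hσ with h2 | h2
      · rw [h1, h2]
      · exact (hd (h1 ▸ hxτ) (hTU _ h2 x hxσ)).elim
      · exact (hd (h2 ▸ hxσ) (hTU _ h1 x hxτ)).elim
      · exact hdT τ h1 σ h2 x hxτ hxσ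
    · rw [Finset.biUnion_insert, ← hfix, Finset.filter_union, id]
      congr 1
      refine Finset.filter_true_of_mem fun x hx => ?_
      by_contra h
      exact hd hx (hf.mem x h)

/-- Removing one vertex from every triangle of a packing leaves a matching. -/
theorem exists_exposed_le (h : Packable G U t) : ∃ g, IsMatch G U g ∧ exposed U g ≤ t := by
  have key {U : Finset V} {g : V → V} (hg : IsMatch G U g) {x y : V} (hxU : x ∉ U) (hyU : y ∉ U)
      (hadj : G.Adj x y) (W : Finset V) (hx : x ∈ W) (hy : y ∈ W) (hUW : U ⊆ W) :
      ∃ g', IsMatch G W g' ∧ ∀ u, g' u = u → u ≠ x ∧ u ≠ y ∧ g u = u := by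
    have hfx : g x = x := by_contra fun h => hxU (hg.mem x h)
    have hfy : g y = y := by_contra fun h => hyU (hg.mem y h)
    refine ⟨_, (hg.mono hUW).add hfx hfy hadj hx hy, fun u hu => ?_⟩
    rcases eq_or_ne u y with rfl | h2
    · simp [hadj.ne] at hu
    · rcases eq_or_ne u x with rfl | h1
      · simp [hadj.ne, hadj.ne'] at hu
      · exact ⟨h1, h2, by simpa [h1, h2] using hu⟩
  induction h with
  | empty =>
    exact ⟨id, ⟨fun _ => rfl, fun _ h => (h rfl).elim, fun _ h => (h rfl).elim⟩, le_rfl⟩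
  | @edge U e t _ he hd ih =>
    obtain ⟨g, hg, hle⟩ := ih
    obtain ⟨x, y, hxy, rfl⟩ := Finset.card_eq_two.1 he.card_eq
    rw [Finset.disjoint_left] at hd
    obtain ⟨g', hg', h⟩ := key hg (hd (by simp)) (hd (by simp))
      (he.isClique (by simp) (by simp) hxy) ({x, y} ∪ U) (by simp) (by simp)
      Finset.subset_union_right
    refine ⟨g', hg', (Finset.card_le_card fun u hu => ?_).trans hle⟩
    rw [Finset.mem_filter] at hu ⊢
    have := h u hu.2
    simp only [Finset.mem_union, Finset.mem_insert, Finset.mem_singleton] at hu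
    tauto
  | @triangle U e t _ he hd ih =>
    obtain ⟨g, hg, hle⟩ := ih
    obtain ⟨a, b, c, hab, hac, hbc, rfl⟩ := SimpleGraph.is3Clique_iff.1 he
    rw [Finset.disjoint_left] at hd
    obtain ⟨g', hg', h⟩ := key hg (hd (by simp)) (hd (by simp)) hab ({a, b, c} ∪ U) (by simp)
      (by simp) Finset.subset_union_right
    refine ⟨g', hg', ?_⟩
    have : ({a, b, c} ∪ U).filter (fun u => g' u = u) ⊆
        insert c (U.filter fun u => g u = u) := by
      intro u hu
      rw [Finset.mem_filter] at hu
      rw [Finset.mem_insert, Finset.mem_filter]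
      have := h u hu.2
      simp only [Finset.mem_union, Finset.mem_insert, Finset.mem_singleton] at hu
      tauto
    exact (Finset.card_le_card this).trans ((Finset.card_insert_le _ _).trans
      (Nat.succ_le_succ hle))

end Packable

/-! ### Packings with the minimum number of triangles -/

/-- A matching whose exposed vertices are partitioned into triangles. -/
structure TriMatch (G : SimpleGraph V) (U : Finset V) (f : V → V) (T : Finset (Finset V)) :
    Prop extends IsMatch G U f where
  clique : ∀ τ ∈ T, G.IsNClique 3 τ
  disj : ∀ τ ∈ T, ∀ σ ∈ T, ∀ x, x ∈ τ → x ∈ σ → τ = σ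
  fix : U.filter (fun x => f x = x) = T.biUnion id

/-- No packing of `U` has fewer than `t` triangles. -/
def MinTri (G : SimpleGraph V) (U : Finset V) (t : ℕ) : Prop := ∀ s, Packable G U s → t ≤ s

namespace TriMatch

variable {T : Finset (Finset V)} {τ σ : Finset V} {x y : V}

theorem mem_iff (h : TriMatch G U f T) : (x ∈ U ∧ f x = x) ↔ ∃ τ ∈ T, x ∈ τ := by
  rw [← Finset.mem_filter (p := fun x => f x = x), h.fix]
  simp

theorem mem_fix (h : TriMatch G U f T) (hτ : τ ∈ T) (hx : x ∈ τ) : x ∈ U ∧ f x = x :=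
  h.mem_iff.2 ⟨τ, hτ, hx⟩

/-- In a packing with the minimum number of triangles no two triangles are linked. -/
theorem eq_of_linked [Finite V] (h : TriMatch G U f T) (hmin : MinTri G U T.card)
    (hg : IsMatch G U g) (hτ : τ ∈ T) (hσ : σ ∈ T) (hx : x ∈ τ) (hy : y ∈ σ)
    (hxy : Linked f g x y) : τ = σ := by
  classical
  by_contra hne
  have hxf := h.mem_fix hτ hx
  have hyf := h.mem_fix hσ hy
  have hxy' : x ≠ y := fun h' => hne (h.disj τ hτ σ hσ x hx (h' ▸ hy))
  have hun := fun u (hu : Linked f g x u) =>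
    Linked.unique_of_left h.invol hg.invol hxf.2 hyf.2 hxy' hxy hu
  -- The exchange covers both ends `x` and `y` of the path. Each of the two triangles shrinks to an
  -- edge, so two triangles are saved.
  have hflip := h.toIsMatch.flip hg {z | Linked f g x z} (fun _ hx => Linked.left hx)
    fun _ hx => Linked.right hx
  have hle := hmin _ (Packable.of_isMatch (t := T.card - 2) hflip ?_)
  · have : 1 < T.card := Finset.one_lt_card.2 ⟨τ, hτ, σ, hσ, hne⟩
    omega
  · convert Packable.of_triangles_erase_erase h.clique h.disj hτ hσ hne hx hy using 1
    rw [← h.fix]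
    ext u
    simp only [Set.mem_ofPred_eq, Finset.mem_filter, Finset.mem_erase]
    by_cases hu : Linked f g x u
    · have := hun u hu
      simp only [hu, if_true]
      tauto
    · simp only [hu, if_false]
      have h1 : u ≠ x := by rintro rfl; exact hu (Linked.refl _)
      have h2 : u ≠ y := by rintro rfl; exact hu hxy
      tauto

/-- Every triangle of a packing with the minimum number of triangles is linked to a vertex
exposed by `g`. -/
theorem exists_linked [Finite V] (h : TriMatch G U f T) (hmin : MinTri G U T.card)
    (hg : IsMatch G U g) (hτ : τ ∈ T) : ∃ x ∈ τ, ∃ z ∈ U, Linked f g x z ∧ g z = z := by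
  by_contra hcon
  -- A path from `τ` that misses the vertices exposed by `g` ends at a triangle vertex, hence in `τ`
  -- again. The three vertices of `τ` would be paired off by such paths.
  have hother : ∀ x ∈ τ, ∃ y ∈ τ, y ≠ x ∧ Linked f g x y := by
    intro x hx
    have hxf := h.mem_fix hτ hx
    rcases Linked.ends h.invol hg.invol hxf.2 with ⟨y, h1, h2, h3, -, -⟩ | ⟨y, h1, h2, -, -⟩
    · obtain ⟨σ, hσ, hy⟩ := h.mem_iff.1 ⟨h.linked_mem hg h1 hxf.1, h3⟩
      exact ⟨y, h.eq_of_linked hmin hg hτ hσ hx hy h1 ▸ hy, h2, h1⟩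
    · exact (hcon ⟨x, hx, y, h.linked_mem hg h1 hxf.1, h1, h2⟩).elim
  have huniq : ∀ x ∈ τ, ∀ y ∈ τ, ∀ z ∈ τ, x ≠ y → Linked f g x y → Linked f g x z →
      z = x ∨ z = y := fun x hx y hy z hz hne hxy hxz =>
    (Linked.unique_of_left h.invol hg.invol (h.mem_fix hτ hx).2 (h.mem_fix hτ hy).2 hne hxy
      hxz).1 (h.mem_fix hτ hz).2
  have hsym := fun {x y : V} (hxy : Linked f g x y) => hxy.symm h.invol hg.invol
  obtain ⟨a, b, c, hab, hac, hbc, rfl⟩ := SimpleGraph.is3Clique_iff.1 (h.clique τ hτ)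
  have hab := hab.ne
  have hac := hac.ne
  have hbc := hbc.ne
  obtain ⟨y, hy, hya, hlink⟩ := hother a (by simp)
  simp only [Finset.mem_insert, Finset.mem_singleton] at hy
  rcases hy with rfl | rfl | rfl
  · exact hya rfl
  · obtain ⟨z, hz, hzc, hl⟩ := hother c (by simp)
    simp only [Finset.mem_insert, Finset.mem_singleton] at hz
    rcases hz with rfl | rfl | rfl
    · rcases huniq z (by simp) y (by simp) c (by simp) hab hlink (hsym hl) with h | h
      · exact hac h.symm
      · exact hbc h.symm
    · rcases huniq a (by simp) z (by simp) c (by simp) hab hlink (hlink.trans (hsym hl)) with h | h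
      · exact hac h.symm
      · exact hbc h.symm
    · exact hzc rfl
  · obtain ⟨z, hz, hzc, hl⟩ := hother b (by simp)
    simp only [Finset.mem_insert, Finset.mem_singleton] at hz
    rcases hz with rfl | rfl | rfl
    · rcases huniq z (by simp) y (by simp) b (by simp) hac hlink (hsym hl) with h | h
      · exact hab h.symm
      · exact hbc h
    · exact hzc rfl
    · rcases huniq a (by simp) z (by simp) b (by simp) hac hlink (hlink.trans (hsym hl)) with h | h
      · exact hab h.symm
      · exact hbc h

/-- The number of triangles is at most the number of vertices exposed by a matching. -/
theorem card_le_exposed [Finite V] (h : TriMatch G U f T) (hmin : MinTri G U T.card)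
    (hg : IsMatch G U g) : T.card ≤ exposed U g := by
  have hex := fun τ (hτ : τ ∈ T) => h.exists_linked hmin hg hτ
  rcases T.eq_empty_or_nonempty with rfl | ⟨τ₀, hτ₀⟩
  · simp
  have : Nonempty V := ⟨(h.exists_linked hmin hg hτ₀).choose⟩
  choose! x hx z hzU hlink hz using hex
  refine Finset.card_le_card_of_injOn z (fun τ hτ => Finset.mem_filter.2 ⟨hzU τ hτ, hz τ hτ⟩)
    fun τ hτ σ hσ hzz => ?_
  refine h.eq_of_linked hmin hg hτ hσ (hx τ hτ) (hx σ hσ) ((hlink τ hτ).trans ?_)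
  rw [hzz]
  exact (hlink σ hσ).symm h.invol hg.invol

/-- Two adjacent vertices exposed by `g` are not linked to two different triangles of a packing
with the minimum number of triangles. -/
theorem eq_of_linked_of_adj [Finite V] (h : TriMatch G U f T) (hmin : MinTri G U T.card)
    (hg : IsMatch G U g) (hτ : τ ∈ T) (hσ : σ ∈ T) (hx : x ∈ τ) (hy : y ∈ σ) {v w : V}
    (hvw : G.Adj v w) (hv : g v = v) (hw : g w = w) (hxv : Linked f g x v)
    (hyw : Linked f g y w) : τ = σ := by
  classical
  by_contra hne
  have hxf := h.mem_fix hτ hx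
  have hyf := h.mem_fix hσ hy
  have hunx := fun u (hu : Linked f g x u) =>
    Linked.unique_of_mixed h.invol hg.invol hxf.2 hv hxv hu
  have huny := fun u (hu : Linked f g y u) =>
    Linked.unique_of_mixed h.invol hg.invol hyf.2 hw hyw hu
  -- Exchanging along both paths covers `x` and `y` and exposes `v` and `w`, which the edge between
  -- them then covers. Again two triangles are saved.
  have hflip := h.toIsMatch.flip hg {z | Linked f g x z ∨ Linked f g y z}
    (fun _ hx => hx.imp Linked.left Linked.left) fun _ hx => hx.imp Linked.right Linked.right
  have hle := hmin _ (Packable.of_isMatch (t := T.card - 2) hflip ?_)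
  · have : 1 < T.card := Finset.one_lt_card.2 ⟨τ, hτ, σ, hσ, hne⟩
    omega
  · have hp := Packable.of_triangles_erase_erase h.clique h.disj hτ hσ hne hx hy
    rw [← h.fix] at hp
    have hp2 := hp.union (Packable.of_edge hvw) ?_
    · rw [add_zero] at hp2
      convert hp2 using 1
      ext u
      simp only [Set.mem_ofPred_eq, Finset.mem_filter, Finset.mem_erase, Finset.mem_union,
        Finset.mem_insert, Finset.mem_singleton]
      by_cases hu : Linked f g x u ∨ Linked f g y u
      · simp only [hu, if_true]
        have hvU := h.linked_mem hg hxv hxf.1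
        have hwU := h.linked_mem hg hyw hyf.1
        constructor
        · rintro ⟨-, h2⟩
          exact Or.inr (hu.imp (fun hu => (hunx u hu).2 h2) fun hu => (huny u hu).2 h2)
        · rintro (⟨h1, h2, h3, h4⟩ | rfl | rfl)
          · exact hu.elim (fun hu => (h2 ((hunx u hu).1 h4)).elim)
              fun hu => (h1 ((huny u hu).1 h4)).elim
          · exact ⟨hvU, hv⟩
          · exact ⟨hwU, hw⟩
      · simp only [hu, if_false]
        rw [not_or] at hu
        have h1 : u ≠ x := by rintro rfl; exact hu.1 (Linked.refl _)
        have h2 : u ≠ y := by rintro rfl; exact hu.2 (Linked.refl _)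
        have h3 : u ≠ v := by rintro rfl; exact hu.1 hxv
        have h4 : u ≠ w := by rintro rfl; exact hu.2 hyw
        tauto
    · rw [Finset.disjoint_left]
      intro u hu hu'
      simp only [Finset.mem_filter, Finset.mem_erase, Finset.mem_insert,
        Finset.mem_singleton] at hu hu'
      rcases hu' with rfl | rfl
      · exact hu.2.1 ((hunx _ hxv).1 hu.2.2.2)
      · exact hu.1 ((huny _ hyw).1 hu.2.2.2)

end TriMatch

theorem Packable.exists_triMatch (h : Packable G U t) :
    ∃ s f T, TriMatch G U f T ∧ T.card = s ∧ MinTri G U s := by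
  classical
  have hex : ∃ s, Packable G U s := ⟨t, h⟩
  obtain ⟨f, T, h1, h2, h3, h4, h5⟩ := (Nat.find_spec hex).exists_isMatch
  exact ⟨_, f, T, ⟨h1, h3, h4, h5⟩, h2, fun s hs => Nat.find_min' hex hs⟩

/-- If `U` has a packing but no perfect matching, then removing some triangle lowers the number of
vertices that a maximum matching exposes. -/
theorem Packable.exists_triangle [Finite V] (h : Packable G U t) {m : V → V}
    (hm : IsMatch G U m) (hmax : ∀ g, IsMatch G U g → exposed U m ≤ exposed U g)
    (hpos : 0 < exposed U m) :
    ∃ τ ⊆ U, G.IsNClique 3 τ ∧ ∃ g, IsMatch G (U \ τ) g ∧ exposed (U \ τ) g < exposed U m := by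
  obtain ⟨s, f, T, hT, rfl, hmin⟩ := h.exists_triMatch
  have hle := hT.card_le_exposed hmin hm
  have hge : exposed U m ≤ T.card := by
    have hp := Packable.of_isMatch hT.toIsMatch
      (hT.fix ▸ Packable.of_triangles hT.clique hT.disj)
    obtain ⟨g, hg, hle⟩ := hp.exists_exposed_le
    exact (hmax g hg).trans hle
  -- Any triangle of a packing with the fewest triangles will do: the rest is packed with one
  -- triangle less, and keeping one edge of each triangle gives a matching with fewer exposed
  -- vertices.
  obtain ⟨τ, hτ⟩ := Finset.card_pos.1 (hpos.trans_le hge)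
  have hτU : τ ⊆ U := fun x hx => (hT.mem_fix hτ hx).1
  refine ⟨τ, hτU, hT.clique τ hτ, ?_⟩
  have hf : IsMatch G (U \ τ) f := ⟨hT.invol, hT.adj, fun x hx => Finset.mem_sdiff.2
    ⟨hT.mem x hx, fun hxτ => hx (hT.mem_fix hτ hxτ).2⟩⟩
  have hp : Packable G (U \ τ) (T.card - 1) := by
    refine Packable.of_isMatch hf ?_
    rw [← Finset.card_erase_of_mem hτ]
    convert Packable.of_triangles (T := T.erase τ)
      (fun σ hσ => hT.clique σ (Finset.mem_of_mem_erase hσ))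
      (fun σ hσ ρ hρ => hT.disj σ (Finset.mem_of_mem_erase hσ) ρ (Finset.mem_of_mem_erase hρ))
      using 1
    ext u
    simp only [Finset.mem_filter, Finset.mem_sdiff, Finset.mem_biUnion, Finset.mem_erase, id]
    constructor
    · rintro ⟨⟨hu, huτ⟩, hfu⟩
      obtain ⟨σ, hσ, huσ⟩ := hT.mem_iff.1 ⟨hu, hfu⟩
      exact ⟨σ, ⟨fun h => huτ (h ▸ huσ), hσ⟩, huσ⟩
    · rintro ⟨σ, ⟨hne, hσ⟩, huσ⟩
      obtain ⟨h1, h2⟩ := hT.mem_fix hσ huσ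
      exact ⟨⟨h1, fun huτ => hne (hT.disj σ hσ τ hτ u huσ huτ)⟩, h2⟩
  obtain ⟨g, hg, hle'⟩ := hp.exists_exposed_le
  exact ⟨g, hg, by omega⟩

/-- Exchanging `f` for `g` on a union of orbits whose exposed vertices are those of `τ`. -/
theorem TriMatch.packable_flip {T : Finset (Finset V)} (h : TriMatch G U f T)
    {τ : Finset V} (hg : IsMatch G (U \ τ) g) (O : Set V) [DecidablePred (· ∈ O)]
    (hOf : ∀ x ∈ O, f x ∈ O) (hOg : ∀ x ∈ O, g x ∈ O) (hτO : ∀ x ∈ τ, x ∈ O)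
    (hgO : ∀ x ∈ O, g x = x → x ∈ τ)
    (hp : Packable G ((T.biUnion id).filter fun x => x ∉ O) t) : Packable G (U \ τ) t := by
  have hflip := h.toIsMatch.flip (hg.mono Finset.sdiff_subset) O hOf hOg
  refine Packable.of_isMatch (f := fun x => if x ∈ O then g x else f x)
    ⟨hflip.invol, hflip.adj, fun x hx => Finset.mem_sdiff.2 ⟨hflip.mem x hx, fun hxτ => ?_⟩⟩ ?_
  · simp only [hτO x hxτ, if_true] at hx
    exact (Finset.mem_sdiff.1 (hg.mem x hx)).2 hxτ
  · convert hp using 1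
    rw [← h.fix]
    ext u
    simp only [Finset.mem_filter, Finset.mem_sdiff]
    by_cases hu : u ∈ O
    · simp only [hu, if_true, not_true, and_false, iff_false, not_and]
      exact fun h1 h2 => h1.2 (hgO u hu h2)
    · have : u ∉ τ := fun h => hu (hτO u h)
      simp [hu, this]

/-- If removing the triangle `τ` lowers the number of vertices that a maximum matching exposes,
then some packing, if there is any, contains `τ`. -/
theorem Packable.sdiff_triangle [Finite V] (h : Packable G U t) {m : V → V}
    (hmax : ∀ g, IsMatch G U g → exposed U m ≤ exposed U g) {τ : Finset V} (hτU : τ ⊆ U)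
    (hτ : G.IsNClique 3 τ) (hg : IsMatch G (U \ τ) g)
    (hlt : exposed (U \ τ) g < exposed U m) : ∃ s, Packable G (U \ τ) s := by
  classical
  obtain ⟨s, f, T, hT, rfl, hmin⟩ := h.exists_triMatch
  have hge : exposed U m ≤ T.card := by
    have hp := Packable.of_isMatch hT.toIsMatch
      (hT.fix ▸ Packable.of_triangles hT.clique hT.disj)
    obtain ⟨g, hg, hle⟩ := hp.exists_exposed_le
    exact (hmax g hg).trans hle
  have hgU : IsMatch G U g := hg.mono Finset.sdiff_subset
  have hfi := hT.invol
  have hgi := hg.invol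
  have hgτ : ∀ x ∈ τ, g x = x := fun x hx => by
    by_contra hne
    exact (Finset.mem_sdiff.1 (hg.mem x hne)).2 hx
  set μ := (U \ τ).filter fun x => g x = x with hμ
  have hμT : μ.card < T.card := hlt.trans_le hge
  have hsplit : ∀ z ∈ U, g z = z → z ∈ μ ∨ z ∈ τ := fun z hz hgz => by
    by_cases hzτ : z ∈ τ
    · exact Or.inr hzτ
    · exact Or.inl (Finset.mem_filter.2 ⟨Finset.mem_sdiff.2 ⟨hz, hzτ⟩, hgz⟩)
  have hμfix : ∀ z ∈ μ, g z = z ∧ z ∉ τ := fun z hz => by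
    have := Finset.mem_filter.1 hz
    exact ⟨this.2, (Finset.mem_sdiff.1 this.1).2⟩
  have hne : Nonempty V := by
    obtain ⟨σ, hσ⟩ := Finset.card_pos.1 (by omega : 0 < T.card)
    exact ⟨(hT.exists_linked hmin hgU hσ).choose⟩
  -- Otherwise each triangle is linked to a vertex of `μ`, different triangles to different
  -- vertices, although `μ` has fewer elements than `T`.
  obtain ⟨τ₀, hτ₀, hnoμ⟩ : ∃ τ₀ ∈ T, ∀ x ∈ τ₀, ∀ z ∈ μ, ¬ Linked f g x z := by
    by_contra! hcon
    choose! x hx z hz hlink using hcon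
    refine hμT.not_ge (Finset.card_le_card_of_injOn z hz fun σ hσ ρ hρ hzz => ?_)
    refine hT.eq_of_linked hmin hgU hσ hρ (hx σ hσ) (hx ρ hρ) ((hlink σ hσ).trans ?_)
    rw [hzz]
    exact (hlink ρ hρ).symm hfi hgi
  have hsym := fun {x y : V} (hxy : Linked f g x y) => hxy.symm hfi hgi
  have hend : ∀ x ∈ τ₀, (∃ z ∈ τ, Linked f g x z) ∨ ∃ y ∈ τ₀, y ≠ x ∧ Linked f g x y := by
    intro x hx
    have hxf := hT.mem_fix hτ₀ hx
    rcases Linked.ends hfi hgi hxf.2 with ⟨y, h1, h2, h3, -, -⟩ | ⟨y, h1, h2, -, -⟩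
    · obtain ⟨σ, hσ, hy⟩ := hT.mem_iff.1 ⟨hT.linked_mem hgU h1 hxf.1, h3⟩
      exact Or.inr ⟨y, hT.eq_of_linked hmin hgU hτ₀ hσ hx hy h1 ▸ hy, h2, h1⟩
    · exact Or.inl ⟨y, (hsplit y (hT.linked_mem hgU h1 hxf.1) h2).resolve_left
        fun hy => hnoμ x hx y hy h1, h1⟩
  have hmix : ∀ x ∈ τ₀, ∀ z ∈ τ, Linked f g x z → ∀ u, Linked f g x u →
      (f u = u → u = x) ∧ (g u = u → u = z) := fun x hx z hz hxz u hu =>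
    Linked.unique_of_mixed hfi hgi (hT.mem_fix hτ₀ hx).2 (hgτ z hz) hxz hu
  obtain ⟨x₀, hx₀, z₀, hz₀U, hlink₀, hgz₀⟩ := hT.exists_linked hmin hgU hτ₀
  have hz₀ : z₀ ∈ τ := (hsplit z₀ hz₀U hgz₀).resolve_left fun hz => hnoμ x₀ hx₀ z₀ hz hlink₀
  -- If all three paths from `τ₀` lead to `τ`, they pair the two triangles, and exchanging along
  -- them puts `τ` in the place of `τ₀`. Otherwise one path leads from `x₀` to `τ` and another joins
  -- the remaining vertices `b` and `c` of `τ₀`.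
  by_cases hall : ∀ x ∈ τ₀, ∃ z ∈ τ, Linked f g x z
  · choose! z hz hlink using hall
    have hinj : Set.InjOn z τ₀ := fun x hx y hy hxy =>
      ((hmix x hx _ (hz x hx) (hlink x hx) y
        ((hlink x hx).trans (hxy ▸ hsym (hlink y hy)))).1 (hT.mem_fix hτ₀ hy).2).symm
    have himg : τ₀.image z = τ := Finset.eq_of_subset_of_card_le
      (Finset.image_subset_iff.2 hz) (by
        rw [Finset.card_image_of_injOn hinj, (hT.clique τ₀ hτ₀).card_eq, hτ.card_eq])
    refine ⟨_, hT.packable_flip (t := (T.erase τ₀).card) hg {u | ∃ x ∈ τ₀, Linked f g x u}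
      (fun u ⟨x, hx, hu⟩ => ⟨x, hx, hu.left⟩) (fun u ⟨x, hx, hu⟩ => ⟨x, hx, hu.right⟩) ?_ ?_ ?_⟩
    · intro u hu
      rw [← himg, Finset.mem_image] at hu
      obtain ⟨x, hx, rfl⟩ := hu
      exact ⟨x, hx, hlink x hx⟩
    · rintro u ⟨x, hx, hu⟩ hgu
      rw [(hmix x hx _ (hz x hx) (hlink x hx) u hu).2 hgu]
      exact hz x hx
    · convert Packable.of_triangles (T := T.erase τ₀)
        (fun σ hσ => hT.clique σ (Finset.mem_of_mem_erase hσ))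
        (fun σ hσ ρ hρ => hT.disj σ (Finset.mem_of_mem_erase hσ) ρ (Finset.mem_of_mem_erase hρ))
        using 1
      ext u
      simp only [Finset.mem_filter, Finset.mem_biUnion, Finset.mem_erase, id, Set.mem_ofPred_eq]
      constructor
      · rintro ⟨⟨σ, hσ, huσ⟩, hu⟩
        exact ⟨σ, ⟨fun h => hu ⟨u, h ▸ huσ, Linked.refl u⟩, hσ⟩, huσ⟩
      · rintro ⟨σ, ⟨hne, hσ⟩, huσ⟩
        refine ⟨⟨σ, hσ, huσ⟩, ?_⟩
        rintro ⟨x, hx, hu⟩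
        exact hne (hT.eq_of_linked hmin hgU hτ₀ hσ hx huσ hu).symm
  · push Not at hall
    obtain ⟨b, hb, hbno⟩ := hall
    obtain ⟨c, hc, hcb, hbc⟩ := (hend b hb).resolve_left fun ⟨z, hz, h⟩ => hbno z hz h
    have hbcu := fun u (hu : Linked f g b u) => Linked.unique_of_left hfi hgi
      (hT.mem_fix hτ₀ hb).2 (hT.mem_fix hτ₀ hc).2 hcb.symm hbc hu
    have hx₀b : x₀ ≠ b := fun h => hbno z₀ hz₀ (h ▸ hlink₀)
    have hx₀c : x₀ ≠ c := fun h => hbno z₀ hz₀ (hbc.trans (h ▸ hlink₀))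
    have hτ₀eq : ∀ u ∈ τ₀, u = x₀ ∨ u = b ∨ u = c := by
      have : ({x₀, b, c} : Finset V) = τ₀ := Finset.eq_of_subset_of_card_le
        (by simp [Finset.insert_subset_iff, hx₀, hb, hc])
        (by rw [(hT.clique τ₀ hτ₀).card_eq, Finset.card_eq_three.2
          ⟨x₀, b, c, hx₀b, hx₀c, hcb.symm, rfl⟩])
      intro u hu
      rw [← this] at hu
      simpa using hu
    have hx₀mix := hmix x₀ hx₀ z₀ hz₀ hlink₀
    -- Such a `z` is adjacent to `z₀`, so minimality leaves only `σ = τ₀`; there the path of `x₀`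
    -- ends at `z₀`, and those of `b` and `c` avoid `τ`.
    have hno : ∀ z ∈ τ, z ≠ z₀ → ∀ σ ∈ T, ∀ y ∈ σ, ¬ Linked f g y z := by
      intro z hz hzz₀ σ hσ y hy hyz
      obtain rfl : τ₀ = σ := hT.eq_of_linked_of_adj hmin hgU hτ₀ hσ hx₀ hy
        (hτ.isClique hz₀ hz hzz₀.symm) hgz₀ (hgτ z hz) hlink₀ hyz
      rcases hτ₀eq y hy with rfl | rfl | rfl
      · exact hzz₀ ((hx₀mix z hyz).2 (hgτ z hz))
      · exact hbno z hz hyz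
      · exact hbno z hz (hbc.trans hyz)
    obtain ⟨z₁, hz₁, z₂, hz₂, h01, h02, h12, hτeq⟩ : ∃ z₁ ∈ τ, ∃ z₂ ∈ τ, z₀ ≠ z₁ ∧ z₀ ≠ z₂ ∧
        z₁ ≠ z₂ ∧ ∀ u ∈ τ, u = z₀ ∨ u = z₁ ∨ u = z₂ := by
      have : (τ.erase z₀).card = 2 := by rw [Finset.card_erase_of_mem hz₀, hτ.card_eq]
      obtain ⟨z₁, z₂, h12, he⟩ := Finset.card_eq_two.1 this
      have h1 : z₁ ∈ τ.erase z₀ := he ▸ by simp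
      have h2 : z₂ ∈ τ.erase z₀ := he ▸ by simp
      rw [Finset.mem_erase] at h1 h2
      refine ⟨z₁, h1.2, z₂, h2.2, h1.1.symm, h2.1.symm, h12, fun u hu => ?_⟩
      by_cases hu0 : u = z₀
      · exact Or.inl hu0
      · have : u ∈ τ.erase z₀ := Finset.mem_erase.2 ⟨hu0, hu⟩
        rw [he] at this
        simpa [hu0] using this
    -- The path from `z₁` meets no triangle of `T`, so its other end is exposed by `g`. An end `y`
    -- in `μ` is excluded by counting: the triangles other than `τ₀` would inject into `μ.erase y`.
    -- Hence the end is `z₂`.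
    have hz₁₂ : Linked f g z₁ z₂ ∧ ∀ u, Linked f g z₁ u → (g u = u → u = z₁ ∨ u = z₂) ∧
        f u ≠ u := by
      rcases Linked.ends hgi hfi (hgτ z₁ hz₁) with ⟨y, h1, h2, h3, h4, h5⟩ | ⟨y, h1, h2, h3, h4⟩
      · have hyU := hT.linked_mem hgU h1.swap (hτU hz₁)
        rcases hsplit y hyU h3 with hy | hy
        · exfalso
          have hcard : (T.erase τ₀).card ≤ (μ.erase y).card := by
            have := fun σ (hσ : σ ∈ T.erase τ₀) =>
              hT.exists_linked hmin hgU (Finset.mem_of_mem_erase hσ)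
            choose! x hx z hzU hlink hgz using this
            refine Finset.card_le_card_of_injOn z (fun σ hσ => ?_) fun σ hσ ρ hρ hzz => ?_
            · have hσT := Finset.mem_of_mem_erase hσ
              have hzy : z σ ≠ y := fun h' => by
                have : Linked f g (x σ) z₁ := (hlink σ hσ).trans (h' ▸ hsym h1.swap)
                exact hno z₁ hz₁ h01.symm σ hσT _ (hx σ hσ) this
              refine Finset.mem_erase.2 ⟨hzy, (hsplit _ (hzU σ hσ) (hgz σ hσ)).resolve_right
                fun hzτ => ?_⟩
              by_cases hz0 : z σ = z₀
              · refine (Finset.mem_erase.1 hσ).1 (hT.eq_of_linked hmin hgU hσT hτ₀ (hx σ hσ) hx₀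
                  ((hlink σ hσ).trans ?_))
                rw [hz0]
                exact hsym hlink₀
              · exact hno _ hzτ hz0 σ hσT _ (hx σ hσ) (hlink σ hσ)
            · refine hT.eq_of_linked hmin hgU (Finset.mem_of_mem_erase hσ)
                (Finset.mem_of_mem_erase hρ) (hx σ hσ) (hx ρ hρ) ((hlink σ hσ).trans ?_)
              rw [hzz]
              exact hsym (hlink ρ hρ)
          rw [Finset.card_erase_of_mem hτ₀, Finset.card_erase_of_mem hy] at hcard
          have := Finset.card_pos.2 ⟨y, hy⟩
          omega
        · rcases hτeq y hy with rfl | rfl | rfl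
          · exact (hno z₁ hz₁ h01.symm τ₀ hτ₀ x₀ hx₀ (hlink₀.trans (hsym h1.swap))).elim
          · exact (h2 rfl).elim
          · exact ⟨h1.swap, fun u hu => ⟨h4 u hu.swap, h5 u hu.swap⟩⟩
      · obtain ⟨σ, hσ, hyσ⟩ := hT.mem_iff.1 ⟨hT.linked_mem hgU h1.swap (hτU hz₁), h2⟩
        exact (hno z₁ hz₁ h01.symm σ hσ y hyσ (hsym h1.swap)).elim
    -- Exchanging along the path from `x₀` to `z₀` and the one from `z₁` to `z₂` frees exactly `τ`
    -- and covers `x₀`; the edge between `b` and `c` remains of `τ₀`.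
    refine ⟨_, hT.packable_flip (t := (T.erase τ₀).card) hg
      {u | Linked f g x₀ u ∨ Linked f g z₁ u}
      (fun u hu => hu.imp Linked.left Linked.left) (fun u hu => hu.imp Linked.right Linked.right)
      ?_ ?_ ?_⟩
    · intro u hu
      rcases hτeq u hu with rfl | rfl | rfl
      · exact Or.inl hlink₀
      · exact Or.inr (Linked.refl _)
      · exact Or.inr hz₁₂.1
    · rintro u (hu | hu) hgu
      · rw [(hx₀mix u hu).2 hgu]
        exact hz₀
      · rcases (hz₁₂.2 u hu).1 hgu with rfl | rfl
        · exact hz₁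
        · exact hz₂
    · convert Packable.of_triangles_erase hT.clique hT.disj hτ₀ hx₀
        (Packable.of_triangles (T := T.erase τ₀)
        (fun σ hσ => hT.clique σ (Finset.mem_of_mem_erase hσ))
        (fun σ hσ ρ hρ => hT.disj σ (Finset.mem_of_mem_erase hσ) ρ (Finset.mem_of_mem_erase hρ)))
        using 1
      rw [← hT.fix]
      ext u
      simp only [Finset.mem_filter, Finset.mem_erase, Set.mem_ofPred_eq, not_or]
      constructor
      · rintro ⟨h1, h2, -⟩
        exact ⟨fun h => h2 (h ▸ Linked.refl u), h1⟩
      · rintro ⟨h1, h2, h3⟩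
        exact ⟨⟨h2, h3⟩, fun hu => h1 ((hx₀mix u hu).1 h3), fun hu => (hz₁₂.2 u hu).2 h3⟩

end Packings

/-! ## Searching for augmenting paths -/

section Search

variable {V : Type*} [DecidableEq V]

/-- A vertex that is covered by `m` or equal to `r`. -/
def Cov (m : V → V) (r x : V) : Prop := m x ≠ x ∨ x = r

/-- Replace the edge at `y` by the edge between the exposed vertex `v` and `y`. -/
def rotate (f : V → V) (v y : V) : V → V := update (update (update f v y) y v) (f y) (f y)

/-- The memory of the search: `ts x` is the time when `x` was reached (`0` if it was not), `mx x`
a matching that exposes `x`, and `cnt` the number of vertices reached. -/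
structure Search (V : Type*) where
  ts : V → ℕ
  mx : V → V → V
  cnt : ℕ

namespace Search

/-- Recording a matching that exposes `z`. -/
def insert (κ : Search V) (f : V → V) (z : V) : Search V :=
  if κ.ts z = 0 then ⟨update κ.ts z (κ.cnt + 1), update κ.mx z f, κ.cnt + 1⟩ else κ

/-- The memory of `κ'` extends that of `κ`. -/
def Ext (κ κ' : Search V) : Prop := ∀ x, κ.ts x ≠ 0 → κ'.ts x = κ.ts x ∧ κ'.mx x = κ.mx x

theorem Ext.refl (κ : Search V) : Ext κ κ := fun _ _ => ⟨rfl, rfl⟩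

theorem Ext.ts_ne {κ κ' : Search V} (h : Ext κ κ') {x : V} (hx : κ.ts x ≠ 0) : κ'.ts x ≠ 0 := by
  rwa [(h x hx).1]

theorem Ext.trans {κ κ' κ'' : Search V} (h : Ext κ κ') (h' : Ext κ' κ'') : Ext κ κ'' :=
  fun x hx => ⟨(h' x (h.ts_ne hx)).1.trans (h x hx).1, (h' x (h.ts_ne hx)).2.trans (h x hx).2⟩

/-- Only the first matching found for a vertex is recorded, so entries never change. -/
theorem ext_insert (κ : Search V) (f : V → V) (z : V) : Ext κ (κ.insert f z) := by
  intro x hx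
  unfold insert
  split_ifs with h
  · have : x ≠ z := fun h' => hx (h' ▸ h)
    simp [this]
  · exact ⟨rfl, rfl⟩

theorem insert_ts_ne (κ : Search V) (f : V → V) (z : V) : (κ.insert f z).ts z ≠ 0 := by
  unfold insert
  split_ifs with h
  · simp
  · exact h

/-- The invariants of the search from the exposed vertex `r` of `m`. -/
structure Good (G : SimpleGraph V) (U : Finset V) (m : V → V) (r : V) (κ : Search V) : Prop where
  near : ∀ x, κ.ts x ≠ 0 → IsNear G U m r (κ.mx x) x
  cov : ∀ x, κ.ts x ≠ 0 → Cov m r x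
  le : ∀ x, κ.ts x ≤ κ.cnt
  root : κ.ts r = 1
  inj : ∀ x y, κ.ts x ≠ 0 → κ.ts x = κ.ts y → x = y
  -- This serves `Good.complete`: a matching recorded early must still contain those edges of `m`
  -- that lead from vertices reached later to unreached ones.
  early : ∀ x, κ.ts x ≠ 0 → ∀ u, κ.mx x u ≠ m u →
    (κ.ts u ≠ 0 ∧ κ.ts u ≤ κ.ts x) ∨ (κ.ts (m u) ≠ 0 ∧ κ.ts (m u) ≤ κ.ts x)

/-- A matching exposing the reached vertex `x` that may be recorded. -/
structure Work (G : SimpleGraph V) (U : Finset V) (m : V → V) (r : V) (κ : Search V)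
    (f : V → V) (x : V) : Prop where
  near : IsNear G U m r f x
  cov : Cov m r x
  ts : κ.ts x ≠ 0
  early : ∀ u, f u ≠ m u → κ.ts u ≠ 0 ∨ κ.ts (m u) ≠ 0

/-- The matching `g` contains the edges of `f` at the vertices that were not reached. -/
def Keeps (κ : Search V) (f g : V → V) : Prop := ∀ p, κ.ts (f p) = 0 → g p = f p

variable {G : SimpleGraph V} {U : Finset V} {m f : V → V} {r v x y z : V} {κ κ' : Search V}

theorem Ext.keeps (h : Ext κ κ') {g : V → V} (hk : Keeps κ f g) : Keeps κ' f g := fun p hp =>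
  hk p (by by_contra h'; exact h.ts_ne h' hp)

theorem Good.work (h : Good G U m r κ) (hx : κ.ts x ≠ 0) : Work G U m r κ (κ.mx x) x :=
  ⟨h.near x hx, h.cov x hx, hx, fun u hu => (h.early x hx u hu).imp And.left And.left⟩

theorem Work.ext (h : Work G U m r κ f x) (he : Ext κ κ') : Work G U m r κ' f x :=
  ⟨h.near, h.cov, he.ts_ne h.ts, fun u hu => (h.early u hu).imp he.ts_ne he.ts_ne⟩

theorem _root_.IsNear.cov_of_ne (h : IsNear G U m r f x) (hne : f y ≠ y) : Cov m r y := by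
  have := mt (h.fixed y).2 hne
  unfold Cov
  tauto

theorem _root_.IsNear.ne_of_cov (h : IsNear G U m r f x) (hc : Cov m r y) (hne : y ≠ x) :
    f y ≠ y := by
  intro h'
  have := (h.fixed y).1 h'
  unfold Cov at hc
  tauto

theorem _root_.IsNear.self (h : IsNear G U m r f x) : f x = x := (h.fixed x).2 (Or.inl rfl)

theorem _root_.IsNear.cov_map (h : IsNear G U m r f x) (hc : Cov m r y) (hne : y ≠ x) :
    Cov m r (f y) :=
  h.cov_of_ne fun h' => h.ne_of_cov hc hne (h.invol.injective h')

theorem rotate_apply_of_ne {u : V} (h1 : u ≠ v) (h2 : u ≠ y) (h3 : u ≠ f y) :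
    rotate f v y u = f u := by
  simp [rotate, h1, h2, h3]

/-- Erasing the edge at `y` and adding the edge `vy` moves the exposed vertex from `v` to `f y`. -/
theorem rotate_near (hm : IsMatch G U m) (hr : r ∈ U) (h : IsNear G U m r f v)
    (hv : Cov m r v) (hvy : G.Adj v y) (hy : Cov m r y) :
    IsNear G U m r (rotate f v y) (f y) := by
  have hU {x : V} (hx : Cov m r x) : x ∈ U := hx.elim (hm.mem x) fun h => h ▸ hr
  have hne := hvy.ne
  have hfy : f y ≠ y := h.ne_of_cov hy hne.symm
  have hyv : f y ≠ v := fun h' => hne (by rw [← h.invol y, h', h.self])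
  have hadd := (h.toIsMatch.erase y).add (x := v) (y := y) (by simp [hne, hyv.symm, h.self])
    (by simp) hvy (hU hv) (hU hy)
  have heq : rotate f v y =
      update (update (fun u => if u = y ∨ u = f y then u else f u) v y) y v := by
    funext u
    by_cases h1 : u = f y
    · subst h1
      simp [rotate, hfy, hyv]
    · by_cases h2 : u = y
      · subst h2
        simp [rotate, hfy.symm]
      · by_cases h3 : u = v
        · subst h3
          simp [rotate, hyv.symm, hne]
        · simp [rotate, h1, h2, h3]
  rw [← heq] at hadd
  refine ⟨hadd, fun u => ?_⟩
  by_cases h1 : u = f y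
  · subst h1
    simp [rotate]
  · simp only [h1, false_or]
    by_cases h2 : u = y
    · subst h2
      simp only [rotate, ne_eq, hfy.symm, not_false_eq_true, update_of_ne, update_self, hne,
        false_iff]
      unfold Cov at hy
      tauto
    · by_cases h3 : u = v
      · subst h3
        simp only [rotate, ne_eq, h1, h2, not_false_eq_true, update_of_ne, update_self, hne.symm,
          false_iff]
        unfold Cov at hv
        tauto
      · rw [rotate_apply_of_ne h3 h2 h1, h.fixed]
        tauto

/-- One move of the search. -/
theorem Good.move (hm : IsMatch G U m) (hr : r ∈ U) (h : Good G U m r κ)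
    (hw : Work G U m r κ f v) (hvy : G.Adj v y) (hy : Cov m r y) :
    Good G U m r (κ.insert (rotate f v y) (f y)) ∧
      Work G U m r (κ.insert (rotate f v y) (f y)) (rotate f v y) (f y) := by
  have hnear := rotate_near hm hr hw.near hw.cov hvy hy
  have hcov : Cov m r (f y) := hw.near.cov_map hy hvy.ne'
  have hext := κ.ext_insert (rotate f v y) (f y)
  have hts := κ.insert_ts_ne (rotate f v y) (f y)
  -- Only `y` needs care, as `v` and `f y` are reached: if `f y = m y`, the partner under `m` has
  -- just been reached, and otherwise `f` already differed from `m` at `y`.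
  have hearly : ∀ u, rotate f v y u ≠ m u → (κ.insert (rotate f v y) (f y)).ts u ≠ 0 ∨
      (κ.insert (rotate f v y) (f y)).ts (m u) ≠ 0 := by
    intro u hu
    by_cases h1 : u = f y
    · exact Or.inl (h1 ▸ hts)
    · by_cases h3 : u = v
      · exact Or.inl (h3 ▸ hext.ts_ne hw.ts)
      · by_cases h2 : u = y
        · by_cases h4 : f y = m y
          · exact Or.inr (by rw [h2, ← h4]; exact hts)
          · exact (h2 ▸ hw.early y h4).imp hext.ts_ne hext.ts_ne
        · rw [rotate_apply_of_ne h3 h2 h1] at hu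
          exact (hw.early u hu).imp hext.ts_ne hext.ts_ne
  refine ⟨?_, hnear, hcov, hts, hearly⟩
  by_cases h0 : κ.ts (f y) = 0
  · have hins : κ.insert (rotate f v y) (f y) = ⟨update κ.ts (f y) (κ.cnt + 1),
      update κ.mx (f y) (rotate f v y), κ.cnt + 1⟩ := by simp [insert, h0]
    rw [hins] at hearly ⊢
    have hle : ∀ x, update κ.ts (f y) (κ.cnt + 1) x ≤ κ.cnt + 1 := fun x => by
      by_cases hx : x = f y
      · simp [hx]
      · simp only [ne_eq, hx, not_false_eq_true, update_of_ne]
        exact (h.le x).trans (Nat.le_succ _)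
    have hlt := fun x => Nat.lt_succ_of_le (h.le x)
    refine ⟨fun x hx => ?_, fun x hx => ?_, hle, ?_, fun x z hx hxz => ?_,
      fun x hx u hu => ?_⟩
    · by_cases hxf : x = f y
      · subst hxf; simpa using hnear
      · simp only [ne_eq, hxf, not_false_eq_true, update_of_ne] at hx ⊢
        exact h.near x hx
    · by_cases hxf : x = f y
      · subst hxf; exact hcov
      · simp only [ne_eq, hxf, not_false_eq_true, update_of_ne] at hx
        exact h.cov x hx
    · have : r ≠ f y := fun h' => by simp [← h', h.root] at h0
      simpa [this] using h.root
    · have := hlt x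
      have := hlt z
      by_cases hxf : x = f y <;> by_cases hzf : z = f y
      · rw [hxf, hzf]
      · simp only [hxf, update_self, ne_eq, hzf, not_false_eq_true, update_of_ne] at hxz
        omega
      · simp only [hzf, update_self, ne_eq, hxf, not_false_eq_true, update_of_ne] at hxz
        omega
      · simp only [ne_eq, hxf, hzf, not_false_eq_true, update_of_ne] at hx hxz
        exact h.inj x z hx hxz
    · by_cases hxf : x = f y
      · subst hxf
        simp only [update_self] at hu ⊢
        exact (hearly u hu).imp (fun h => ⟨h, hle _⟩) fun h => ⟨h, hle _⟩
      · simp only [ne_eq, hxf, not_false_eq_true, update_of_ne] at hx hu ⊢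
        refine (h.early x hx u hu).imp (fun h' => ?_) fun h' => ?_
        · have : u ≠ f y := fun e => h'.1 (e ▸ h0)
          simpa [this] using h'
        · have : m u ≠ f y := fun e => h'.1 (e ▸ h0)
          simpa [this] using h'
  · simpa [insert, h0] using h

/-- The memory after reaching the root. -/
theorem good_init (hm : IsMatch G U m) (hr : m r = r) (f : V → V → V) :
    Good G U m r (insert ⟨fun _ => 0, f, 0⟩ m r) := by
  have hins : insert ⟨fun _ => 0, f, 0⟩ m r =
    ⟨update (fun _ => 0) r 1, update f r m, 1⟩ := by simp [insert]
  rw [hins]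
  have key {x : V} (hx : update (fun _ => 0) r 1 x ≠ 0) : x = r := by
    by_contra h
    simp [h] at hx
  refine ⟨fun x hx => ?_, fun x hx => Or.inr (key hx), fun x => ?_, by simp, fun x y hx hxy => ?_,
    fun x hx u hu => ?_⟩
  · obtain rfl := key hx
    simp only [update_self]
    refine ⟨hm, fun u => ?_⟩
    by_cases h : u = x <;> simp [h, hr]
  · by_cases h : x = r <;> simp [h]
  · exact (key hx).trans (key (x := y) fun h => hx (hxy.trans h)).symm
  · obtain rfl := key hx
    simp at hu

/-! ### Completeness of the search -/

/-- The graph induced on the reached vertices. -/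
def graph (G : SimpleGraph V) (κ : Search V) : SimpleGraph V where
  Adj x y := G.Adj x y ∧ κ.ts x ≠ 0 ∧ κ.ts y ≠ 0
  symm := ⟨fun _ _ h => ⟨h.1.symm, h.2.2, h.2.1⟩⟩
  loopless := ⟨fun _ h => h.1.ne rfl⟩

theorem reached_of_reachable (hx : κ.ts x ≠ 0) (h : (κ.graph G).Reachable x y) :
    κ.ts y ≠ 0 := by
  obtain ⟨p⟩ := h
  induction p with
  | nil => exact hx
  | cons h _ ih => exact ih h.2.2

/-- If the search is stuck, it has reached all the vertices that it can reach. -/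
theorem Good.complete [Fintype V] (hm : IsMatch G U m) (hr : m r = r) (h : Good G U m r κ)
    (h1 : ∀ x y, κ.ts x ≠ 0 → G.Adj x y → Cov m r y → κ.ts (κ.mx x y) ≠ 0)
    (h2 : ∀ x p, κ.ts x ≠ 0 → (κ.graph G).Reachable x p → p ≠ x → κ.ts (κ.mx x p) ≠ 0)
    {u : V} (hf : IsNear G U m r f u) : κ.ts u ≠ 0 := by
  classical
  intro hu
  have hrt : κ.ts r ≠ 0 := by rw [h.root]; exact one_ne_zero
  -- every component contains at most one vertex that `m` does not match within it
  have hexit : ∀ y y', κ.ts y ≠ 0 → κ.ts y' ≠ 0 → (y = r ∨ κ.ts (m y) = 0) →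
      (y' = r ∨ κ.ts (m y') = 0) → (κ.graph G).Reachable y' y → y = y' := by
    have key : ∀ y y', κ.ts y ≠ 0 → κ.ts y' ≠ 0 → (y = r ∨ κ.ts (m y) = 0) →
        (κ.graph G).Reachable y' y → ¬ κ.ts y' < κ.ts y := by
      intro y y' hy hy' hey hreach hlt
      have hyr : y ≠ r := by
        rintro rfl
        have := h.root
        omega
      have hmy := hey.resolve_left hyr
      -- Since `y` is later than `y'` and `m y` is unreached, `early` leaves the edge of `m` at `y`
      -- untouched. It leads out of the component, against `h2`.
      have heq : κ.mx y' y = m y := by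
        by_contra hne
        rcases h.early y' hy' y hne with h' | h'
        · omega
        · exact h'.1 hmy
      refine h2 y' y hy' hreach ?_ (heq ▸ hmy)
      rintro rfl
      omega
    intro y y' hy hy' hey hey' hreach
    rcases lt_trichotomy (κ.ts y) (κ.ts y') with hlt | heq | hlt
    · exact (key y' y hy' hy hey' hreach.symm hlt).elim
    · exact h.inj y y' hy heq
    · exact (key y y' hy hy' hey hreach hlt).elim
  have hadj {g : V → V} {w x : V} (hg : IsNear G U m r g w) (hx : κ.ts x ≠ 0)
      (hgx : κ.ts (g x) ≠ 0) : (κ.graph G).Reachable x (g x) := by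
    by_cases hne : g x = x
    · rw [hne]
    · exact SimpleGraph.Adj.reachable (G := κ.graph G) ⟨hg.adj x hne, hx, hgx⟩
  -- Parity: `κ.mx x` pairs off the component of `x` without `x`, so the component is odd. If `f`
  -- stayed among the reached vertices, it would pair off the whole component, because its exposed
  -- vertex `u` is unreached.
  have hout : ∀ x, κ.ts x ≠ 0 → ∃ s, (κ.graph G).Reachable x s ∧ κ.ts (f s) = 0 := by
    intro x hx
    by_contra! hcon
    set C := Finset.univ.filter fun s => (κ.graph G).Reachable x s with hC
    have hCmem {s : V} : s ∈ C ↔ (κ.graph G).Reachable x s := by simp [hC]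
    have hf0 : (C.card : ZMod 2) = 0 := by
      rw [Finset.cast_card]
      refine Finset.sum_involution (fun a _ => f a) (fun _ _ => by decide) (fun s hs _ => ?_)
        (fun s hs => ?_) fun s _ => hf.invol s
      · have hs' := reached_of_reachable hx (hCmem.1 hs)
        exact hf.ne_of_cov (h.cov s hs') fun h' => hs' (h' ▸ hu)
      · rw [hCmem] at hs ⊢
        exact hs.trans (hadj hf (reached_of_reachable hx hs) (hcon s hs))
    have hx0 : ((C.erase x).card : ZMod 2) = 0 := by
      rw [Finset.cast_card]
      have hn := h.near x hx
      refine Finset.sum_involution (fun a _ => κ.mx x a) (fun _ _ => by decide)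
        (fun s hs _ => ?_) (fun s hs => ?_) fun s _ => hn.invol s
      · rw [Finset.mem_erase, hCmem] at hs
        exact hn.ne_of_cov (h.cov s (reached_of_reachable hx hs.2)) hs.1
      · rw [Finset.mem_erase, hCmem] at hs ⊢
        refine ⟨fun h' => hs.1 ?_, hs.2.trans (hadj hn (reached_of_reachable hx hs.2)
          (h2 x s hx hs.2 hs.1))⟩
        rw [← hn.invol s, h', hn.self]
    have hxC : x ∈ C := hCmem.2 (SimpleGraph.Reachable.refl x)
    rw [← Finset.card_erase_add_one hxC, Nat.cast_add, hx0] at hf0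
    exact absurd hf0 (by decide)
  choose! s hs hfs using hout
  -- The root and the partners under `m` of the elements of `A` lie in pairwise different
  -- components, so there are more components than elements of `A`. But `f` leads from a vertex of
  -- each of them to its own element of `A`.
  let A := {a : V // κ.ts a = 0 ∧ Cov m r a ∧ ∃ x, κ.ts x ≠ 0 ∧ G.Adj x a}
  have hmA (a : A) : κ.ts (m a) ≠ 0 := by
    obtain ⟨ha, hc, x, hx, hxa⟩ := a.2
    by_cases heq : κ.mx x a = m a
    · rw [← heq]; exact h1 x a hx hxa hc
    · exact ((h.early x hx a heq).resolve_left fun h' => h'.1 ha).1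
  let e : Option A → V := fun o => o.elim r fun a => m a
  have he : ∀ o, κ.ts (e o) ≠ 0 := by
    rintro (_ | a)
    · exact hrt
    · exact hmA a
  have hee : ∀ o, e o = r ∨ κ.ts (m (e o)) = 0 := by
    rintro (_ | a)
    · exact Or.inl rfl
    · exact Or.inr (by simpa [e, hm.invol a.1] using a.2.1)
  have heinj : Injective e := by
    have hra (a : A) : r ≠ m a := fun h' => by
      have : (a : V) = r := by rw [← hm.invol a, ← h', hr]
      exact hrt (this ▸ a.2.1)
    rintro (_ | a) (_ | b) hab
    · rfl
    · exact (hra b hab).elim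
    · exact (hra a hab.symm).elim
    · exact congrArg some (Subtype.ext (hm.invol.injective hab))
  have hA (o : Option A) : κ.ts (f (s (e o))) = 0 ∧ Cov m r (f (s (e o))) ∧
      ∃ x, κ.ts x ≠ 0 ∧ G.Adj x (f (s (e o))) := by
    have hsr := reached_of_reachable (he o) (hs _ (he o))
    have hne : s (e o) ≠ u := fun h' => hsr (h' ▸ hu)
    have hcs := h.cov _ hsr
    exact ⟨hfs _ (he o), hf.cov_map hcs hne, _, hsr, hf.adj _ (hf.ne_of_cov hcs hne)⟩
  have hinj : Injective fun o : Option A => (⟨f (s (e o)), hA o⟩ : A) := by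
    intro o o' hoo
    have hss : s (e o) = s (e o') := hf.invol.injective (Subtype.ext_iff.1 hoo)
    refine heinj (hexit _ _ (he o) (he o') (hee o) (hee o') ?_)
    exact (hs _ (he o')).trans (hss ▸ (hs _ (he o)).symm)
  have := Fintype.card_le_of_injective _ hinj
  rw [Fintype.card_option] at this
  exact Nat.not_succ_le_self _ this

/-! ### Sliding along an edge -/

/-- The invariant when the matching `f₀` is transformed into one that exposes `w`, guided by the
matching `K` that exposes `w`: the matching `f` exposes `v`, and `R` exposes `K v`. -/
structure Slide (G : SimpleGraph V) (U : Finset V) (m : V → V) (r : V) (K f₀ : V → V) (w : V)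
    (κ : Search V) (f R : V → V) (v : V) : Prop where
  good : Good G U m r κ
  work : Work G U m r κ f v
  workR : v ≠ w → Work G U m r κ R (K v)
  agree : v ≠ w → ∀ u, u ≠ v → u ≠ K v → u ≠ w → f u = K u ∨ R u = K u
  keeps : Keeps κ f₀ f

variable {K f₀ R : V → V} {w : V}

/-- The edge `wv` closes an odd cycle with the alternating path of `f` and `K` from `v` to `w`.
Rotating `K` along this edge starts the second family of matchings, which expose the vertices of the
cycle that `f` skips. -/
theorem Slide.init (hm : IsMatch G U m) (hr : r ∈ U) (h : Good G U m r κ)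
    (hw : Work G U m r κ f v) (hK : Work G U m r κ K w) (hwv : G.Adj w v) :
    Slide G U m r K f w (κ.insert (rotate K w v) (K v)) f (rotate K w v) v := by
  obtain ⟨h1, h2⟩ := h.move hm hr hK hwv hw.cov
  refine ⟨h1, hw.ext (ext_insert _ _ _), fun _ => h2, fun _ u hu1 hu2 hu3 => ?_, fun _ _ => rfl⟩
  exact Or.inr (rotate_apply_of_ne hu3 hu1 hu2)

/-- A step of sliding. -/
theorem Slide.step [Fintype V] (hm : IsMatch G U m) (hr : r ∈ U) (hK : IsNear G U m r K w)
    (h : Slide G U m r K f₀ w κ f R v) (hv : v ≠ w) :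
    (f (K v) = w → Slide G U m r K f₀ w (κ.insert (rotate f v (K v)) (f (K v)))
      (rotate f v (K v)) R (f (K v))) ∧
    (f (K v) ≠ w → Slide G U m r K f₀ w
      ((κ.insert (rotate f v (K v)) (f (K v))).insert
        (rotate R (K v) (f (K v))) (R (f (K v))))
      (rotate f v (K v)) (rotate R (K v) (f (K v))) (f (K v))) ∧
    -- The growing agreement with `K` bounds the number of steps.
    (Finset.univ.filter fun u => f u = K u).card <
      (Finset.univ.filter fun u => rotate f v (K v) u = K u).card := by
  have hKv : K v ≠ v := hK.ne_of_cov h.work.cov hv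
  have hKc : Cov m r (K v) := hK.cov_map h.work.cov hv
  have hadj := hK.adj v hKv
  have hfn := h.work.near
  obtain ⟨hg1, hw1⟩ := h.good.move hm hr h.work hadj hKc
  have hR := h.workR hv
  set y := K v with hy
  set z := f y with hz
  have hKy : K y = v := hK.invol v
  have hzy : z ≠ y := hfn.ne_of_cov hKc hKv
  have hzv : z ≠ v := fun h' => hKv (by rw [← hfn.invol y, ← hz, h', hfn.self])
  have hfz : f z = y := hfn.invol y
  have hKz : K z ≠ y := fun h' => hzv (by rw [← hK.invol z, h', hKy])
  have hrv : rotate f v y v = y := by simp [rotate, ← hz, hzv.symm, hKv.symm]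
  have hry : rotate f v y y = v := by simp [rotate, ← hz, hzy.symm]
  have hext1 := κ.ext_insert (rotate f v y) z
  -- The rotation changes `f` only at `v`, `y` and `z`, whose partners under `f` are `v`, `z` and
  -- `y`. All three are reached: `z` just now, and `y` because `R` exposes it.
  have hkeep : ∀ κ', Ext (κ.insert (rotate f v y) z) κ' → Keeps κ' f₀ (rotate f v y) := by
    intro κ' hκ' p hp
    have hfp := (hext1.trans hκ').keeps h.keeps p hp
    rw [← hfp] at hp
    have e1 : p ≠ v := by
      rintro rfl
      rw [hfn.self] at hp
      exact (hext1.trans hκ').ts_ne h.work.ts hp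
    have e2 : p ≠ y := by
      rintro rfl
      exact hκ'.ts_ne (insert_ts_ne _ _ _) hp
    have e3 : p ≠ z := by
      rintro rfl
      rw [hfz] at hp
      exact (hext1.trans hκ').ts_ne hR.ts hp
    rw [rotate_apply_of_ne e1 e2 e3, hfp]
  refine ⟨fun hzw => ⟨hg1, hw1, fun h' => (h' hzw).elim, fun h' => (h' hzw).elim,
    hkeep _ (Ext.refl _)⟩, fun hzw => ?_, ?_⟩
  · have hadj2 : G.Adj y z := hfn.adj y hzy
    have hzc : Cov m r z := hfn.cov_map hKc hKv
    obtain ⟨hg2, hw2⟩ := hg1.move hm hr (hR.ext hext1) hadj2 hzc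
    -- Up to here `f` contains the edge `yz`, which is not in `K`, so `R` is the matching that
    -- agrees with `K` at `z`.
    have hRz : R z = K z :=
      (h.agree hv z hzv hzy hzw).resolve_left fun h' => hKz (h'.symm.trans hfz)
    refine ⟨hg2, hw1.ext (ext_insert _ _ _), fun _ => hRz ▸ hw2, fun _ u hu1 hu2 hu3 => ?_,
      hkeep _ (ext_insert _ _ _)⟩
    by_cases e1 : u = v
    · left; rw [e1, hrv]
    · by_cases e2 : u = y
      · left; rw [e2, hry, hKy]
      · rw [rotate_apply_of_ne e1 e2 hu1, rotate_apply_of_ne e2 hu1 (hRz ▸ hu2)]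
        exact h.agree hv u e1 e2 hu3
  · refine Finset.card_lt_card ⟨fun u hu => ?_, fun hsub => ?_⟩
    · simp only [Finset.mem_filter, Finset.mem_univ, true_and] at hu ⊢
      by_cases e1 : u = v
      · rw [e1, hrv]
      · by_cases e2 : u = y
        · rw [e2, hry, hKy]
        · have e3 : u ≠ z := by
            rintro rfl
            exact hKz (hu.symm.trans hfz)
          rw [rotate_apply_of_ne e1 e2 e3, hu]
    · have := hsub (Finset.mem_filter.2 ⟨Finset.mem_univ v, hrv⟩)
      simp only [Finset.mem_filter, Finset.mem_univ, true_and, hfn.self] at this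
      exact hKv this.symm

end Search

end Search

/-! ## Bounded programs -/

namespace Ram

/-- Programs whose loops run through the numbers below `n`. -/
inductive Cmd where
  | skip
  | assign (x : ℕ) (e : Expr)
  | write (a : ℕ) (index e : Expr)
  | seq (p q : Cmd)
  | ite (test : Expr) (p q : Cmd)
  | forN (x : ℕ) (p : Cmd)

namespace Cmd

/-- The underlying program of the machine. -/
def toProg : Cmd → Prog
  | skip => .skip
  | assign x e => .assign x e
  | write a k e => .write a k e
  | seq p q => .seq p.toProg q.toProg
  | ite b p q => .branch b p.toProg q.toProg
  | forN x p => .seq (.assign x (.const 0)) (.loop (.sub (.reg 0) (.reg x))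
      (.seq p.toProg (.assign x (.add (.reg x) (.const 1)))))

/-- The final state of a program started with `n` in register `0`. -/
def run (n : ℕ) : Cmd → State → State
  | skip, s => s
  | assign x e, s => s.setReg x (e.eval s)
  | write a k e, s => s.setArr a (k.eval s) (e.eval s)
  | seq p q, s => q.run n (p.run n s)
  | ite b p q, s => if b.eval s ≠ 0 then p.run n s else q.run n s
  | forN x p, s => ((List.range n).foldl (fun s k => p.run n (s.setReg x k)) s).setReg x n

/-- Whether the program writes register `x`. -/
def writesReg : Cmd → ℕ → Bool
  | skip, _ => false
  | assign y _, x => y == x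
  | write _ _ _, _ => false
  | seq p q, x => p.writesReg x || q.writesReg x
  | ite _ p q, x => p.writesReg x || q.writesReg x
  | forN y p, x => y == x || p.writesReg x

/-- Whether the program writes array `a`. -/
def writesArr : Cmd → ℕ → Bool
  | skip, _ => false
  | assign _ _, _ => false
  | write b _ _, a => b == a
  | seq p q, a => p.writesArr a || q.writesArr a
  | ite _ p q, a => p.writesArr a || q.writesArr a
  | forN _ p, a => p.writesArr a

/-- No loop body writes the counter of its loop, and register `0` is not written. -/
def wf : Cmd → Bool
  | skip => true
  | assign x _ => x != 0
  | write _ _ _ => true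
  | seq p q => p.wf && q.wf
  | ite _ p q => p.wf && q.wf
  | forN x p => x != 0 && !p.writesReg x && p.wf

/-- A bound for the running time. -/
noncomputable def time : Cmd → Polynomial ℕ
  | skip => 1
  | assign _ e => ((e.cost + 1 : ℕ) : Polynomial ℕ)
  | write _ k e => ((k.cost + e.cost + 1 : ℕ) : Polynomial ℕ)
  | seq p q => p.time + q.time
  | ite b p q => ((b.cost + 1 : ℕ) : Polynomial ℕ) + p.time + q.time
  -- The initial assignment takes 2 steps, each test 4 and each increment 4; the last test fails,
  -- whence `6 = 2 + 4` and `8 = 4 + 4`.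
  | forN _ p => ((6 : ℕ) : Polynomial ℕ) + Polynomial.X * (p.time + ((8 : ℕ) : Polynomial ℕ))

end Cmd

namespace State

variable (s : State) (x v a k : ℕ)

@[simp] theorem setReg_arr : (s.setReg x v).arr = s.arr := rfl

@[simp] theorem setReg_reg_self : (s.setReg x v).reg x = v := Function.update_self ..

@[simp] theorem setReg_reg_of_ne {x y : ℕ} (h : y ≠ x) : (s.setReg x v).reg y = s.reg y :=
  Function.update_of_ne h ..

@[simp] theorem setArr_reg : (s.setArr a k v).reg = s.reg := rfl

@[simp] theorem setArr_arr_self : (s.setArr a k v).arr a = Function.update (s.arr a) k v :=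
  Function.update_self ..

@[simp] theorem setArr_arr_of_ne {a b : ℕ} (h : b ≠ a) : (s.setArr a k v).arr b = s.arr b :=
  Function.update_of_ne h ..

end State

namespace Cmd

/-- The invariant rule for loops. On exit the counter holds `n`, which is why `fin` concerns the
modified state. -/
theorem forN_rule {n x : ℕ} {p : Cmd} {s : State} {Q : State → Prop} (I : ℕ → State → Prop)
    (h0 : I 0 s) (step : ∀ k < n, ∀ s, I k s → I (k + 1) (p.run n (s.setReg x k)))
    (fin : ∀ s, I n s → Q (s.setReg x n)) : Q ((forN x p).run n s) := by
  refine fin _ ?_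
  have key : ∀ k ≤ n, I k ((List.range k).foldl (fun s k => p.run n (s.setReg x k)) s) := by
    intro k
    induction k with
    | zero => exact fun _ => h0
    | succ k ih =>
      intro hk
      rw [List.range_succ, List.foldl_append]
      exact step k hk _ (ih (Nat.le_of_succ_le hk))
  exact key n le_rfl

/-- A frame rule whose side condition is Boolean, so that for concrete programs it is settled by
`rfl`. -/
theorem run_reg {n x : ℕ} (c : Cmd) (s : State) (h : c.writesReg x = false) :
    (c.run n s).reg x = s.reg x := by
  induction c generalizing s with
  | skip => rfl
  | assign y e =>
    have : x ≠ y := fun h' => by simp [writesReg, h'] at h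
    simp [run, this]
  | write => rfl
  | seq p q ihp ihq =>
    simp only [writesReg, Bool.or_eq_false_iff] at h
    rw [run, ihq _ h.2, ihp _ h.1]
  | ite b p q ihp ihq =>
    simp only [writesReg, Bool.or_eq_false_iff] at h
    rw [run]
    split_ifs
    · exact ihp _ h.1
    · exact ihq _ h.2
  | forN y p ih =>
    simp only [writesReg, Bool.or_eq_false_iff] at h
    have hxy : x ≠ y := fun h' => by simp [h'] at h
    refine forN_rule (Q := fun s' => s'.reg x = s.reg x) (fun _ s' => s'.reg x = s.reg x)
      rfl (fun k _ s' hs' => ?_) fun s' hs' => ?_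
    · rw [ih _ h.2, State.setReg_reg_of_ne _ _ hxy, hs']
    · rw [State.setReg_reg_of_ne _ _ hxy, hs']

theorem run_arr {n a : ℕ} (c : Cmd) (s : State) (h : c.writesArr a = false) :
    (c.run n s).arr a = s.arr a := by
  induction c generalizing s with
  | skip => rfl
  | assign y e => rfl
  | write b =>
    have : a ≠ b := fun h' => by simp [writesArr, h'] at h
    simp [run, this]
  | seq p q ihp ihq =>
    simp only [writesArr, Bool.or_eq_false_iff] at h
    rw [run, ihq _ h.2, ihp _ h.1]
  | ite b p q ihp ihq =>
    simp only [writesArr, Bool.or_eq_false_iff] at h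
    rw [run]
    split_ifs
    · exact ihp _ h.1
    · exact ihq _ h.2
  | forN y p ih =>
    exact forN_rule (Q := fun s' => s'.arr a = s.arr a) (fun _ s' => s'.arr a = s.arr a) rfl
      (fun k _ s' hs' => by rw [ih _ h, State.setReg_arr, hs']) fun s' hs' => hs'

/-- Register `0` thus holds `n` throughout, and every loop test compares with the same bound. -/
theorem writesReg_zero {c : Cmd} (h : c.wf) : c.writesReg 0 = false := by
  induction c with
  | skip => rfl
  | assign y e => simpa [wf, writesReg] using h
  | write => rfl
  | seq p q ihp ihq =>
    simp only [wf, Bool.and_eq_true] at h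
    simp [writesReg, ihp h.1, ihq h.2]
  | ite b p q ihp ihq =>
    simp only [wf, Bool.and_eq_true] at h
    simp [writesReg, ihp h.1, ihq h.2]
  | forN y p ih =>
    simp only [wf, Bool.and_eq_true, bne_iff_ne, ne_eq] at h
    simp [writesReg, ih h.2, h.1.1]

/-- Bounded programs halt in polynomial time. -/
theorem exec {n : ℕ} (c : Cmd) (hc : c.wf) (s : State) (hs : s.reg 0 = n) :
    ∃ t, Exec c.toProg s t (c.run n s) ∧ t ≤ c.time.eval n := by
  induction c generalizing s with
  | skip => exact ⟨1, Exec.skip s, by simp [time]⟩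
  | assign x e => exact ⟨_, Exec.assign s x e, by simp [time]⟩
  | write a k e => exact ⟨_, Exec.write s a k e, by simp [time]⟩
  | seq p q ihp ihq =>
    simp only [wf, Bool.and_eq_true] at hc
    obtain ⟨t, ht, hle⟩ := ihp hc.1 s hs
    obtain ⟨t', ht', hle'⟩ := ihq hc.2 (p.run n s)
      (by rw [run_reg _ _ (writesReg_zero hc.1), hs])
    exact ⟨_, Exec.seq ht ht', by simpa [time] using add_le_add hle hle'⟩
  | ite b p q ihp ihq =>
    simp only [wf, Bool.and_eq_true] at hc
    rw [run, toProg]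
    split_ifs with hb
    · obtain ⟨t, ht, hle⟩ := ihp hc.1 s hs
      exact ⟨_, Exec.branch_true hb ht, by simp [time]; omega⟩
    · obtain ⟨t, ht, hle⟩ := ihq hc.2 s hs
      exact ⟨_, Exec.branch_false (not_not.1 hb) ht, by simp [time]; omega⟩
  | forN x p ih =>
    simp only [wf, Bool.and_eq_true, bne_iff_ne, ne_eq, Bool.not_eq_true'] at hc
    set F : ℕ → State := fun k => (List.range k).foldl (fun s k => p.run n (s.setReg x k)) s
      with hF
    have hF0 : ∀ k, (F k).reg 0 = n := by
      intro k
      induction k with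
      | zero => exact hs
      | succ k ihk =>
        have : F (k + 1) = p.run n ((F k).setReg x k) := by
          simp [hF, List.range_succ]
        rw [this, run_reg _ _ (writesReg_zero hc.2), State.setReg_reg_of_ne _ _ (Ne.symm hc.1.1),
          ihk]
    -- The induction is on the number `j` of iterations still to come, since `Exec` unfolds a loop
    -- at its front.
    have key : ∀ j ≤ n, ∃ t, Exec (.loop (.sub (.reg 0) (.reg x))
        (.seq p.toProg (.assign x (.add (.reg x) (.const 1))))) ((F (n - j)).setReg x (n - j)) t
        ((F n).setReg x n) ∧ t ≤ 4 + j * (p.time.eval n + 8) := by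
      intro j
      induction j with
      | zero =>
        intro _
        refine ⟨_, Exec.loop_false ?_, ?_⟩
        · simp [Expr.eval, hF0, State.setReg_reg_of_ne _ _ (Ne.symm hc.1.1)]
        · simp [Expr.cost]
      | succ j ihj =>
        intro hj
        obtain ⟨t', ht', hle'⟩ := ihj (Nat.le_of_succ_le hj)
        obtain ⟨t, ht, hle⟩ := ih hc.2 ((F (n - (j + 1))).setReg x (n - (j + 1)))
          (by rw [State.setReg_reg_of_ne _ _ (Ne.symm hc.1.1), hF0])
        have hstep : p.run n ((F (n - (j + 1))).setReg x (n - (j + 1))) = F (n - j) := by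
          have : n - j = (n - (j + 1)) + 1 := by omega
          rw [this]
          simp [hF, List.range_succ]
        rw [hstep] at ht
        have hx : (F (n - j)).reg x = n - (j + 1) := by
          rw [← hstep, run_reg _ _ hc.1.2, State.setReg_reg_self]
        have hass := Exec.assign (F (n - j)) x (.add (.reg x) (.const 1))
        have heval : Expr.eval (F (n - j)) (.add (.reg x) (.const 1)) = n - j := by
          simp only [Expr.eval, hx]
          omega
        rw [heval] at hass
        refine ⟨_, Exec.loop_true ?_ (Exec.seq ht hass) ht', ?_⟩
        · simp only [Expr.eval, State.setReg_reg_self, State.setReg_reg_of_ne _ _ (Ne.symm hc.1.1),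
            hF0]
          omega
        · simp only [Expr.cost]
          rw [Nat.succ_mul]
          omega
    obtain ⟨t, ht, hle⟩ := key n le_rfl
    rw [Nat.sub_self] at ht
    refine ⟨_, Exec.seq (Exec.assign s x (.const 0)) ht, ?_⟩
    simp only [time, Expr.cost, Polynomial.eval_add, Polynomial.eval_mul, Polynomial.eval_X,
      Polynomial.eval_natCast, Nat.cast_id]
    omega

end Cmd

end Ram

namespace Ram

/-! ## The program

Arrays: `0` the friendship matrix, `1` the labels, `2` the offsets of the rows of matrices, `3` the
current matching, `4` and `5` the memory of the search, `6` and `7` the memory of the exploration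
of a component, `8` and `9` working matchings, `10` the set of remaining vertices, `11` the labels
of the removed triangles. Register `2` counts the vertices reached by the search. -/

namespace Expr

/-- The entry of array `a` at the index in register `x`. -/
def cell (a x : ℕ) : Expr := arr a (reg x)

/-- The entry of matrix `a` at the indices in the registers `x` and `y`. -/
def entry (a x y : ℕ) : Expr := arr a (add (arr 2 (reg x)) (reg y))

/-- A test for being different. -/
def ne (e f : Expr) : Expr := add (sub e f) (sub f e)

/-- Negation of a test. -/
def not (e : Expr) : Expr := sub (const 1) e

/-- A test for adjacency. -/
def adj (x y : ℕ) : Expr := sub (add (entry 0 x y) (entry 0 y x)) (const 1)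

variable (s : State) (a x y : ℕ) (e f : Expr)

@[simp] theorem eval_const (c : ℕ) : (const c).eval s = c := rfl
@[simp] theorem eval_reg : (reg x).eval s = s.reg x := rfl
@[simp] theorem eval_add : (add e f).eval s = e.eval s + f.eval s := rfl
@[simp] theorem eval_sub : (sub e f).eval s = e.eval s - f.eval s := rfl
@[simp] theorem eval_arr : (arr a e).eval s = s.arr a (e.eval s) := rfl
@[simp] theorem eval_cell : (cell a x).eval s = s.arr a (s.reg x) := rfl
@[simp] theorem eval_entry : (entry a x y).eval s = s.arr a (s.arr 2 (s.reg x) + s.reg y) := rfl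

@[simp] theorem eval_ne : (ne e f).eval s = 0 ↔ e.eval s = f.eval s := by
  simp only [ne, eval_add, eval_sub]; omega

@[simp] theorem eval_not : (not e).eval s = 0 ↔ e.eval s ≠ 0 := by
  simp only [not, eval_sub, eval_const]; omega

end Expr

namespace Cmd

open Ram.Expr

variable {n : ℕ}

theorem forN_fin_rule {x : ℕ} {p : Cmd} {s : State} {Q : State → Prop} (I : ℕ → State → Prop)
    (h0 : I 0 s) (step : ∀ (k : Fin n) s, I k s → I (k + 1) (p.run n (s.setReg x k)))
    (fin : ∀ s, I n s → Q (s.setReg x n)) : Q ((forN x p).run n s) :=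
  forN_rule I h0 (fun k hk s hs => step ⟨k, hk⟩ s hs) fin

@[simp] theorem run_seq (p q : Cmd) (s : State) : (seq p q).run n s = q.run n (p.run n s) := rfl
@[simp] theorem run_skip (s : State) : skip.run n s = s := rfl
@[simp] theorem run_assign (x : ℕ) (e : Expr) (s : State) :
    (assign x e).run n s = s.setReg x (e.eval s) := rfl
@[simp] theorem run_write (a : ℕ) (k e : Expr) (s : State) :
    (write a k e).run n s = s.setArr a (k.eval s) (e.eval s) := rfl

theorem run_ite_of_ne {b : Expr} {s : State} (p q : Cmd) (h : b.eval s ≠ 0) :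
    (ite b p q).run n s = p.run n s := if_pos h

theorem run_ite_of_eq {b : Expr} {s : State} (p q : Cmd) (h : b.eval s = 0) :
    (ite b p q).run n s = q.run n s := if_neg (not_not.2 h)

/-! ### What the memory holds, and frame rules -/

/-- Fixed contents of the memory: the number of vertices, the offsets of the rows, and the
graph. -/
structure Env (G : SimpleGraph (Fin n)) (s : State) : Prop where
  size : s.reg 0 = n
  row : ∀ x : Fin n, s.arr 2 x = x * n
  adj : ∀ x y : Fin n, s.arr 0 (x * n + y) + s.arr 0 (y * n + x) - 1 ≠ 0 ↔ G.Adj x y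

/-- Array `a` holds the function `f`. -/
def Vec (s : State) (a : ℕ) (f : Fin n → Fin n) : Prop := ∀ y : Fin n, s.arr a y = f y

/-- Row `x` of matrix `a` holds the function `f`. -/
def Row (s : State) (a : ℕ) (x : Fin n) (f : Fin n → Fin n) : Prop :=
  ∀ y : Fin n, s.arr a (x * n + y) = f y

/-- The arrays `4` and `5` and register `2` hold the memory of a search. -/
structure Stores (s : State) (κ : Search (Fin n)) : Prop where
  ts : ∀ x : Fin n, s.arr 4 x = κ.ts x
  mx : ∀ x, κ.ts x ≠ 0 → Row s 5 x (κ.mx x)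
  cnt : s.reg 2 = κ.cnt

variable {G : SimpleGraph (Fin n)} {s s' : State} {κ : Search (Fin n)} {f : Fin n → Fin n}
  {a b x : ℕ}

theorem Env.congr (h : Env G s) (h0 : s'.reg 0 = s.reg 0) (ha0 : s'.arr 0 = s.arr 0)
    (ha2 : s'.arr 2 = s.arr 2) : Env G s' :=
  ⟨h0 ▸ h.size, ha2 ▸ h.row, ha0 ▸ h.adj⟩

theorem Env.setReg (h : Env G s) (x k : ℕ) (hx : 0 ≠ x) : Env G (s.setReg x k) :=
  h.congr (by simp [hx]) rfl rfl

theorem Env.setArr (h : Env G s) (a k v : ℕ) (h0 : 0 ≠ a) (h2 : 2 ≠ a) :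
    Env G (s.setArr a k v) :=
  h.congr rfl (by simp [h0]) (by simp [h2])

theorem Env.run (h : Env G s) (c : Cmd) (h0 : c.writesReg 0 = false)
    (ha0 : c.writesArr 0 = false) (ha2 : c.writesArr 2 = false) : Env G (c.run n s) :=
  h.congr (run_reg c s h0) (run_arr c s ha0) (run_arr c s ha2)

theorem Stores.congr (h : Stores s κ) (h2 : s'.reg 2 = s.reg 2) (h4 : s'.arr 4 = s.arr 4)
    (h5 : s'.arr 5 = s.arr 5) : Stores s' κ :=
  ⟨h4 ▸ h.ts, fun x hx y => h5 ▸ h.mx x hx y, h2 ▸ h.cnt⟩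

theorem Stores.setReg (h : Stores s κ) (x k : ℕ) (hx : 2 ≠ x) : Stores (s.setReg x k) κ :=
  h.congr (by simp [hx]) rfl rfl

theorem Stores.setArr (h : Stores s κ) (a k v : ℕ) (h4 : 4 ≠ a) (h5 : 5 ≠ a) :
    Stores (s.setArr a k v) κ :=
  h.congr rfl (by simp [h4]) (by simp [h5])

theorem Stores.run (h : Stores s κ) (c : Cmd) (h2 : c.writesReg 2 = false)
    (h4 : c.writesArr 4 = false) (h5 : c.writesArr 5 = false) : Stores (c.run n s) κ :=
  h.congr (run_reg c s h2) (run_arr c s h4) (run_arr c s h5)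

theorem Vec.congr (h : Vec s a f) (ha : s'.arr a = s.arr a) : Vec s' a f := fun y => ha ▸ h y

theorem Vec.run (h : Vec s a f) (c : Cmd) (ha : c.writesArr a = false) : Vec (c.run n s) a f :=
  h.congr (run_arr c s ha)

theorem Vec.setArr (h : Vec s a f) (k v : ℕ) (hab : a ≠ b) : Vec (s.setArr b k v) a f :=
  h.congr (by simp [hab])

theorem Vec.update (h : Vec s a f) (x y : Fin n) :
    Vec (s.setArr a x y) a (Function.update f x y) := by
  intro z
  by_cases hz : z = x
  · simp [hz]
  · have : (z : ℕ) ≠ x := fun h => hz (Fin.ext h)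
    simp [hz, this, h z]

theorem Row.congr {X : Fin n} (h : Row s a X f) (ha : s'.arr a = s.arr a) : Row s' a X f :=
  fun y => ha ▸ h y

theorem Env.eval_adj (h : Env G s) {X Y : Fin n} {y : ℕ} (hX : s.reg x = X) (hY : s.reg y = Y) :
    (Expr.adj x y).eval s ≠ 0 ↔ G.Adj X Y := by
  simp [Expr.adj, hX, hY, h.row, ← h.adj]

theorem Env.eval_entry (h : Env G s) {X Y : Fin n} {y : ℕ} (hX : s.reg x = X)
    (hY : s.reg y = Y) : (entry a x y).eval s = s.arr a (X * n + Y) := by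
  simp [hX, hY, h.row]

/-- Division with remainder by `n`; different matrix entries occupy different cells. -/
theorem row_index {X X' Y Y' : Fin n} (h : (X : ℕ) * n + Y = X' * n + Y') : X = X' ∧ Y = Y' := by
  have hn : 0 < n := X.pos
  have h1 := congrArg (· / n) h
  have h2 := congrArg (· % n) h
  simp only [Nat.mul_add_mod_self_right, Nat.mod_eq_of_lt Y.2, Nat.mod_eq_of_lt Y'.2] at h2
  rw [mul_comm, mul_comm (X' : ℕ)] at h1
  simp only [Nat.mul_add_div hn, Nat.div_eq_of_lt Y.2, Nat.div_eq_of_lt Y'.2, add_zero] at h1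
  exact ⟨Fin.ext h1, Fin.ext h2⟩

/-! ### Copying -/

/-- Copy row `x` of matrix `a` to array `d`. -/
def copyIn (d a x : ℕ) : Cmd := forN 1 (write d (reg 1) (entry a x 1))

/-- Copy array `d` to row `x` of matrix `a`. -/
def copyOut (a x d : ℕ) : Cmd := forN 1 (write a (add (arr 2 (reg x)) (reg 1)) (cell d 1))

theorem copyIn_spec (hs : Env G s) {d : ℕ} {X : Fin n} (hx : s.reg x = X) (hx1 : x ≠ 1)
    (hd2 : 2 ≠ d) (hda : a ≠ d) (h : Row s a X f) : Vec ((copyIn d a x).run n s) d f := by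
  refine forN_fin_rule (Q := fun s' => Vec s' d f) (fun k s' => s'.reg x = X ∧
    s'.arr 2 = s.arr 2 ∧ s'.arr a = s.arr a ∧ ∀ y : Fin n, (y : ℕ) < k → s'.arr d y = f y)
    ⟨hx, rfl, rfl, fun y hy => absurd hy (Nat.not_lt_zero _)⟩ ?_ ?_
  · rintro k s' ⟨h1, h2, h3, h4⟩
    refine ⟨by simp [hx1, h1], by simp [hd2, h2], by simp [hda, h3], fun y hy => ?_⟩
    simp only [run_write, eval_reg, State.setReg_reg_self, Expr.eval_entry, State.setReg_arr,
      State.setReg_reg_of_ne _ _ hx1, State.setArr_arr_self, h1, h2, h3, hs.row, h k]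
    by_cases hyk : y = k
    · simp [hyk]
    · have : (y : ℕ) ≠ k := fun h => hyk (Fin.ext h)
      simp only [ne_eq, this, not_false_eq_true, Function.update_of_ne]
      exact h4 y (by omega)
  · rintro s' ⟨-, -, -, h4⟩ y
    exact h4 y y.2

theorem copyOut_spec (hs : Env G s) {d : ℕ} {X : Fin n} (hx : s.reg x = X) (hx1 : x ≠ 1)
    (ha2 : 2 ≠ a) (hda : d ≠ a) (h : Vec s d f) :
    Row ((copyOut a x d).run n s) a X f ∧
      ∀ Y ≠ X, ∀ g, Row s a Y g → Row ((copyOut a x d).run n s) a Y g := by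
  refine forN_fin_rule (Q := fun s' => Row s' a X f ∧ ∀ Y ≠ X, ∀ g, Row s a Y g → Row s' a Y g)
    (fun k s' => s'.reg x = X ∧ s'.arr 2 = s.arr 2 ∧ s'.arr d = s.arr d ∧
    (∀ y : Fin n, (y : ℕ) < k → s'.arr a (X * n + y) = f y) ∧
    ∀ Y ≠ X, ∀ y : Fin n, s'.arr a (Y * n + y) = s.arr a (Y * n + y))
    ⟨hx, rfl, rfl, fun y hy => absurd hy (Nat.not_lt_zero _), fun _ _ _ => rfl⟩ ?_ ?_
  · rintro k s' ⟨h1, h2, h3, h4, h5⟩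
    refine ⟨by simp [hx1, h1], by simp [ha2, h2], by simp [hda, h3], fun y hy => ?_,
      fun Y hY y => ?_⟩
    · simp only [run_write, eval_reg, State.setReg_reg_self, eval_cell, eval_add, eval_arr,
        State.setReg_arr, State.setReg_reg_of_ne _ _ hx1, State.setArr_arr_self, h1, h2, h3,
        hs.row, h k]
      by_cases hyk : y = k
      · simp [hyk]
      · have : (X : ℕ) * n + y ≠ X * n + k := fun h => hyk (row_index h).2
        simp only [ne_eq, this, not_false_eq_true, Function.update_of_ne]
        exact h4 y (lt_of_le_of_ne (Nat.lt_succ_iff.1 hy) fun h => hyk (Fin.ext h))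
    · simp only [run_write, eval_reg, State.setReg_reg_self, eval_cell, eval_add, eval_arr,
        State.setReg_arr, State.setReg_reg_of_ne _ _ hx1, State.setArr_arr_self, h1, h2, h3,
        hs.row]
      have : (Y : ℕ) * n + y ≠ X * n + k := fun h => hY (row_index h).1
      simp only [ne_eq, this, not_false_eq_true, Function.update_of_ne]
      exact h5 Y hY y
  · rintro s' ⟨-, -, -, h4, h5⟩
    exact ⟨fun y => h4 y y.2, fun Y hY g hg y => (h5 Y hY y).trans (hg y)⟩

/-! ### Moves of the search -/

/-- Record the matching in array `d` for the vertex in register `12`. -/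
def insert (d : ℕ) : Cmd :=
  ite (cell 4 12) skip (seq (assign 2 (add (reg 2) (const 1)))
    (seq (write 4 (reg 12) (reg 2)) (copyOut 5 12 d)))

theorem insert_spec (hs : Env G s) {d : ℕ} (hd4 : d ≠ 4) (hd5 : d ≠ 5) {z : Fin n}
    (hz : s.reg 12 = z) (hd : Vec s d f) (h : Stores s κ) :
    Stores ((insert d).run n s) (κ.insert f z) := by
  by_cases h0 : κ.ts z = 0
  · rw [insert, run_ite_of_eq _ _ (by simp [hz, h.ts, h0])]
    simp only [Search.insert, h0, if_true]
    set s1 := (s.setReg 2 (κ.cnt + 1)).setArr 4 z (κ.cnt + 1) with hs1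
    have hrun : (seq (assign 2 (add (reg 2) (const 1))) (seq (write 4 (reg 12) (reg 2))
        (copyOut 5 12 d))).run n s = (copyOut 5 12 d).run n s1 := by
      simp [hs1, hz, h.cnt]
    rw [hrun]
    have hc := copyOut_spec (s := s1) (a := 5) (x := 12) (d := d) (f := f) (G := G) (X := z)
      ((hs.setReg 2 _ (by decide)).setArr 4 _ _ (by decide) (by decide)) (by simp [hs1, hz])
      (by decide) (by decide) hd5 ((hd.congr (s' := s.setReg 2 (κ.cnt + 1)) rfl).setArr _ _ hd4)
    refine ⟨fun x => ?_, fun x hx => ?_, ?_⟩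
    · rw [run_arr _ _ (by rfl)]
      by_cases hx : x = z
      · simp [hx, hs1]
      · have : (x : ℕ) ≠ z := fun h => hx (Fin.ext h)
        simp [hs1, hx, this, h.ts]
    · by_cases hxz : x = z
      · subst hxz; simpa using hc.1
      · simp only [ne_eq, hxz, not_false_eq_true, Function.update_of_ne] at hx ⊢
        exact hc.2 x hxz _ ((h.mx x hx).congr (by simp [hs1]))
    · rw [run_reg _ _ (by rfl)]
      simp [hs1]
  · rw [insert, run_ite_of_ne _ _ (by simp [hz, h.ts, h0])]
    simpa [Search.insert, h0] using h

/-- Rotate the matching in array `d`, which exposes the vertex in register `10`, along the edge to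
the vertex in register `11`, and record the result. -/
def move (d : ℕ) : Cmd :=
  -- The old partner is saved first, because the second write overwrites it.
  seq (assign 12 (cell d 11)) (seq (write d (reg 10) (reg 11)) (seq (write d (reg 11) (reg 10))
    (seq (write d (reg 12) (reg 12)) (insert d))))

theorem move_spec (hs : Env G s) {d : ℕ} (hd0 : d ≠ 0) (hd2 : d ≠ 2) (hd4 : d ≠ 4) (hd5 : d ≠ 5)
    {v y : Fin n} (hv : s.reg 10 = v) (hy : s.reg 11 = y) (hd : Vec s d f) (h : Stores s κ) :
    Stores ((move d).run n s) (κ.insert (rotate f v y) (f y)) ∧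
      Vec ((move d).run n s) d (rotate f v y) ∧ ((move d).run n s).reg 12 = f y := by
  set s1 := (((s.setReg 12 (f y)).setArr d v y).setArr d y v).setArr d (f y) (f y) with hs1
  have hrun : (move d).run n s = (insert d).run n s1 := by
    simp [move, hs1, hv, hy, hd y]
  have hvec : Vec s1 d (rotate f v y) :=
    (((hd.congr (s' := s.setReg 12 (f y)) rfl).update v y).update y v).update (f y) (f y)
  have henv : Env G s1 :=
    (((hs.setReg 12 _ (by decide)).setArr d _ _ hd0.symm hd2.symm).setArr d _ _ hd0.symm
      hd2.symm).setArr d _ _ hd0.symm hd2.symm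
  have hst : Stores s1 κ :=
    (((h.setReg 12 _ (by decide)).setArr d _ _ hd4.symm hd5.symm).setArr d _ _ hd4.symm
      hd5.symm).setArr d _ _ hd4.symm hd5.symm
  have h12 : s1.reg 12 = f y := by simp [hs1]
  rw [hrun]
  refine ⟨insert_spec henv hd4 hd5 h12 hvec hst, hvec.run _ ?_, ?_⟩
  · simp [insert, copyOut, writesArr, hd4.symm, hd5.symm]
  · rw [run_reg _ _ (by rfl), h12]

/-! ### Sliding -/

/-- Transform the matching in array `8`, which exposes the vertex in register `20`, into one that
exposes the adjacent vertex in register `21`. -/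
def slide : Cmd :=
  seq (copyIn 9 5 21) (seq (assign 10 (reg 21)) (seq (assign 11 (reg 20)) (seq (move 9)
    (seq (assign 22 (reg 20)) (forN 24 (ite (ne (reg 22) (reg 21))
      (seq (assign 23 (entry 5 21 22)) (seq (assign 10 (reg 22)) (seq (assign 11 (reg 23))
        (seq (move 8) (seq (assign 22 (reg 12)) (ite (ne (reg 22) (reg 21))
          (seq (assign 10 (reg 23)) (seq (assign 11 (reg 22)) (move 9))) skip))))))
      skip))))))

variable {U : Finset (Fin n)} {m : Fin n → Fin n} {r : Fin n}

/-- Arrays `8` and `9` hold the two matchings of `Search.Slide`. Until `w` is exposed, each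
iteration increases the number of vertices at which array `8` agrees with `K`. -/
theorem slide_spec (hs : Env G s) (hm : IsMatch G U m) (hr : r ∈ U) (h : Stores s κ)
    (hκ : κ.Good G U m r) {v w : Fin n} (hv : s.reg 20 = v) (hw : s.reg 21 = w)
    (hts : κ.ts w ≠ 0) (hwv : G.Adj w v) (hf : Vec s 8 f) (hwork : κ.Work G U m r f v) :
    ∃ κ' g, κ.Ext κ' ∧ κ'.Good G U m r ∧ Stores (slide.run n s) κ' ∧
      Vec (slide.run n s) 8 g ∧ κ'.Work G U m r g w ∧ κ'.Keeps f g := by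
  set K := κ.mx w with hK
  have hKw := hκ.work hts
  set s1 := (copyIn 9 5 21).run n s with hs1
  have hR1 : Vec s1 9 K := copyIn_spec hs hw (by decide) (by decide) (by decide) (h.mx w hts)
  set s2 := (s1.setReg 10 w).setReg 11 v with hs2
  have hs1w : s1.reg 21 = w := by rw [hs1, run_reg _ _ (by rfl), hw]
  have hs1v : s1.reg 20 = v := by rw [hs1, run_reg _ _ (by rfl), hv]
  have henv2 : Env G s2 := ((hs.run _ (by rfl) (by rfl) (by rfl)).setReg 10 _ (by decide)).setReg
    11 _ (by decide)
  have hst2 : Stores s2 κ := ((h.run _ (by rfl) (by rfl) (by rfl)).setReg 10 _ (by decide)).setReg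
    11 _ (by decide)
  obtain ⟨hst3, hR3, -⟩ := move_spec henv2 (d := 9) (by decide) (by decide) (by decide)
    (by decide) (v := w) (y := v) (by simp [hs2]) (by simp [hs2]) (hR1.congr rfl) hst2
  set s3 := (move 9).run n s2 with hs3
  have hs3v : s3.reg 20 = v := by rw [hs3, run_reg _ _ (by rfl)]; simp [hs2, hs1v]
  have hs3w : s3.reg 21 = w := by rw [hs3, run_reg _ _ (by rfl)]; simp [hs2, hs1w]
  have henv3 : Env G s3 := henv2.run _ (by rfl) (by rfl) (by rfl)
  have hf3 : Vec s3 8 f := (((hf.run (copyIn 9 5 21) (by rfl)).congr (s' := s2) rfl).run _ (by rfl))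
  have hrun : slide.run n s = (forN 24 (ite (ne (reg 22) (reg 21))
      (seq (assign 23 (entry 5 21 22)) (seq (assign 10 (reg 22)) (seq (assign 11 (reg 23))
        (seq (move 8) (seq (assign 22 (reg 12)) (ite (ne (reg 22) (reg 21))
          (seq (assign 10 (reg 23)) (seq (assign 11 (reg 22)) (move 9))) skip))))))
      skip)).run n (s3.setReg 22 v) := by
    simp only [slide, run_seq, run_assign, eval_reg, ← hs1, hs1w]
    rw [State.setReg_reg_of_ne _ _ (by decide), hs1v, ← hs2, ← hs3, hs3v]
  rw [hrun]
  have hinit := Search.Slide.init hm hr hκ hwork hKw hwv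
  refine forN_fin_rule (Q := fun s' => ∃ κ' g, κ.Ext κ' ∧ κ'.Good G U m r ∧ Stores s' κ' ∧
    Vec s' 8 g ∧ κ'.Work G U m r g w ∧ κ'.Keeps f g)
    (fun k s' => Env G s' ∧ s'.reg 21 = w ∧ ∃ κ' g R u, κ.Ext κ' ∧ Stores s' κ' ∧ Vec s' 8 g ∧
      Vec s' 9 R ∧ s'.reg 22 = (u : Fin n) ∧ Search.Slide G U m r K f w κ' g R u ∧
      (u ≠ w → k ≤ (Finset.univ.filter fun u => g u = K u).card)) ?_ ?_ ?_
  · exact ⟨henv3.setReg 22 _ (by decide), by simp [hs3w], _, f, _, v, Search.ext_insert _ _ _,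
      hst3.setReg 22 _ (by decide), hf3.congr rfl, hR3.congr rfl, by simp, hinit,
      fun _ => Nat.zero_le _⟩
  · rintro k s' ⟨henv, h21, κ', g, R, u, hext, hst, hg, hR, hu, hsl, hcard⟩
    by_cases huw : u = w
    · rw [run_ite_of_eq _ _ (by simp [hu, h21, huw])]
      exact ⟨henv.setReg 24 _ (by decide), by simp [h21], κ', g, R, u, hext,
        hst.setReg 24 _ (by decide), hg.congr rfl, hR.congr rfl, by simp [hu], hsl,
        fun h => (h huw).elim⟩
    · have huw' : (u : ℕ) ≠ w := fun h => huw (Fin.ext h)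
      rw [run_ite_of_ne _ _ (by simp [hu, h21, huw'])]
      obtain ⟨hstep1, hstep2, hlt⟩ := hsl.step hm hr hKw.near huw
      have hKu : s'.arr 5 (w * n + u) = K u := by
        rw [hst.mx w (hext.ts_ne hts) u, (hext w hts).2]
      set t1 := (((s'.setReg 24 k).setReg 23 (K u)).setReg 10 u).setReg 11 (K u) with ht1
      have henv1 : Env G t1 := (((henv.setReg 24 _ (by decide)).setReg 23 _ (by decide)).setReg
        10 _ (by decide)).setReg 11 _ (by decide)
      have hst1 : Stores t1 κ' := (((hst.setReg 24 _ (by decide)).setReg 23 _ (by decide)).setReg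
        10 _ (by decide)).setReg 11 _ (by decide)
      obtain ⟨hst2, hg2, h12⟩ := move_spec henv1 (d := 8) (by decide) (by decide) (by decide)
        (by decide) (v := u) (y := K u) (by simp [ht1]) (by simp [ht1]) (hg.congr rfl) hst1
      set t2 := (move 8).run n t1 with ht2
      have henv2' : Env G t2 := henv1.run _ (by rfl) (by rfl) (by rfl)
      have hR2 : Vec t2 9 R := (hR.congr (s' := t1) rfl).run _ (by rfl)
      have h21' : t2.reg 21 = w := by rw [ht2, run_reg _ _ (by rfl)]; simp [ht1, h21]
      have h23' : t2.reg 23 = K u := by rw [ht2, run_reg _ _ (by rfl)]; simp [ht1]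
      have hbody : ∀ c : Cmd, (seq (assign 23 (entry 5 21 22)) (seq (assign 10 (reg 22))
          (seq (assign 11 (reg 23)) (seq (move 8) (seq (assign 22 (reg 12)) c))))).run n
          (s'.setReg 24 k) = c.run n (t2.setReg 22 (g (K u))) := by
        intro c
        simp only [run_seq, run_assign]
        rw [(henv.setReg 24 _ (by decide)).eval_entry (X := w) (Y := u) (by simp [h21])
          (by simp [hu])]
        simp only [State.setReg_arr, hKu, eval_reg]
        rw [State.setReg_reg_of_ne _ _ (by decide), State.setReg_reg_of_ne _ _ (by decide), hu,
          State.setReg_reg_of_ne _ _ (by decide), State.setReg_reg_self, ← ht1, ← ht2, h12]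
      rw [hbody]
      have hcard' : (k : ℕ) + 1 ≤
          (Finset.univ.filter fun v => rotate g u (K u) v = K v).card :=
        (hcard huw).trans_lt hlt
      by_cases hzw : g (K u) = w
      · rw [run_ite_of_eq _ _ (by simp [hzw, h21'])]
        exact ⟨henv2'.setReg 22 _ (by decide), by simp [h21'], _, _, R, g (K u),
          hext.trans (Search.ext_insert _ _ _), hst2.setReg 22 _ (by decide), hg2.congr rfl,
          hR2.congr rfl, by simp, hstep1 hzw, fun _ => hcard'⟩
      · have hzw' : (g (K u) : ℕ) ≠ w := fun h => hzw (Fin.ext h)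
        rw [run_ite_of_ne _ _ (by simp [h21', hzw'])]
        set t3 := ((t2.setReg 22 (g (K u))).setReg 10 (K u)).setReg 11 (g (K u)) with ht3
        have hrun3 : (seq (assign 10 (reg 23)) (seq (assign 11 (reg 22)) (move 9))).run n
            (t2.setReg 22 (g (K u))) = (move 9).run n t3 := by
          simp [ht3, h23']
        rw [hrun3]
        obtain ⟨hst4, hR4, -⟩ := move_spec (s := t3) (G := G) (d := 9) (f := R)
          (((henv2'.setReg 22 _ (by decide)).setReg 10 _ (by decide)).setReg 11 _ (by decide))
          (by decide) (by decide) (by decide) (by decide) (v := K u) (y := g (K u))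
          (by simp [ht3]) (by simp [ht3]) (hR2.congr rfl)
          (((hst2.setReg 22 _ (by decide)).setReg 10 _ (by decide)).setReg 11 _ (by decide))
        refine ⟨(((henv2'.setReg 22 _ (by decide)).setReg 10 _ (by decide)).setReg 11 _
            (by decide)).run _ (by rfl) (by rfl) (by rfl), ?_, _, _, _, g (K u),
          (hext.trans (Search.ext_insert _ _ _)).trans (Search.ext_insert _ _ _), hst4,
          (hg2.congr (s' := t3) rfl).run (move 9) (by rfl), hR4, ?_, hstep2 hzw, fun _ => hcard'⟩
        · rw [run_reg _ _ (by rfl)]; simp [ht3, h21']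
        · rw [run_reg _ _ (by rfl)]; simp [ht3]
  · rintro s' ⟨henv, h21, κ', g, R, u, hext, hst, hg, hR, hu, hsl, hcard⟩
    -- After `n` iterations short of `w` there would be agreement everywhere, even at `u`, which the
    -- current matching exposes and `K` covers.
    have huw : u = w := by
      by_contra hne
      have hc := hcard hne
      have hall : (Finset.univ.filter fun u => g u = K u) = Finset.univ :=
        Finset.eq_univ_of_card _ (le_antisymm (Finset.card_le_univ _) (by simpa using hc))
      have := Finset.mem_univ u
      rw [← hall, Finset.mem_filter, hsl.work.near.self] at this
      exact hKw.near.ne_of_cov hsl.work.cov hne this.2.symm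
    subst huw
    exact ⟨κ', g, hext, hsl.good, hst.setReg 24 _ (by decide), hg.congr rfl, hsl.work, hsl.keeps⟩

end Cmd

end Ram

namespace Ram

namespace Cmd

open Ram.Expr

variable {n : ℕ} {G : SimpleGraph (Fin n)} {s s' : State} {κ κ₀ : Search (Fin n)}
  {f m : Fin n → Fin n} {U : Finset (Fin n)} {r : Fin n} {a b x : ℕ}

/-- Fill array `a` with the values of an expression. -/
theorem fill_spec {e : Expr} {v : Fin n → ℕ}
    (h : ∀ (s' : State) (k : Fin n), s'.reg 1 = (k : ℕ) → (∀ b ≠ a, s'.arr b = s.arr b) →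
      e.eval s' = v k) (y : Fin n) :
    ((forN 1 (write a (reg 1) e)).run n s).arr a y = v y := by
  revert y
  refine forN_fin_rule (Q := fun s' => ∀ y : Fin n, s'.arr a y = v y)
    (fun k s' => (∀ b ≠ a, s'.arr b = s.arr b) ∧ ∀ y : Fin n, (y : ℕ) < k → s'.arr a y = v y)
    ⟨fun _ _ => rfl, fun y hy => absurd hy (Nat.not_lt_zero _)⟩ ?_ fun s' hs' y => hs'.2 y y.2
  rintro k s' ⟨h1, h2⟩
  refine ⟨fun b hb => by simp [hb, h1], fun y hy => ?_⟩
  rw [run_write, eval_reg, State.setReg_reg_self, State.setArr_arr_self,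
    h (s'.setReg 1 k) k (by simp) h1]
  by_cases hyk : y = k
  · simp [hyk]
  · have : (y : ℕ) ≠ k := fun h => hyk (Fin.ext h)
    simp only [ne_eq, this, not_false_eq_true, Function.update_of_ne, State.setReg_arr]
    exact h2 y (by omega)

/-! ### Exploring a component -/

/-- Slide from the vertex in register `20` to the vertex in register `21` if this is possible and
useful. -/
def visit : Cmd :=
  ite (cell 4 21) (ite (Expr.not (cell 7 21)) (ite (adj 20 21) (seq (copyIn 8 6 20) (seq slide
    (seq (copyOut 6 21 8) (write 7 (reg 21) (const 1))))) skip) skip) skip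

/-- Slide from the vertex in register `30` through its component of the graph on the reached
vertices. -/
def explore : Cmd :=
  seq (forN 1 (write 7 (reg 1) (const 0))) (seq (write 7 (reg 30) (const 1))
    (seq (copyIn 8 5 30) (seq (copyOut 6 30 8)
      (forN 31 (forN 20 (ite (cell 7 20) (forN 21 visit) skip))))))

/-- The invariant of the exploration. -/
structure Exploring (G : SimpleGraph (Fin n)) (U : Finset (Fin n)) (m : Fin n → Fin n) (r : Fin n)
    (κ₀ : Search (Fin n)) (X : Fin n) (s : State) : Prop where
  env : Env G s
  ex : ∃ κ, κ₀.Ext κ ∧ κ.Good G U m r ∧ Stores s κ ∧ ∀ w : Fin n, s.arr 7 w ≠ 0 →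
    ∃ g, Row s 6 w g ∧ κ.Work G U m r g w ∧ κ.Keeps (κ₀.mx X) g

variable {X : Fin n}

theorem Exploring.setReg (h : Exploring G U m r κ₀ X s) (x k : ℕ) (h0 : 0 ≠ x) (h2 : 2 ≠ x) :
    Exploring G U m r κ₀ X (s.setReg x k) := by
  obtain ⟨κ, h1, hg, h3, h4⟩ := h.ex
  exact ⟨h.env.setReg x k h0, κ, h1, hg, h3.setReg x k h2, h4⟩

theorem visit_spec (hm : IsMatch G U m) (hr : r ∈ U) (h : Exploring G U m r κ₀ X s) {w w' : Fin n}
    (hw : s.reg 20 = w) (hw' : s.reg 21 = w') (hmark : s.arr 7 w ≠ 0) :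
    Exploring G U m r κ₀ X (visit.run n s) ∧
      (∀ u : Fin n, s.arr 7 u ≠ 0 → (visit.run n s).arr 7 u ≠ 0) ∧
      ((κ₀.graph G).Adj w w' → (visit.run n s).arr 7 w' ≠ 0) := by
  obtain ⟨κ, hext, hg, hst, hrow⟩ := h.ex
  unfold visit
  by_cases hts : κ.ts w' = 0
  · rw [run_ite_of_eq _ _ (by simp [hw', hst.ts, hts])]
    exact ⟨h, fun _ h => h, fun hadj => (hext.ts_ne hadj.2.2 hts).elim⟩
  rw [run_ite_of_ne _ _ (by simp [hw', hst.ts, hts])]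
  by_cases hm7 : s.arr 7 w' = 0
  swap
  · rw [run_ite_of_eq _ _ (by simp [hw', hm7])]
    exact ⟨h, fun _ h => h, fun _ => hm7⟩
  rw [run_ite_of_ne _ _ (by simp [hw', hm7])]
  by_cases hadj : G.Adj w w'
  swap
  · rw [run_ite_of_eq _ _ (not_not.1 (mt (h.env.eval_adj hw hw').1 hadj))]
    exact ⟨h, fun _ h => h, fun h => (hadj h.1).elim⟩
  rw [run_ite_of_ne _ _ ((h.env.eval_adj hw hw').2 hadj)]
  obtain ⟨g, hgrow, hgwork, hgkeep⟩ := hrow w hmark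
  have hv8 : Vec ((copyIn 8 6 20).run n s) 8 g :=
    copyIn_spec h.env hw (by decide) (by decide) (by decide) hgrow
  set s1 := (copyIn 8 6 20).run n s with hs1
  have henv1 : Env G s1 := h.env.run _ (by rfl) (by rfl) (by rfl)
  obtain ⟨κ', g', hext', hg', hst', hv8', hwork', hkeep'⟩ := slide_spec henv1 hm hr
    (hst.run _ (by rfl) (by rfl) (by rfl)) hg (v := w) (w := w')
    (by rw [hs1, run_reg _ _ (by rfl), hw]) (by rw [hs1, run_reg _ _ (by rfl), hw']) hts hadj.symm
    hv8 hgwork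
  set s2 := slide.run n s1 with hs2
  have henv2 : Env G s2 := henv1.run _ (by rfl) (by rfl) (by rfl)
  have h21 : s2.reg 21 = w' := by
    rw [hs2, run_reg _ _ (by rfl), hs1, run_reg _ _ (by rfl), hw']
  obtain ⟨hrow3, hrow3'⟩ := copyOut_spec henv2 (a := 6) h21 (by decide) (by decide) (by decide)
    hv8'
  set s3 := (copyOut 6 21 8).run n s2 with hs3
  have h21' : s3.reg 21 = w' := by rw [hs3, run_reg _ _ (by rfl), h21]
  have hrun : (seq (copyIn 8 6 20) (seq slide (seq (copyOut 6 21 8)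
      (write 7 (reg 21) (const 1))))).run n s = s3.setArr 7 w' 1 := by
    simp [← hs1, ← hs2, ← hs3, h21']
  have h7 : s3.arr 7 = s.arr 7 := by
    rw [hs3, run_arr _ _ (by rfl), hs2, run_arr _ _ (by rfl), hs1, run_arr _ _ (by rfl)]
  have h6 : s2.arr 6 = s.arr 6 := by
    rw [hs2, run_arr _ _ (by rfl), hs1, run_arr _ _ (by rfl)]
  rw [hrun]
  refine ⟨⟨(henv2.run _ (by rfl) (by rfl) (by rfl)).setArr 7 _ _ (by decide) (by decide), κ',
    hext.trans hext', hg', (hst'.run _ (by rfl) (by rfl) (by rfl)).setArr 7 _ _ (by decide)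
    (by decide), fun u hu => ?_⟩, fun u hu => ?_, fun _ => by simp⟩
  · by_cases huw : u = w'
    · subst huw
      -- Slides compose: at an edge to a vertex that is still unreached, `g` agrees with the initial
      -- matching, and then `g'` with `g`.
      refine ⟨g', hrow3.congr (by simp), hwork', fun p hp => ?_⟩
      have h1 := hext'.keeps hgkeep p hp
      exact (hkeep' p (h1 ▸ hp)).trans h1
    · have hne : (u : ℕ) ≠ w' := fun h => huw (Fin.ext h)
      rw [State.setArr_arr_self, Function.update_of_ne hne, h7] at hu
      obtain ⟨g₁, h1, h2, h3⟩ := hrow u hu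
      exact ⟨g₁, (hrow3' u huw g₁ (h1.congr h6)).congr (by simp), h2.ext hext', hext'.keeps h3⟩
  · by_cases huw : u = w'
    · simp [huw]
    · have hne : (u : ℕ) ≠ w' := fun h => huw (Fin.ext h)
      rwa [State.setArr_arr_self, Function.update_of_ne hne, h7]

theorem visit_loop_spec (hm : IsMatch G U m) (hr : r ∈ U) (h : Exploring G U m r κ₀ X s)
    {w : Fin n} (hw : s.reg 20 = w) (hmark : s.arr 7 w ≠ 0) :
    Exploring G U m r κ₀ X ((forN 21 visit).run n s) ∧
      (∀ u : Fin n, s.arr 7 u ≠ 0 → ((forN 21 visit).run n s).arr 7 u ≠ 0) ∧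
      ∀ w', (κ₀.graph G).Adj w w' → ((forN 21 visit).run n s).arr 7 w' ≠ 0 := by
  refine forN_fin_rule (Q := fun s' => Exploring G U m r κ₀ X s' ∧
      (∀ u : Fin n, s.arr 7 u ≠ 0 → s'.arr 7 u ≠ 0) ∧
      ∀ w', (κ₀.graph G).Adj w w' → s'.arr 7 w' ≠ 0)
    (fun k s' => Exploring G U m r κ₀ X s' ∧ s'.reg 20 = w ∧
      (∀ u : Fin n, s.arr 7 u ≠ 0 → s'.arr 7 u ≠ 0) ∧
      ∀ w' : Fin n, (w' : ℕ) < k → (κ₀.graph G).Adj w w' → s'.arr 7 w' ≠ 0)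
    ⟨h, hw, fun _ h => h, fun _ h => absurd h (Nat.not_lt_zero _)⟩ ?_ ?_
  · rintro k s' ⟨h1, h2, h3, h4⟩
    obtain ⟨e1, e2, e3⟩ := visit_spec hm hr (h1.setReg 21 k (by decide) (by decide)) (w := w)
      (w' := k) (by simp [h2]) (by simp) (h3 w hmark)
    refine ⟨e1, by rw [run_reg _ _ (by rfl)]; simp [h2], fun u hu => e2 u (h3 u hu),
      fun w' hw' hadj => ?_⟩
    by_cases hk : w' = k
    · exact hk ▸ e3 (hk ▸ hadj)
    · have hne : (w' : ℕ) ≠ k := fun h => hk (Fin.ext h)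
      exact e2 w' (h4 w' (by omega) hadj)
  · rintro s' ⟨h1, h2, h3, h4⟩
    exact ⟨h1.setReg 21 n (by decide) (by decide), h3, fun w' => h4 w' w'.2⟩

/-- One sweep marks all neighbours of marked vertices, so `k` sweeps mark everything within distance
`k`. -/
theorem visit_loop_loop_spec (hm : IsMatch G U m) (hr : r ∈ U) (h : Exploring G U m r κ₀ X s) :
    Exploring G U m r κ₀ X ((forN 20 (ite (cell 7 20) (forN 21 visit) skip)).run n s) ∧
      (∀ u : Fin n, s.arr 7 u ≠ 0 →
        ((forN 20 (ite (cell 7 20) (forN 21 visit) skip)).run n s).arr 7 u ≠ 0) ∧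
      ∀ w w' : Fin n, s.arr 7 w ≠ 0 → (κ₀.graph G).Adj w w' →
        ((forN 20 (ite (cell 7 20) (forN 21 visit) skip)).run n s).arr 7 w' ≠ 0 := by
  refine forN_fin_rule (Q := fun s' => Exploring G U m r κ₀ X s' ∧
      (∀ u : Fin n, s.arr 7 u ≠ 0 → s'.arr 7 u ≠ 0) ∧
      ∀ w w' : Fin n, s.arr 7 w ≠ 0 → (κ₀.graph G).Adj w w' → s'.arr 7 w' ≠ 0)
    (fun k s' => Exploring G U m r κ₀ X s' ∧
      (∀ u : Fin n, s.arr 7 u ≠ 0 → s'.arr 7 u ≠ 0) ∧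
      ∀ w w' : Fin n, (w : ℕ) < k → s.arr 7 w ≠ 0 → (κ₀.graph G).Adj w w' → s'.arr 7 w' ≠ 0)
    ⟨h, fun _ h => h, fun _ _ h => absurd h (Nat.not_lt_zero _)⟩ ?_ ?_
  · rintro k s' ⟨h1, h3, h4⟩
    have h1' := h1.setReg 20 k (by decide) (by decide)
    by_cases hmark : s'.arr 7 k = 0
    · rw [run_ite_of_eq _ _ (by simp [hmark])]
      refine ⟨h1', h3, fun w w' hwk hw => h4 w w' ?_ hw⟩
      have : (w : ℕ) ≠ k := fun e => h3 w hw (by rw [e, hmark])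
      omega
    · rw [run_ite_of_ne _ _ (by simp [hmark])]
      obtain ⟨e1, e2, e3⟩ := visit_loop_spec hm hr h1' (w := k) (by simp) hmark
      refine ⟨e1, fun u hu => e2 u (h3 u hu), fun w w' hwk hw hadj => ?_⟩
      by_cases hk : w = k
      · exact e3 w' (hk ▸ hadj)
      · have hne : (w : ℕ) ≠ k := fun h => hk (Fin.ext h)
        exact e2 w' (h4 w w' (by omega) hw hadj)
  · rintro s' ⟨h1, h3, h4⟩
    exact ⟨h1.setReg 20 n (by decide) (by decide), h3, fun w w' => h4 w w' w.2⟩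

/-- Sliding from `X` to `p` ends with a matching that exposes `p`. If the partner of `p` under `κ.mx
X` were unreached, `Keeps` would have preserved their edge. -/
theorem explore_spec (hs : Env G s) (hm : IsMatch G U m) (hr : r ∈ U) (h : Stores s κ)
    (hκ : κ.Good G U m r) (hX : s.reg 30 = X) (hts : κ.ts X ≠ 0) :
    ∃ κ', κ.Ext κ' ∧ κ'.Good G U m r ∧ Stores (explore.run n s) κ' ∧
      ∀ p, (κ.graph G).Reachable X p → p ≠ X → κ'.ts (κ.mx X p) ≠ 0 := by
  set s1 := (forN 1 (write 7 (reg 1) (const 0))).run n s with hs1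
  have h7 : ∀ y : Fin n, s1.arr 7 y = 0 := fill_spec (v := fun _ => 0) fun _ _ _ _ => rfl
  set s2 := s1.setArr 7 X 1 with hs2
  have henv2 : Env G s2 := (hs.run _ (by rfl) (by rfl) (by rfl)).setArr 7 _ _ (by decide)
    (by decide)
  have hst2 : Stores s2 κ := (h.run _ (by rfl) (by rfl) (by rfl)).setArr 7 _ _ (by decide)
    (by decide)
  have h30 : s1.reg 30 = X := by rw [hs1, run_reg _ _ (by rfl), hX]
  set s3 := (copyIn 8 5 30).run n s2 with hs3
  have hv3 : Vec s3 8 (κ.mx X) :=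
    copyIn_spec henv2 h30 (by decide) (by decide) (by decide) (hst2.mx X hts)
  have henv3 : Env G s3 := henv2.run _ (by rfl) (by rfl) (by rfl)
  have hst3 : Stores s3 κ := hst2.run _ (by rfl) (by rfl) (by rfl)
  set s4 := (copyOut 6 30 8).run n s3 with hs4
  have hrow4 : Row s4 6 X (κ.mx X) := (copyOut_spec henv3 (by
    rw [hs3, run_reg _ _ (by rfl)]; exact h30) (by decide) (by decide) (by decide) hv3).1
  have hmark : ∀ u : Fin n, s4.arr 7 u ≠ 0 ↔ u = X := by
    intro u
    rw [hs4, run_arr _ _ (by rfl), hs3, run_arr _ _ (by rfl), hs2, State.setArr_arr_self]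
    by_cases hu : u = X
    · simp [hu]
    · have : (u : ℕ) ≠ X := fun h => hu (Fin.ext h)
      simp [this, hu, h7]
  have hexp : Exploring G U m r κ X s4 := by
    refine ⟨henv3.run _ (by rfl) (by rfl) (by rfl), κ, Search.Ext.refl _, hκ,
      hst3.run _ (by rfl) (by rfl) (by rfl), fun w hw => ?_⟩
    obtain rfl := (hmark w).1 hw
    exact ⟨_, hrow4, hκ.work hts, fun _ _ => rfl⟩
  have hrun : explore.run n s =
      (forN 31 (forN 20 (ite (cell 7 20) (forN 21 visit) skip))).run n s4 := by
    simp only [explore, run_seq, run_write, eval_reg, eval_const, ← hs1, h30, ← hs2, ← hs3, ← hs4]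
  rw [hrun]
  refine forN_fin_rule (Q := fun s' => ∃ κ', κ.Ext κ' ∧ κ'.Good G U m r ∧ Stores s' κ' ∧
      ∀ p, (κ.graph G).Reachable X p → p ≠ X → κ'.ts (κ.mx X p) ≠ 0)
    (fun k s' => Exploring G U m r κ X s' ∧
      ∀ (w : Fin n) (p : (κ.graph G).Walk w X), p.length ≤ k → s'.arr 7 w ≠ 0)
    ⟨hexp, fun w p hp => (hmark w).2 (SimpleGraph.Walk.eq_of_length_eq_zero (Nat.le_zero.1 hp))⟩
    ?_ ?_
  · rintro k s' ⟨h1, h2⟩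
    obtain ⟨e1, e2, e3⟩ := visit_loop_loop_spec hm hr (h1.setReg 31 k (by decide) (by decide))
    refine ⟨e1, fun w p hp => ?_⟩
    cases p with
    | nil => exact e2 _ (h2 _ SimpleGraph.Walk.nil (by simp))
    | cons hadj q =>
      rw [SimpleGraph.Walk.length_cons] at hp
      exact e3 _ w (h2 _ q (by omega)) hadj.symm
  · rintro s' ⟨h1, h2⟩
    obtain ⟨κ', hext, hg, hst, hrow⟩ := h1.ex
    refine ⟨κ', hext, hg, hst.setReg 31 _ (by decide), fun p hreach hpX h0 => ?_⟩
    obtain ⟨q⟩ := hreach.symm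
    -- A path has fewer than `n` edges, so `n` sweeps mark the whole component.
    have hlt := q.toPath.2.length_lt
    rw [Fintype.card_fin] at hlt
    obtain ⟨g, -, hwork, hkeep⟩ := hrow p (h2 p q.toPath hlt.le)
    have := hkeep p h0
    rw [hwork.near.self] at this
    exact (hκ.near X hts).ne_of_cov hwork.cov hpX this.symm

/-! ### The search -/

/-- Move the matching of the vertex in register `30` along the edge to the vertex in register
`32`. -/
def expand : Cmd :=
  ite (adj 30 32) (ite (add (ne (cell 3 32) (reg 32)) (Expr.not (ne (reg 32) (reg 34))))
    (seq (copyIn 8 5 30) (seq (assign 10 (reg 30)) (seq (assign 11 (reg 32)) (move 8)))) skip) skip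

/-- A round of the search. -/
def round : Cmd :=
  seq (forN 30 (ite (cell 4 30) (forN 32 expand) skip)) (forN 30 (ite (cell 4 30) explore skip))

/-- The search from the vertex in register `34`. -/
def search : Cmd :=
  seq (forN 1 (write 4 (reg 1) (const 0))) (seq (assign 2 (const 0))
    (seq (forN 1 (write 8 (reg 1) (cell 3 1))) (seq (assign 12 (reg 34)) (seq (insert 8)
      (forN 33 round)))))

/-- The invariant of the search. -/
structure Searching (G : SimpleGraph (Fin n)) (U : Finset (Fin n)) (m : Fin n → Fin n) (r : Fin n)
    (κ : Search (Fin n)) (s : State) : Prop where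
  env : Env G s
  vec : Vec s 3 m
  root : s.reg 34 = r
  stores : Stores s κ
  good : κ.Good G U m r

theorem Searching.setReg (h : Searching G U m r κ s) (x k : ℕ) (h0 : 0 ≠ x) (h2 : 2 ≠ x)
    (h34 : 34 ≠ x) : Searching G U m r κ (s.setReg x k) :=
  ⟨h.env.setReg x k h0, h.vec, by simp [h34, h.root], h.stores.setReg x k h2, h.good⟩

theorem expand_spec (hm : IsMatch G U m) (hr : r ∈ U) (h : Searching G U m r κ s) {X Y : Fin n}
    (hX : s.reg 30 = X) (hY : s.reg 32 = Y) (hts : κ.ts X ≠ 0) :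
    ∃ κ', κ.Ext κ' ∧ Searching G U m r κ' (expand.run n s) ∧
      (G.Adj X Y → Cov m r Y → κ'.ts (κ.mx X Y) ≠ 0) := by
  unfold expand
  by_cases hadj : G.Adj X Y
  swap
  · rw [run_ite_of_eq _ _ (not_not.1 (mt (h.env.eval_adj hX hY).1 hadj))]
    exact ⟨κ, Search.Ext.refl _, h, fun h' => (hadj h').elim⟩
  rw [run_ite_of_ne _ _ ((h.env.eval_adj hX hY).2 hadj)]
  have htest : (add (ne (cell 3 32) (reg 32)) (Expr.not (ne (reg 32) (reg 34)))).eval s ≠ 0 ↔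
      Cov m r Y := by
    rw [eval_add, ne_eq, Nat.add_eq_zero_iff]
    simp only [eval_ne, eval_not, eval_cell, eval_reg, hY, h.root, h.vec Y, ne_eq, Fin.val_inj,
      Cov]
    tauto
  by_cases hc : Cov m r Y
  swap
  · rw [run_ite_of_eq _ _ (not_not.1 (mt htest.1 hc))]
    exact ⟨κ, Search.Ext.refl _, h, fun _ h' => (hc h').elim⟩
  rw [run_ite_of_ne _ _ (htest.2 hc)]
  have hv : Vec ((copyIn 8 5 30).run n s) 8 (κ.mx X) :=
    copyIn_spec h.env hX (by decide) (by decide) (by decide) (h.stores.mx X hts)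
  set s1 := (copyIn 8 5 30).run n s with hs1
  set s2 := (s1.setReg 10 X).setReg 11 Y with hs2
  have hrun : (seq (copyIn 8 5 30) (seq (assign 10 (reg 30)) (seq (assign 11 (reg 32))
      (move 8)))).run n s = (move 8).run n s2 := by
    have h30 : s1.reg 30 = X := by rw [hs1, run_reg _ _ (by rfl), hX]
    have h32 : s1.reg 32 = Y := by rw [hs1, run_reg _ _ (by rfl), hY]
    simp [← hs1, hs2, h30, h32]
  have henv2 : Env G s2 := ((h.env.run _ (by rfl) (by rfl) (by rfl)).setReg 10 _
    (by decide)).setReg 11 _ (by decide)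
  obtain ⟨h1, -, -⟩ := move_spec henv2 (d := 8) (by decide) (by decide) (by decide) (by decide)
    (v := X) (y := Y) (by simp [hs2]) (by simp [hs2]) (hv.congr rfl)
    (((h.stores.run _ (by rfl) (by rfl) (by rfl)).setReg 10 _ (by decide)).setReg 11 _ (by decide))
  rw [hrun]
  refine ⟨_, Search.ext_insert _ _ _, ⟨henv2.run _ (by rfl) (by rfl) (by rfl),
    ((h.vec.run (copyIn 8 5 30) (by rfl)).congr (s' := s2) rfl).run _ (by rfl), ?_, h1,
    (h.good.move hm hr (h.good.work hts) hadj hc).1⟩, fun _ _ => Search.insert_ts_ne _ _ _⟩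
  rw [run_reg _ _ (by rfl), hs2, State.setReg_reg_of_ne _ _ (by decide),
    State.setReg_reg_of_ne _ _ (by decide), hs1, run_reg _ _ (by rfl), h.root]

theorem expand_loop_spec (hm : IsMatch G U m) (hr : r ∈ U) (h : Searching G U m r κ s)
    {X : Fin n} (hX : s.reg 30 = X) (hts : κ.ts X ≠ 0) :
    ∃ κ', κ.Ext κ' ∧ Searching G U m r κ' ((forN 32 expand).run n s) ∧
      ∀ Y, G.Adj X Y → Cov m r Y → κ'.ts (κ.mx X Y) ≠ 0 := by
  refine forN_fin_rule (Q := fun s' => ∃ κ', κ.Ext κ' ∧ Searching G U m r κ' s' ∧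
      ∀ Y, G.Adj X Y → Cov m r Y → κ'.ts (κ.mx X Y) ≠ 0)
    (fun k s' => s'.reg 30 = X ∧ ∃ κ', κ.Ext κ' ∧ Searching G U m r κ' s' ∧
      ∀ Y : Fin n, (Y : ℕ) < k → G.Adj X Y → Cov m r Y → κ'.ts (κ.mx X Y) ≠ 0)
    ⟨hX, κ, Search.Ext.refl _, h, fun _ h => absurd h (Nat.not_lt_zero _)⟩ ?_ ?_
  · rintro k s' ⟨h1, κ', hext, hS, h2⟩
    obtain ⟨κ'', hext', hS', h3⟩ := expand_spec hm hr
      (hS.setReg 32 k (by decide) (by decide) (by decide)) (X := X) (Y := k) (by simp [h1])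
      (by simp) (hext.ts_ne hts)
    refine ⟨by rw [run_reg _ _ (by rfl)]; simp [h1], κ'', hext.trans hext', hS',
      fun Y hY hadj hc => ?_⟩
    by_cases hk : Y = k
    · subst hk
      rw [← (hext X hts).2]
      exact h3 hadj hc
    · have hne : (Y : ℕ) ≠ k := fun h => hk (Fin.ext h)
      exact hext'.ts_ne (h2 Y (by omega) hadj hc)
  · rintro s' ⟨h1, κ', hext, hS, h2⟩
    exact ⟨κ', hext, hS.setReg 32 _ (by decide) (by decide) (by decide), fun Y => h2 Y Y.2⟩

theorem graph_le (h : Search.Ext κ₀ κ) : κ₀.graph G ≤ κ.graph G :=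
  fun _ _ hadj => ⟨hadj.1, h.ts_ne hadj.2.1, h.ts_ne hadj.2.2⟩

/-- The closure conditions refer to the memory `κ` before the round. If the round reaches nothing
new, they become the hypotheses of `Search.Good.complete`. -/
theorem round_spec (hm : IsMatch G U m) (hr : r ∈ U) (h : Searching G U m r κ s) :
    ∃ κ', κ.Ext κ' ∧ Searching G U m r κ' (round.run n s) ∧
      (∀ x y, κ.ts x ≠ 0 → G.Adj x y → Cov m r y → κ'.ts (κ.mx x y) ≠ 0) ∧
      ∀ x p, κ.ts x ≠ 0 → (κ.graph G).Reachable x p → p ≠ x → κ'.ts (κ.mx x p) ≠ 0 := by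
  obtain ⟨κ₁, hext₁, hS₁, h₁⟩ : ∃ κ', κ.Ext κ' ∧ Searching G U m r κ'
      ((forN 30 (ite (cell 4 30) (forN 32 expand) skip)).run n s) ∧
      ∀ x y, κ.ts x ≠ 0 → G.Adj x y → Cov m r y → κ'.ts (κ.mx x y) ≠ 0 := by
    refine forN_fin_rule (Q := fun s' => ∃ κ', κ.Ext κ' ∧ Searching G U m r κ' s' ∧
        ∀ x y, κ.ts x ≠ 0 → G.Adj x y → Cov m r y → κ'.ts (κ.mx x y) ≠ 0)
      (fun k s' => ∃ κ', κ.Ext κ' ∧ Searching G U m r κ' s' ∧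
        ∀ x y : Fin n, (x : ℕ) < k → κ.ts x ≠ 0 → G.Adj x y → Cov m r y → κ'.ts (κ.mx x y) ≠ 0)
      ⟨κ, Search.Ext.refl _, h, fun _ _ h => absurd h (Nat.not_lt_zero _)⟩ ?_ ?_
    · rintro k s' ⟨κ', hext, hS, h2⟩
      have hS' := hS.setReg 30 k (by decide) (by decide) (by decide)
      by_cases hk0 : κ'.ts k = 0
      · rw [run_ite_of_eq _ _ (by simp [hS.stores.ts, hk0])]
        refine ⟨κ', hext, hS', fun x y hx hts => h2 x y ?_ hts⟩
        have : (x : ℕ) ≠ k := fun e => hext.ts_ne hts (by rw [Fin.ext e, hk0])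
        omega
      · rw [run_ite_of_ne _ _ (by simp [hS.stores.ts, hk0])]
        obtain ⟨κ'', hext', hS'', h3⟩ := expand_loop_spec hm hr hS' (X := k) (by simp) hk0
        refine ⟨κ'', hext.trans hext', hS'', fun x y hx hts hadj hc => ?_⟩
        by_cases hk : x = k
        · subst hk
          rw [← (hext x hts).2]
          exact h3 y hadj hc
        · have hne : (x : ℕ) ≠ k := fun h => hk (Fin.ext h)
          exact hext'.ts_ne (h2 x y (by omega) hts hadj hc)
    · rintro s' ⟨κ', hext, hS, h2⟩
      exact ⟨κ', hext, hS.setReg 30 _ (by decide) (by decide) (by decide), fun x y => h2 x y x.2⟩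
  rw [round, run_seq]
  refine forN_fin_rule (Q := fun s' => ∃ κ', κ.Ext κ' ∧ Searching G U m r κ' s' ∧
      (∀ x y, κ.ts x ≠ 0 → G.Adj x y → Cov m r y → κ'.ts (κ.mx x y) ≠ 0) ∧
      ∀ x p, κ.ts x ≠ 0 → (κ.graph G).Reachable x p → p ≠ x → κ'.ts (κ.mx x p) ≠ 0)
    (fun k s' => ∃ κ', κ₁.Ext κ' ∧ Searching G U m r κ' s' ∧
      ∀ x p : Fin n, (x : ℕ) < k → κ.ts x ≠ 0 → (κ.graph G).Reachable x p → p ≠ x →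
        κ'.ts (κ.mx x p) ≠ 0)
    ⟨κ₁, Search.Ext.refl _, hS₁, fun _ _ h => absurd h (Nat.not_lt_zero _)⟩ ?_ ?_
  · rintro k s' ⟨κ', hext, hS, h2⟩
    have hS' := hS.setReg 30 k (by decide) (by decide) (by decide)
    by_cases hk0 : κ'.ts k = 0
    · rw [run_ite_of_eq _ _ (by simp [hS.stores.ts, hk0])]
      refine ⟨κ', hext, hS', fun x y hx hts => h2 x y ?_ hts⟩
      have : (x : ℕ) ≠ k := fun e => (hext₁.trans hext).ts_ne hts (by rw [Fin.ext e, hk0])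
      omega
    · rw [run_ite_of_ne _ _ (by simp [hS.stores.ts, hk0])]
      obtain ⟨κ'', hext', hg'', hst'', h3⟩ := explore_spec hS'.env hm hr hS'.stores hS'.good
        (X := k) (by simp) hk0
      refine ⟨κ'', hext.trans hext', ⟨hS'.env.run _ (by rfl) (by rfl) (by rfl),
        hS'.vec.run _ (by rfl), by rw [run_reg _ _ (by rfl), hS'.root], hst'', hg''⟩,
        fun x p hx hts hreach hp => ?_⟩
      by_cases hk : x = k
      · subst hk
        rw [← ((hext₁.trans hext) x hts).2]
        exact h3 p (hreach.mono (graph_le (hext₁.trans hext))) hp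
      · have hne : (x : ℕ) ≠ k := fun h => hk (Fin.ext h)
        exact hext'.ts_ne (h2 x p (by omega) hts hreach hp)
  · rintro s' ⟨κ', hext, hS, h2⟩
    exact ⟨κ', hext₁.trans hext, hS.setReg 30 _ (by decide) (by decide) (by decide),
      fun x y hx hadj hc => hext.ts_ne (h₁ x y hx hadj hc), fun x p => h2 x p x.2⟩

theorem search_spec (hs : Env G s) (hm : IsMatch G U m) (hr : r ∈ U) (hmr : m r = r)
    (hv : Vec s 3 m) (hroot : s.reg 34 = r) :
    ∃ κ, Searching G U m r κ (search.run n s) ∧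
      ∀ f u, IsNear G U m r f u → κ.ts u ≠ 0 := by
  set s1 := (forN 1 (write 4 (reg 1) (const 0))).run n s with hs1
  have h4 : ∀ y : Fin n, s1.arr 4 y = 0 := fill_spec (v := fun _ => 0) fun _ _ _ _ => rfl
  have hv1 : Vec (s1.setReg 2 0) 3 m :=
    (hv.run (forN 1 (write 4 (reg 1) (const 0))) (by rfl)).congr (s' := s1.setReg 2 0) rfl
  set s2 := (forN 1 (write 8 (reg 1) (cell 3 1))).run n (s1.setReg 2 0) with hs2
  have hv8 : Vec s2 8 m := fill_spec fun s' k h1 h2 => by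
    rw [eval_cell, h2 3 (by decide), h1, hv1 k]
  have h34 : s2.reg 34 = r := by
    rw [hs2, run_reg _ _ (by rfl), State.setReg_reg_of_ne _ _ (by decide), hs1,
      run_reg _ _ (by rfl), hroot]
  have henv3 : Env G (s2.setReg 12 r) := (((hs.run _ (by rfl) (by rfl) (by rfl)).setReg 2 _
    (by decide)).run _ (by rfl) (by rfl) (by rfl)).setReg 12 _ (by decide)
  have hst3 : Stores (s2.setReg 12 r) ⟨fun _ => 0, fun _ => m, 0⟩ := by
    refine ⟨fun x => ?_, fun x hx => (hx rfl).elim, ?_⟩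
    · rw [State.setReg_arr, hs2, run_arr _ _ (by rfl), State.setReg_arr, h4]
    · rw [State.setReg_reg_of_ne _ _ (by decide), hs2, run_reg _ _ (by rfl),
        State.setReg_reg_self]
  have hst4 := insert_spec henv3 (d := 8) (by decide) (by decide) (z := r) (by simp)
    (hv8.congr rfl) hst3
  set s4 := (insert 8).run n (s2.setReg 12 r) with hs4
  have hgood := Search.good_init (G := G) hm hmr (fun _ => m)
  have hS4 : Searching G U m r _ s4 := ⟨henv3.run _ (by rfl) (by rfl) (by rfl),
    ((hv1.run (forN 1 (write 8 (reg 1) (cell 3 1))) (by rfl)).congr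
      (s' := s2.setReg 12 r) rfl).run _ (by rfl), by
      rw [hs4, run_reg _ _ (by rfl), State.setReg_reg_of_ne _ _ (by decide), h34], hst4, hgood⟩
  have hrun : search.run n s = (forN 33 round).run n s4 := by
    simp only [search, run_seq, run_assign, eval_const, eval_reg, ← hs1, ← hs2, h34, ← hs4]
  rw [hrun]
  refine forN_fin_rule (Q := fun s' => ∃ κ, Searching G U m r κ s' ∧
      ∀ f u, IsNear G U m r f u → κ.ts u ≠ 0)
    -- A round completes the search or reaches another vertex. The root counts already at the start,
    -- so the second alternative would need `n + 1` vertices after `n` rounds.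
    (fun k s' => ∃ κ, Searching G U m r κ s' ∧ ((∀ f u, IsNear G U m r f u → κ.ts u ≠ 0) ∨
      k + 1 ≤ (Finset.univ.filter fun x => κ.ts x ≠ 0).card)) ⟨_, hS4, Or.inr ?_⟩ ?_ ?_
  · rw [zero_add, Nat.succ_le_iff, Finset.card_pos]
    exact ⟨r, Finset.mem_filter.2 ⟨Finset.mem_univ _, by rw [hgood.root]; exact one_ne_zero⟩⟩
  · rintro k s' ⟨κ, hS, hor⟩
    obtain ⟨κ', hext, hS', h1, h2⟩ :=
      round_spec hm hr (hS.setReg 33 k (by decide) (by decide) (by decide))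
    refine ⟨κ', hS', ?_⟩
    rcases hor with hor | hor
    · exact Or.inl fun f u hf => hext.ts_ne (hor f u hf)
    · by_cases hsame : ∀ x, κ'.ts x ≠ 0 → κ.ts x ≠ 0
      · left
        intro f u hf
        exact hext.ts_ne (hS.good.complete hm hmr (fun x y hx hadj hc => hsame _
          (h1 x y hx hadj hc)) (fun x p hx hreach hp => hsame _ (h2 x p hx hreach hp)) hf)
      · right
        push Not at hsame
        obtain ⟨x, hx, hx0⟩ := hsame
        refine Nat.succ_le_of_lt (hor.trans_lt (Finset.card_lt_card ⟨fun y hy => ?_, fun hsub =>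
          ?_⟩))
        · rw [Finset.mem_filter] at hy ⊢
          exact ⟨hy.1, hext.ts_ne hy.2⟩
        · exact (Finset.mem_filter.1 (hsub (Finset.mem_filter.2 ⟨Finset.mem_univ x, hx⟩))).2 hx0
  · rintro s' ⟨κ, hS, hor⟩
    refine ⟨κ, hS.setReg 33 _ (by decide) (by decide) (by decide), hor.resolve_right fun h => ?_⟩
    have := (Finset.univ.filter fun x => κ.ts x ≠ 0).card_le_univ
    rw [Fintype.card_fin] at this
    omega

end Cmd

end Ram

/-- A matching that exposes a neighbour of another exposed vertex extends to a larger one. -/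
theorem IsNear.add_lt {V : Type*} [DecidableEq V] {G : SimpleGraph V} {U : Finset V} {m f : V → V}
    {r x e : V} (h : IsNear G U m r f x) (hr : r ∈ U) (hmr : m r = r) (hx : x ∈ U) (he : e ∈ U)
    (hme : m e = e) (her : e ≠ r) (hadj : G.Adj x e) :
    IsMatch G U (update (update f x e) e x) ∧
      exposed U (update (update f x e) e x) < exposed U m := by
  have hfx : f x = x := (h.fixed x).2 (Or.inl rfl)
  have hfe : f e = e := (h.fixed e).2 (Or.inr ⟨hme, her⟩)
  have hfix : ∀ u, update (update f x e) e x u = u → m u = u ∧ u ≠ r := by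
    intro u hu
    by_cases h1 : u = e
    · subst h1
      rw [update_self] at hu
      exact (hadj.ne hu).elim
    · rw [update_of_ne h1] at hu
      by_cases h2 : u = x
      · subst h2
        rw [update_self] at hu
        exact (hadj.ne hu.symm).elim
      · rw [update_of_ne h2] at hu
        exact ((h.fixed u).1 hu).resolve_left h2
  refine ⟨h.toIsMatch.add hfx hfe hadj hx he, Finset.card_lt_card ⟨fun u hu => ?_, fun hsub => ?_⟩⟩
  · rw [Finset.mem_filter] at hu ⊢
    exact ⟨hu.1, (hfix u hu.2).1⟩
  · exact (hfix r (Finset.mem_filter.1 (hsub (Finset.mem_filter.2 ⟨hr, hmr⟩))).2).2 rfl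

namespace Ram

namespace Expr

/-- Conjunction of tests. -/
def and (e f : Expr) : Expr := not (add (not e) (not f))

@[simp] theorem eval_and (s : State) (e f : Expr) :
    (and e f).eval s = 0 ↔ e.eval s = 0 ∨ f.eval s = 0 := by
  simp only [and, not, eval_sub, eval_const, eval_add]; omega

/-- A test for being a remaining vertex exposed by the current matching. -/
def free (x : ℕ) : Expr := and (cell 10 x) (not (ne (cell 3 x) (reg x)))

end Expr

namespace Cmd

open Ram.Expr

variable {n : ℕ} {G : SimpleGraph (Fin n)} {s s' : State} {κ : Search (Fin n)}
  {f m : Fin n → Fin n} {U : Finset (Fin n)} {r : Fin n} {a b x : ℕ}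

/-- Array `10` holds the set of remaining vertices. -/
def Alive (s : State) (U : Finset (Fin n)) : Prop := ∀ x : Fin n, s.arr 10 x ≠ 0 ↔ x ∈ U

theorem Alive.congr (h : Alive s U) (ha : s'.arr 10 = s.arr 10) : Alive s' U := fun x => ha ▸ h x

theorem eval_free (hU : Alive s U) (hm : Vec s 3 m) {X : Fin n} (hX : s.reg x = X) :
    (free x).eval s = 0 ↔ ¬(X ∈ U ∧ m X = X) := by
  rw [free, eval_and, eval_not, ne_eq, eval_ne, eval_cell, eval_cell, eval_reg, hX, hm X,
    ← hU X, Fin.val_inj]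
  tauto

/-! ### Augmenting -/

/-- Augment the current matching by the edge between the vertices in the registers `30` and `36`
unless it was augmented before. -/
def extend : Cmd :=
  ite (and (not (reg 35)) (and (free 36) (and (ne (reg 36) (reg 34)) (adj 30 36))))
    (seq (copyIn 3 5 30) (seq (write 3 (reg 30) (reg 36)) (seq (write 3 (reg 36) (reg 30))
      (assign 35 (const 1))))) skip

/-- Augment the current matching using the vertices reached by the search. -/
def augment : Cmd :=
  seq (assign 35 (const 0)) (forN 30 (ite (cell 4 30) (forN 36 extend) skip))

/-- The invariant of the augmentation. -/
structure Augmenting (G : SimpleGraph (Fin n)) (U : Finset (Fin n)) (m : Fin n → Fin n)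
    (r : Fin n) (κ : Search (Fin n)) (s : State) : Prop where
  env : Env G s
  alive : Alive s U
  root : s.reg 34 = r
  stores : Stores s κ
  done : (s.reg 35 = 0 ∧ Vec s 3 m) ∨
    (s.reg 35 ≠ 0 ∧ ∃ m', Vec s 3 m' ∧ IsMatch G U m' ∧ exposed U m' < exposed U m)

theorem Augmenting.setReg (h : Augmenting G U m r κ s) (x k : ℕ) (h0 : 0 ≠ x) (h2 : 2 ≠ x)
    (h34 : 34 ≠ x) (h35 : 35 ≠ x) : Augmenting G U m r κ (s.setReg x k) :=
  ⟨h.env.setReg x k h0, h.alive, by simp [h34, h.root], h.stores.setReg x k h2, by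
    rw [State.setReg_reg_of_ne _ _ h35]; exact h.done⟩

/-- The flag in register `35` blocks further augmentations, because the stored matchings are near
the old matching `m` only. -/
theorem extend_spec (hm : IsMatch G U m) (hr : r ∈ U) (hmr : m r = r) (hκ : κ.Good G U m r)
    (h : Augmenting G U m r κ s) {X E : Fin n} (hX : s.reg 30 = X) (hE : s.reg 36 = E)
    (hts : κ.ts X ≠ 0) :
    Augmenting G U m r κ (extend.run n s) ∧ ((extend.run n s).reg 35 = 0 → s.reg 35 = 0 ∧
      (E ∈ U → m E = E → E ≠ r → ¬G.Adj X E)) := by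
  rcases h.done with ⟨h35, hv⟩ | hdone
  · have hfree := eval_free h.alive hv hE
    have hadj := h.env.eval_adj hX hE
    by_cases hc : E ∈ U ∧ m E = E ∧ E ≠ r ∧ G.Adj X E
    · obtain ⟨h1, h2, h3, h4⟩ := hc
      have h3' : (E : ℕ) ≠ r := fun h => h3 (Fin.ext h)
      rw [extend, run_ite_of_ne _ _ (by
        rw [ne_eq, eval_and, eval_and, eval_and, eval_not, eval_ne, hfree, eval_reg, eval_reg,
          eval_reg, h35, hE, h.root]
        tauto)]
      have hXU : X ∈ U := by
        rcases eq_or_ne X r with rfl | hne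
        · exact hr
        · exact hm.mem X (by have := hκ.cov X hts; unfold Cov at this; tauto)
      obtain ⟨hm', hlt⟩ := (hκ.near X hts).add_lt hr hmr hXU h1 h2 h3 h4
      set s1 := (copyIn 3 5 30).run n s with hs1
      have hv1 : Vec s1 3 (κ.mx X) :=
        copyIn_spec h.env hX (by decide) (by decide) (by decide) (h.stores.mx X hts)
      have hrun : (seq (copyIn 3 5 30) (seq (write 3 (reg 30) (reg 36))
          (seq (write 3 (reg 36) (reg 30)) (assign 35 (const 1))))).run n s =
          ((s1.setArr 3 X E).setArr 3 E X).setReg 35 1 := by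
        simp only [run_seq, run_write, run_assign, eval_reg, eval_const, ← hs1, State.setArr_reg]
        rw [hs1, run_reg _ _ (by rfl), run_reg _ _ (by rfl), hX, hE]
      rw [hrun]
      refine ⟨⟨?_, ?_, ?_, ?_, Or.inr ⟨by simp, _, ?_, hm', hlt⟩⟩, fun h0 => by simp at h0⟩
      · exact (((h.env.run (copyIn 3 5 30) (by rfl) (by rfl) (by rfl)).setArr 3 _ _ (by decide)
          (by decide)).setArr 3 _ _ (by decide) (by decide)).setReg 35 _ (by decide)
      · exact h.alive.congr (by simp [hs1, run_arr (copyIn 3 5 30) s (a := 10) (by rfl)])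
      · rw [State.setReg_reg_of_ne _ _ (by decide), State.setArr_reg, State.setArr_reg, hs1,
          run_reg _ _ (by rfl), h.root]
      · exact (((h.stores.run (copyIn 3 5 30) (by rfl) (by rfl) (by rfl)).setArr 3 _ _ (by decide)
          (by decide)).setArr 3 _ _ (by decide) (by decide)).setReg 35 _ (by decide)
      · exact ((hv1.update X E).update E X).congr rfl
    · rw [extend, run_ite_of_eq _ _ (by
        rw [eval_and, eval_and, eval_and, eval_not, eval_ne, hfree, eval_reg, eval_reg,
          eval_reg, h35, hE, h.root, Fin.val_inj]
        rw [← not_iff_not, not_ne_iff] at hadj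
        tauto)]
      exact ⟨h, fun _ => ⟨h35, by tauto⟩⟩
  · rw [extend, run_ite_of_eq _ _ (by simp [hdone.1])]
    exact ⟨h, fun h0 => (hdone.1 h0).elim⟩

theorem augment_spec (hU : Alive s U) (hm : IsMatch G U m) (hr : r ∈ U) (hmr : m r = r)
    (h : Searching G U m r κ s) :
    ∃ m', Vec (augment.run n s) 3 m' ∧ IsMatch G U m' ∧ (exposed U m' < exposed U m ∨
      m' = m ∧ ∀ x e, κ.ts x ≠ 0 → e ∈ U → m e = e → e ≠ r → ¬G.Adj x e) := by
  rw [augment, run_seq, run_assign]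
  have h0 : Augmenting G U m r κ (s.setReg 35 ((const 0).eval s)) :=
    ⟨h.env.setReg 35 _ (by decide), hU, by simp [h.root], h.stores.setReg 35 _ (by decide),
      Or.inl ⟨by simp, h.vec.congr rfl⟩⟩
  refine forN_fin_rule (Q := fun s' => ∃ m', Vec s' 3 m' ∧ IsMatch G U m' ∧
      (exposed U m' < exposed U m ∨
        m' = m ∧ ∀ x e, κ.ts x ≠ 0 → e ∈ U → m e = e → e ≠ r → ¬G.Adj x e))
    (fun k s' => Augmenting G U m r κ s' ∧ (s'.reg 35 = 0 → ∀ x e : Fin n, (x : ℕ) < k →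
      κ.ts x ≠ 0 → e ∈ U → m e = e → e ≠ r → ¬G.Adj x e))
    ⟨h0, fun _ _ _ h => absurd h (Nat.not_lt_zero _)⟩ ?_ ?_
  · rintro k s' ⟨hS, hno⟩
    have hS' := hS.setReg 30 k (by decide) (by decide) (by decide) (by decide)
    by_cases hk : κ.ts k = 0
    · rw [run_ite_of_eq _ _ (by simp [hS.stores.ts, hk])]
      refine ⟨hS', fun h35 x e hx hts => hno (by simpa using h35) x e ?_ hts⟩
      have : (x : ℕ) ≠ k := fun h => hts (by rw [Fin.ext h, hk])
      omega
    · rw [run_ite_of_ne _ _ (by simp [hS.stores.ts, hk])]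
      refine forN_fin_rule (Q := fun t => Augmenting G U m r κ t ∧ (t.reg 35 = 0 →
          ∀ x e : Fin n, (x : ℕ) < k + 1 → κ.ts x ≠ 0 → e ∈ U → m e = e → e ≠ r → ¬G.Adj x e))
        (fun j t => t.reg 30 = k ∧ Augmenting G U m r κ t ∧ (t.reg 35 = 0 → s'.reg 35 = 0 ∧
          ∀ e : Fin n, (e : ℕ) < j → e ∈ U → m e = e → e ≠ r → ¬G.Adj k e))
        ⟨by simp, hS', fun h => ⟨by simpa using h, fun _ h => absurd h (Nat.not_lt_zero _)⟩⟩ ?_ ?_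
      · rintro j t ⟨h30, hT, hj⟩
        obtain ⟨hT', hspec⟩ := extend_spec hm hr hmr h.good (hT.setReg 36 j (by decide) (by decide)
          (by decide) (by decide)) (X := k) (E := j) (by simp [h30]) (by simp) hk
        refine ⟨by rw [run_reg _ _ (by rfl)]; simp [h30], hT', fun h35 => ?_⟩
        obtain ⟨h1, h2⟩ := hspec h35
        obtain ⟨h3, h4⟩ := hj (by simpa using h1)
        refine ⟨h3, fun e he => ?_⟩
        rcases eq_or_ne e j with rfl | hne
        · exact h2
        · have : (e : ℕ) ≠ j := fun h => hne (Fin.ext h)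
          exact h4 e (by omega)
      · rintro t ⟨-, hT, hj⟩
        refine ⟨hT.setReg 36 _ (by decide) (by decide) (by decide) (by decide),
          fun h35 x e hx hts => ?_⟩
        obtain ⟨h3, h4⟩ := hj (by simpa using h35)
        rcases eq_or_ne x k with rfl | hne
        · exact h4 e e.2
        · have : (x : ℕ) ≠ k := fun h => hne (Fin.ext h)
          exact hno h3 x e (by omega) hts
  · rintro s' ⟨hS, hno⟩
    rcases hS.done with ⟨h35, hv⟩ | ⟨-, m', h1, h2, h3⟩
    · exact ⟨m, hv.congr rfl, hm, Or.inr ⟨rfl, fun x e => hno h35 x e x.2⟩⟩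
    · exact ⟨m', h1.congr rfl, h2, Or.inl h3⟩

/-! ### Maximum matchings -/

/-- Try to augment the current matching from every vertex. -/
def pass : Cmd := forN 34 (ite (free 34) (seq search augment) skip)

/-- Compute a maximum matching of the remaining vertices. -/
def maxmatch : Cmd := seq (forN 1 (write 3 (reg 1) (reg 1))) (forN 37 pass)

/-- If no root leads to an augmentation, `m` is unchanged, and completeness of all the searches
excludes the configuration that Berge's theorem provides for a matching that is not maximum. -/
theorem pass_spec (hs : Env G s) (hU : Alive s U) (hv : Vec s 3 m) (hm : IsMatch G U m) :
    ∃ m', Vec (pass.run n s) 3 m' ∧ IsMatch G U m' ∧ (exposed U m' < exposed U m ∨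
      ∀ g, IsMatch G U g → exposed U m' ≤ exposed U g) := by
  refine forN_fin_rule (Q := fun s' => ∃ m', Vec s' 3 m' ∧ IsMatch G U m' ∧
      (exposed U m' < exposed U m ∨ ∀ g, IsMatch G U g → exposed U m' ≤ exposed U g))
    (fun k s' => Env G s' ∧ Alive s' U ∧ ∃ m', Vec s' 3 m' ∧ IsMatch G U m' ∧
      (exposed U m' < exposed U m ∨ m' = m ∧ ∀ (r e x : Fin n) f, (r : ℕ) < k → r ∈ U → e ∈ U →
        r ≠ e → m r = r → m e = e → IsNear G U m r f x → ¬G.Adj x e))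
    ⟨hs, hU, m, hv, hm, Or.inr ⟨rfl, fun _ _ _ _ h => absurd h (Nat.not_lt_zero _)⟩⟩ ?_ ?_
  · rintro k s' ⟨hs', hU', m', hv', hm', hor⟩
    have henv := hs'.setReg 34 k (by decide)
    have hU1 : Alive (s'.setReg 34 k) U := hU'
    have hv1 : Vec (s'.setReg 34 k) 3 m' := hv'
    have hfree := eval_free hU1 hv1 (x := 34) (X := k) (by simp)
    by_cases hk : k ∈ U ∧ m' k = k
    · rw [run_ite_of_ne _ _ (by rw [ne_eq, hfree]; exact not_not.2 hk), run_seq]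
      obtain ⟨κ, hS, hcomp⟩ := search_spec henv hm' hk.1 hk.2 hv1 (by simp)
      obtain ⟨m'', h1, h2, h3⟩ := augment_spec (hU1.congr (run_arr search _ (by rfl))) hm' hk.1
        hk.2 hS
      refine ⟨hS.env.run _ (by rfl) (by rfl) (by rfl), hU1.congr (by
        rw [run_arr _ _ (by rfl), run_arr _ _ (by rfl)]), m'', h1, h2, ?_⟩
      rcases h3 with h3 | ⟨rfl, h3⟩
      · exact Or.inl (h3.trans_le (hor.elim le_of_lt fun h => h.1 ▸ le_rfl))
      · refine hor.imp id fun ⟨h4, h5⟩ => ⟨h4, fun r e x f hr hrU he hre hmr hme hf => ?_⟩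
        subst h4
        rcases eq_or_ne r k with rfl | hne
        · exact h3 x e (hcomp f x hf) he hme hre.symm
        · have : (r : ℕ) ≠ k := fun h => hne (Fin.ext h)
          exact h5 r e x f (by omega) hrU he hre hmr hme hf
    · rw [run_ite_of_eq _ _ (by rwa [hfree])]
      refine ⟨henv, hU1, m', hv1, hm', hor.imp id fun ⟨h4, h5⟩ => ⟨h4,
        fun r e x f hr hrU he hre hmr => h5 r e x f ?_ hrU he hre hmr⟩⟩
      have : (r : ℕ) ≠ k := fun h => hk (by rw [← Fin.ext h, h4]; exact ⟨hrU, hmr⟩)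
      omega
  · rintro s' ⟨-, -, m', hv', hm', hor⟩
    refine ⟨m', hv', hm', hor.imp id fun ⟨h4, h5⟩ g hg => ?_⟩
    subst h4
    by_contra! hlt
    obtain ⟨r, e, x, f, hr, he, hre, hmr, hme, hf, hadj⟩ := hm'.exists_augmentation hg hlt
    exact h5 r e x f r.2 hr he hre hmr hme hf hadj

theorem maxmatch_spec (hs : Env G s) (hU : Alive s U) :
    ∃ m, Vec (maxmatch.run n s) 3 m ∧ IsMatch G U m ∧
      ∀ g, IsMatch G U g → exposed U m ≤ exposed U g := by
  rw [maxmatch, run_seq]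
  have hv : Vec ((forN 1 (write 3 (reg 1) (reg 1))).run n s) 3 (id : Fin n → Fin n) :=
    fill_spec fun _ _ h _ => h
  refine forN_fin_rule (Q := fun s' => ∃ m, Vec s' 3 m ∧ IsMatch G U m ∧
      ∀ g, IsMatch G U g → exposed U m ≤ exposed U g)
    (fun k s' => Env G s' ∧ Alive s' U ∧ ∃ m, Vec s' 3 m ∧ IsMatch G U m ∧
      -- The empty matching exposes at most `n` vertices, and each pass before the maximum lowers
      -- this number; after `n` passes the second alternative means that nothing is exposed.
      ((∀ g, IsMatch G U g → exposed U m ≤ exposed U g) ∨ exposed U m + k ≤ n))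
    ⟨hs.run _ (by rfl) (by rfl) (by rfl), hU.congr (run_arr _ _ (by rfl)), id, hv,
      ⟨fun _ => rfl, fun _ h => (h rfl).elim, fun _ h => (h rfl).elim⟩, Or.inr ?_⟩ ?_ ?_
  · exact (Finset.card_le_univ _).trans_eq (Fintype.card_fin n)
  · rintro k s' ⟨hs', hU', m, hv', hm, hor⟩
    obtain ⟨m', h1, h2, h3⟩ := pass_spec (hs'.setReg 37 k (by decide)) (hU'.congr
      (s' := s'.setReg 37 k) rfl) (hv'.congr (s' := s'.setReg 37 k) rfl) hm
    refine ⟨(hs'.setReg 37 k (by decide)).run _ (by rfl) (by rfl) (by rfl),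
      (hU'.congr (s' := s'.setReg 37 k) rfl).congr (run_arr _ _ (by rfl)), m', h1, h2, ?_⟩
    rcases h3 with h3 | h3
    · rcases hor with hor | hor
      · exact absurd h3 (hor m' h2).not_gt
      · exact Or.inr (by omega)
    · exact Or.inl h3
  · rintro s' ⟨-, -, m, hv', hm, hor⟩
    exact ⟨m, hv', hm, hor.elim id fun h g _ => by omega⟩

/-- Count the exposed vertices in register `38`. -/
def count : Cmd :=
  seq (assign 38 (const 0)) (forN 39 (ite (free 39) (assign 38 (add (reg 38) (const 1))) skip))

theorem count_spec (hU : Alive s U) (hv : Vec s 3 m) : (count.run n s).reg 38 = exposed U m := by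
  rw [count, run_seq]
  refine forN_fin_rule (Q := fun s' => s'.reg 38 = exposed U m)
    (fun k s' => s'.arr = s.arr ∧ s'.reg 38 =
      ((U.filter fun x => m x = x).filter fun x : Fin n => (x : ℕ) < k).card)
    ⟨rfl, by simp⟩ ?_ ?_
  · rintro k s' ⟨h1, h2⟩
    have hfree := eval_free (hU.congr (s' := s'.setReg 39 k) (congrFun h1 10))
      (hv.congr (s' := s'.setReg 39 k) (congrFun h1 3)) (x := 39) (X := k) (by simp)
    by_cases hk : k ∈ U ∧ m k = k
    · rw [run_ite_of_ne _ _ (by rw [ne_eq, hfree]; exact not_not.2 hk)]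
      refine ⟨h1, ?_⟩
      have : (U.filter fun x => m x = x).filter (fun x : Fin n => (x : ℕ) < k + 1) =
          Insert.insert k ((U.filter fun x => m x = x).filter fun x : Fin n => (x : ℕ) < k) := by
        ext x
        simp only [Finset.mem_filter, Finset.mem_insert]
        constructor
        · rintro ⟨h3, h4⟩
          rcases eq_or_ne x k with h | hne
          · exact Or.inl h
          · have : (x : ℕ) ≠ k := fun h => hne (Fin.ext h)
            exact Or.inr ⟨h3, by omega⟩
        · rintro (rfl | h)
          · exact ⟨hk, by omega⟩
          · exact ⟨h.1, by omega⟩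
      rw [this, Finset.card_insert_of_notMem (by simp)]
      simp [h2]
    · rw [run_ite_of_eq _ _ (by rwa [hfree])]
      refine ⟨h1, ?_⟩
      rw [run_skip, State.setReg_reg_of_ne _ _ (by decide), h2]
      congr 1
      refine Finset.filter_congr fun x hx => ?_
      have hx := Finset.mem_filter.1 hx
      have : (x : ℕ) ≠ k := fun h => hk (by rwa [← Fin.ext h])
      omega
  · rintro s' ⟨-, h2⟩
    rw [State.setReg_reg_of_ne _ _ (by decide), h2, Finset.filter_true_of_mem fun x _ => x.2,
      exposed]

end Cmd

end Ram

/-! ## Packings and egalitarian welfare -/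

/-- Edges are split off until two or three vertices are left. -/
theorem Packable.of_isClique {V : Type*} [DecidableEq V] {G : SimpleGraph V} :
    ∀ (k : ℕ) (C : Finset V), C.card = k → G.IsClique (C : Set V) → 2 ≤ k →
      ∃ t, Packable G C t := by
  intro k
  induction k using Nat.strong_induction_on with
  | _ k ih =>
    intro C hC hcl hk
    rcases (by omega : k = 2 ∨ k = 3 ∨ 2 ≤ k - 2) with rfl | rfl | hk'
    · exact ⟨_, by simpa using Packable.empty.edge ⟨hcl, hC⟩ (Finset.disjoint_empty_right _)⟩
    · exact ⟨_, by simpa using Packable.empty.triangle ⟨hcl, hC⟩ (Finset.disjoint_empty_right _)⟩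
    · obtain ⟨e, heC, he⟩ := Finset.exists_subset_card_eq (hC ▸ hk : 2 ≤ C.card)
      obtain ⟨t, ht⟩ := ih (k - 2) (by omega) (C \ e)
        (by rw [Finset.card_sdiff_of_subset heC, hC, he]) (hcl.subset (by simp)) hk'
      have := ht.edge ⟨hcl.subset (by simpa using heC), he⟩ Finset.disjoint_sdiff
      rw [Finset.union_sdiff_of_subset heC] at this
      exact ⟨t, this⟩

theorem Packable.of_isClique_parts {n : ℕ} {G : SimpleGraph (Fin n)} (π : Outcome n)
    (h : ∀ C ∈ π.parts, G.IsClique (C : Set (Fin n)) ∧ 2 ≤ C.card) :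
    ∃ t, Packable G Finset.univ t := by
  have key : ∀ P ⊆ π.parts, ∃ t, Packable G (P.biUnion id) t := by
    intro P
    induction P using Finset.induction_on with
    | empty => exact fun _ => ⟨0, Packable.empty⟩
    | insert C P hC ih =>
      intro hP
      obtain ⟨t, ht⟩ := ih fun D hD => hP (Finset.mem_insert_of_mem hD)
      have hCP := hP (Finset.mem_insert_self C P)
      obtain ⟨t', ht'⟩ := Packable.of_isClique _ C rfl (h C hCP).1 (h C hCP).2
      rw [Finset.biUnion_insert]
      refine ⟨_, ht'.union ht (Finset.disjoint_biUnion_right _ _ _ |>.2 fun D hD => ?_)⟩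
      exact π.disjoint hCP (hP (Finset.mem_insert_of_mem hD)) (by rintro rfl; exact hC hD)
  obtain ⟨t, ht⟩ := key π.parts subset_rfl
  have := π.biUnion_parts
  rw [this] at ht
  exact ⟨t, ht⟩

theorem IsPerfectK2K3Packing.packable {n : ℕ} {G : SimpleGraph (Fin n)} {π : Outcome n}
    (h : IsPerfectK2K3Packing G π) : ∃ t, Packable G Finset.univ t :=
  Packable.of_isClique_parts π fun C hC => (h C hC).elim
    (fun h => ⟨h.isClique, h.card_eq.ge⟩) fun h => ⟨h.isClique, by rw [h.card_eq]; decide⟩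

/-! ### Positive welfare means a packing of the strong friendship graph -/

namespace FriendGame

variable {n : ℕ} (I : FriendGame n)

theorem eaValue_le_one (i j : Fin n) : I.eaValue i j ≤ 1 := by
  unfold eaValue
  split_ifs <;> omega

theorem utility_le (i : Fin n) (C : Finset (Fin n)) : I.utility i C ≤ (C \ {i}).card := by
  refine (Finset.sum_le_card_nsmul _ _ 1 fun j _ => I.eaValue_le_one i j).trans ?_
  simp

theorem card_sdiff_singleton_lt (i : Fin n) (C : Finset (Fin n)) : (C \ {i}).card < n := by
  have : C \ {i} ⊂ Finset.univ := Finset.ssubset_univ_iff.2 fun h => by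
    have := Finset.mem_univ i
    rw [← h] at this
    simp at this
  simpa using Finset.card_lt_card this

/-- An agent with an enemy in her coalition has negative utility. -/
theorem mem_friends_of_utility_nonneg {i j : Fin n} {C : Finset (Fin n)}
    (h : 0 ≤ I.utility i C) (hj : j ∈ C) (hji : j ≠ i) : j ∈ I.friends i := by
  by_contra hf
  have hmem : j ∈ C \ {i} := by simp [hj, hji]
  -- The enemy `j` contributes `-n`, and the at most `n - 2` other members at most `1` each.
  have h1 := Finset.add_sum_erase (C \ {i}) (I.eaValue i) hmem
  have h2 : I.eaValue i j = -n := if_neg hf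
  have h3 : ∑ k ∈ (C \ {i}).erase j, I.eaValue i k ≤ ((C \ {i}).erase j).card := by
    refine (Finset.sum_le_card_nsmul _ _ 1 fun k _ => I.eaValue_le_one i k).trans ?_
    simp
  have h4 := Finset.card_erase_lt_of_mem hmem
  have h5 := card_sdiff_singleton_lt i C
  unfold utility at h
  omega

theorem esw_le (π : Outcome n) (i : Fin n) : I.esw π ≤ I.utility i (π.part i) :=
  ciInf_le (Set.finite_range _).bddBelow i

/-- Positive utility excludes both enemies and solitude, so every coalition is a clique of mutual
friends with at least two members. -/
theorem packable_of_esw_pos {π : Outcome n} (h : 0 < I.esw π) :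
    ∃ t, Packable I.strongGraph Finset.univ t := by
  refine Packable.of_isClique_parts π fun C hC => ?_
  have hut : ∀ i ∈ C, 0 < I.utility i C := fun i hi => by
    have := I.esw_le π i
    rw [π.part_eq_of_mem hC hi] at this
    omega
  refine ⟨fun i hi j hj hij => ⟨I.mem_friends_of_utility_nonneg (hut i hi).le hj hij.symm,
    I.mem_friends_of_utility_nonneg (hut j hj).le hi hij⟩, ?_⟩
  obtain ⟨i, hi⟩ := π.nonempty_of_mem_parts hC
  by_contra! hcard
  have := I.utility_le i C
  rw [Finset.card_sdiff_of_subset (Finset.singleton_subset_iff.2 hi), Finset.card_singleton] at this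
  have := hut i hi
  omega

theorem opt_le (hn : 0 < n) : I.opt ≤ (n : ℤ) - 1 := by
  refine ciSup_le fun π => (I.esw_le π ⟨0, hn⟩).trans ((I.utility_le _ _).trans ?_)
  have := card_sdiff_singleton_lt ⟨0, hn⟩ (π.part ⟨0, hn⟩)
  omega

theorem opt_nonpos (h : ∀ t, ¬Packable I.strongGraph Finset.univ t) : I.opt ≤ 0 :=
  ciSup_le fun _ => not_lt.1 fun hπ => (I.packable_of_esw_pos hπ).elim h

variable {I}

theorem exists_friend_of_isPerfectK2K3Packing {π : Outcome n}
    (h : IsPerfectK2K3Packing I.strongGraph π) (i : Fin n) :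
    (∃ j ∈ π.part i, j ∈ I.friends i) ∧ 1 ≤ I.utility i (π.part i) := by
  have hi : i ∈ π.part i := π.mem_part (Finset.mem_univ i)
  have hC := h (π.part i) (π.part_mem.2 (Finset.mem_univ i))
  have hcl : I.strongGraph.IsClique (π.part i : Set (Fin n)) :=
    hC.elim (fun h => h.isClique) fun h => h.isClique
  have hcard : 2 ≤ (π.part i).card := hC.elim (fun h => h.card_eq.ge) fun h => by
    rw [h.card_eq]; decide
  have hfr : ∀ j ∈ π.part i \ {i}, j ∈ I.friends i := fun j hj => by
    rw [Finset.mem_sdiff, Finset.mem_singleton] at hj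
    exact (hcl hi hj.1 (Ne.symm hj.2)).1
  have hcard' := Finset.card_sdiff_of_subset (Finset.singleton_subset_iff.2 hi)
  rw [Finset.card_singleton] at hcard'
  constructor
  · obtain ⟨j, hj⟩ := Finset.card_pos.1 (by omega : 0 < (π.part i \ {i}).card)
    exact ⟨j, (Finset.mem_sdiff.1 hj).1, hfr j hj⟩
  · have hone : ∀ j ∈ π.part i \ {i}, I.eaValue i j = 1 := fun j hj => if_pos (hfr j hj)
    rw [utility, Finset.sum_congr rfl hone]
    simp only [Finset.sum_const, nsmul_eq_mul, mul_one]
    omega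

theorem one_le_esw (hn : 0 < n) {π : Outcome n} (h : IsPerfectK2K3Packing I.strongGraph π) :
    1 ≤ I.esw π :=
  have : Nonempty (Fin n) := ⟨⟨0, hn⟩⟩
  le_ciInf fun i => (exists_friend_of_isPerfectK2K3Packing h i).2

theorem esw_eq_zero (hn : 0 < n) {π : Outcome n} (h : ∀ i, π.part i = {i}) : I.esw π = 0 := by
  have : Nonempty (Fin n) := ⟨⟨0, hn⟩⟩
  simp [esw, utility, h]

end FriendGame

namespace Ram

namespace Cmd

open Ram.Expr

variable {n : ℕ} {G : SimpleGraph (Fin n)} {s s' : State} {m l : Fin n → Fin n}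
  {U : Finset (Fin n)} {d : ℕ}

/-! ### Removing triangles -/

/-- Set the cells of array `a` at the indices in the registers `41`, `42` and `43`. -/
def write3 (a : ℕ) (e : Expr) : Cmd :=
  seq (write a (reg 41) e) (seq (write a (reg 42) e) (write a (reg 43) e))

/-- Remove the triangle in the registers `41`, `42` and `43` if this decreases the number of exposed
vertices, which register `44` holds. -/
def attempt : Cmd :=
  ite (and (and (cell 10 41) (and (cell 10 42) (cell 10 43)))
      (and (adj 41 42) (and (adj 41 43) (adj 42 43))))
    (seq (write3 10 (const 0)) (seq maxmatch (seq count
      (ite (sub (reg 44) (reg 38)) (seq (assign 44 (reg 38)) (write3 11 (reg 41)))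
        (write3 10 (const 1)))))) skip

/-- Remove triangles as long as this decreases the number of exposed vertices. -/
def greedy : Cmd := forN 40 (forN 41 (forN 42 (forN 43 attempt)))

/-- The vertices outside of `U` are partitioned into triangles, labelled by `l`. -/
def Labels (G : SimpleGraph (Fin n)) (U : Finset (Fin n)) (l : Fin n → Fin n) : Prop :=
  -- Labels of triangles avoid `U`, from which the labels of matching edges are taken.
  ∀ x ∉ U, l x ∉ U ∧ G.IsNClique 3 (Finset.univ.filter fun y => y ∉ U ∧ l y = l x)

/-- The invariant of the removal of triangles. -/
structure Removing (G : SimpleGraph (Fin n)) (U : Finset (Fin n)) (d : ℕ) (s : State) : Prop where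
  env : Env G s
  alive : Alive s U
  reg : s.reg 44 = d
  max : ∃ m, IsMatch G U m ∧ exposed U m = d ∧ ∀ g, IsMatch G U g → d ≤ exposed U g
  labels : ∃ l : Fin n → Fin n, (∀ x ∉ U, s.arr 11 x = l x) ∧ Labels G U l
  packable : (∃ t, Packable G Finset.univ t) → ∃ t, Packable G U t

theorem Removing.setReg (h : Removing G U d s) (x k : ℕ) (h0 : 0 ≠ x) (h44 : 44 ≠ x) :
    Removing G U d (s.setReg x k) :=
  ⟨h.env.setReg x k h0, h.alive, by rw [State.setReg_reg_of_ne _ _ h44, h.reg], h.max, h.labels,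
    h.packable⟩

/-- Removing the triangle decreases the number of exposed vertices below `d`. -/
def Improves (G : SimpleGraph (Fin n)) (U : Finset (Fin n)) (d : ℕ) (a b c : Fin n) : Prop :=
  {a, b, c} ⊆ U ∧ G.IsNClique 3 {a, b, c} ∧
    ∃ g, IsMatch G (U \ {a, b, c}) g ∧ exposed (U \ {a, b, c}) g < d

theorem write3_spec {a b c : Fin n} {i : ℕ} {e : Expr} {v : ℕ} (ha : s.reg 41 = a)
    (hb : s.reg 42 = b) (hc : s.reg 43 = c) (he : ∀ s' : State, s'.reg = s.reg → e.eval s' = v)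
    (x : Fin n) :
    ((write3 i e).run n s).arr i x = if x ∈ ({a, b, c} : Finset (Fin n)) then v else s.arr i x := by
  simp only [write3, run_seq, run_write, eval_reg, State.setArr_reg, State.setArr_arr_self,
    he s rfl, he (s.setArr i a v) rfl, he ((s.setArr i a v).setArr i b v) rfl, ha, hb, hc,
    Finset.mem_insert, Finset.mem_singleton, update_apply, Fin.val_inj]
  by_cases h1 : x = a <;> by_cases h2 : x = b <;> by_cases h3 : x = c <;> simp [h1, h2, h3]

/-- A vertex of the new triangle is a fresh label, as the labels in use lie outside of `U`. -/
theorem Labels.sdiff (h : Labels G U l) {τ : Finset (Fin n)} (hτU : τ ⊆ U)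
    (hτ : G.IsNClique 3 τ) {a : Fin n} (ha : a ∈ τ) :
    Labels G (U \ τ) fun x => if x ∈ τ then a else l x := by
  intro x hx
  by_cases hxτ : x ∈ τ
  · have : (Finset.univ.filter fun y => y ∉ U \ τ ∧ (if y ∈ τ then a else l y) = a) = τ := by
      ext y
      simp only [Finset.mem_filter, Finset.mem_univ, true_and, Finset.mem_sdiff, not_and, not_not]
      by_cases hy : y ∈ τ
      · simp [hy]
      · simp only [hy, imp_false, if_false, iff_false, not_and]
        exact fun hyU hl => (h y hyU).1 (hl ▸ hτU ha)
    simp only [hxτ, if_true, this]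
    exact ⟨by simp [ha], hτ⟩
  · have hxU : x ∉ U := fun hxU => hx (Finset.mem_sdiff.2 ⟨hxU, hxτ⟩)
    have : (Finset.univ.filter fun y => y ∉ U \ τ ∧ (if y ∈ τ then a else l y) = l x) =
        Finset.univ.filter fun y => y ∉ U ∧ l y = l x := by
      ext y
      simp only [Finset.mem_filter, Finset.mem_univ, true_and, Finset.mem_sdiff, not_and, not_not]
      by_cases hy : y ∈ τ
      · simp only [hy, if_true, implies_true, true_and, hτU hy, not_true_eq_false, false_and,
          iff_false]
        exact fun hl => (h x hxU).1 (hl ▸ hτU ha)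
      · simp [hy]
    simp only [hxτ, if_false, this]
    exact ⟨fun hl => (h x hxU).1 (Finset.mem_sdiff.1 hl).1, (h x hxU).2⟩

theorem attempt_spec (h : Removing G U d s) {a b c : Fin n} (ha : s.reg 41 = a)
    (hb : s.reg 42 = b) (hc : s.reg 43 = c) :
    (Removing G U d (attempt.run n s) ∧ ¬Improves G U d a b c) ∨
      ∃ U' d', d' < d ∧ Removing G U' d' (attempt.run n s) := by
  set τ : Finset (Fin n) := {a, b, c} with hτdef
  have haτ : a ∈ τ := by simp [hτdef]
  have htest : (and (and (cell 10 41) (and (cell 10 42) (cell 10 43)))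
      (and (adj 41 42) (and (adj 41 43) (adj 42 43)))).eval s ≠ 0 ↔
      τ ⊆ U ∧ G.IsNClique 3 τ := by
    rw [hτdef, SimpleGraph.is3Clique_triple_iff, ← h.env.eval_adj ha hb, ← h.env.eval_adj ha hc,
      ← h.env.eval_adj hb hc, Finset.insert_subset_iff, Finset.insert_subset_iff,
      Finset.singleton_subset_iff, ← h.alive a, ← h.alive b, ← h.alive c]
    simp only [ne_eq, eval_and, eval_cell, ha, hb, hc, not_or]
  by_cases hτ : τ ⊆ U ∧ G.IsNClique 3 τ
  swap
  · rw [attempt, run_ite_of_eq _ _ (by rwa [← not_ne_iff, htest])]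
    exact Or.inl ⟨h, fun himp => hτ ⟨himp.1, himp.2.1⟩⟩
  rw [attempt, run_ite_of_ne _ _ (htest.2 hτ), run_seq, run_seq, run_seq]
  obtain ⟨hτU, hτ⟩ := hτ
  set s1 := (write3 10 (const 0)).run n s with hs1
  have henv1 : Env G s1 := h.env.run _ (by rfl) (by rfl) (by rfl)
  have hal1 : Alive s1 (U \ τ) := fun x => by
    rw [hs1, write3_spec ha hb hc (v := 0) fun _ _ => rfl, Finset.mem_sdiff, ← h.alive x]
    split_ifs with hx <;> simp_all
  obtain ⟨m, hv, hm, hmax⟩ := maxmatch_spec henv1 hal1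
  set s2 := maxmatch.run n s1 with hs2
  have henv2 : Env G s2 := henv1.run _ (by rfl) (by rfl) (by rfl)
  have hal2 : Alive s2 (U \ τ) := hal1.congr (run_arr _ _ (by rfl))
  have h38 := count_spec hal2 hv
  set s3 := count.run n s2 with hs3
  have henv3 : Env G s3 := henv2.run _ (by rfl) (by rfl) (by rfl)
  have hal3 : Alive s3 (U \ τ) := hal2.congr (run_arr _ _ (by rfl))
  have h44 : s3.reg 44 = d := by
    rw [hs3, run_reg _ _ (by rfl), hs2, run_reg _ _ (by rfl), hs1, run_reg _ _ (by rfl), h.reg]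
  have ha3 : s3.reg 41 = a := by
    rw [hs3, run_reg _ _ (by rfl), hs2, run_reg _ _ (by rfl), hs1, run_reg _ _ (by rfl), ha]
  have hb3 : s3.reg 42 = b := by
    rw [hs3, run_reg _ _ (by rfl), hs2, run_reg _ _ (by rfl), hs1, run_reg _ _ (by rfl), hb]
  have hc3 : s3.reg 43 = c := by
    rw [hs3, run_reg _ _ (by rfl), hs2, run_reg _ _ (by rfl), hs1, run_reg _ _ (by rfl), hc]
  have h11 : s3.arr 11 = s.arr 11 := by
    rw [hs3, run_arr _ _ (by rfl), hs2, run_arr _ _ (by rfl), hs1, run_arr _ _ (by rfl)]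
  obtain ⟨l, hl, hlab⟩ := h.labels
  obtain ⟨m₀, hm₀, hd₀, hmax₀⟩ := h.max
  by_cases hlt : exposed (U \ τ) m < d
  · right
    rw [run_ite_of_ne _ _ (by simp only [eval_sub, eval_reg, h44, h38]; omega), run_seq, run_assign,
      eval_reg, h38]
    set s4 := s3.setReg 44 (exposed (U \ τ) m) with hs4
    refine ⟨U \ τ, _, hlt, (henv3.setReg 44 _ (by decide)).run _ (by rfl) (by rfl) (by rfl),
      (hal3.congr (s' := s4) rfl).congr (run_arr _ _ (by rfl)), ?_, ⟨m, hm, rfl, hmax⟩,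
      ⟨_, fun x hx => ?_, hlab.sdiff hτU hτ haτ⟩, fun hp => ?_⟩
    · rw [run_reg _ _ (by rfl), hs4, State.setReg_reg_self]
    · rw [write3_spec (s := s4) (a := a) (b := b) (c := c) (v := a) (by simp [hs4, ha3])
        (by simp [hs4, hb3]) (by simp [hs4, hc3]) fun s' h' => by
          rw [eval_reg, h', hs4, State.setReg_reg_of_ne _ _ (by decide), ha3]]
      by_cases hxτ : x ∈ τ
      · rw [if_pos hxτ, if_pos hxτ]
      · rw [if_neg hxτ, if_neg hxτ, hs4, State.setReg_arr, h11,
          hl x fun hxU => hx (Finset.mem_sdiff.2 ⟨hxU, hxτ⟩)]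
    -- The removal lowers the minimum number of exposed vertices, so `Packable.sdiff_triangle`
    -- preserves packability.
    · obtain ⟨t, ht⟩ := h.packable hp
      exact ht.sdiff_triangle (m := m₀) (fun g hg => hd₀ ▸ hmax₀ g hg) hτU hτ hm
        (by rwa [hd₀])
  -- The triangle is put back. Array `3` keeps a matching of the smaller set, which does no harm:
  -- the invariant does not mention this array, and `maxmatch` always starts from the empty
  -- matching.
  · left
    rw [run_ite_of_eq _ _ (by simp only [eval_sub, eval_reg, h44, h38]; omega)]
    refine ⟨⟨henv3.run _ (by rfl) (by rfl) (by rfl), fun x => ?_, ?_, h.max, ⟨l, fun x hx => ?_,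
      hlab⟩, h.packable⟩, fun ⟨_, _, g, hg, hgd⟩ => hlt ((hmax g hg).trans_lt hgd)⟩
    · rw [write3_spec ha3 hb3 hc3 (v := 1) fun _ _ => rfl]
      by_cases hxτ : x ∈ τ
      · rw [if_pos hxτ]
        exact iff_of_true one_ne_zero (hτU hxτ)
      · rw [if_neg hxτ, hal3 x, Finset.mem_sdiff]
        exact and_iff_left hxτ
    · rw [run_reg _ _ (by rfl), h44]
    · rw [run_arr _ _ (by rfl), h11, hl x hx]

/-- The invariant of a pass through all triangles. -/
def Trying (G : SimpleGraph (Fin n)) (d₀ : ℕ) (P : Fin n → Fin n → Fin n → Prop) (s : State) :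
    Prop :=
  ∃ U d, Removing G U d s ∧ (d < d₀ ∨ d = d₀ ∧ ∀ a b c, P a b c → ¬Improves G U d₀ a b c)

section

variable {P Q : Fin n → Fin n → Fin n → Prop} {d₀ : ℕ}

theorem Trying.mono (h : Trying G d₀ P s) (hQ : ∀ a b c, Q a b c → P a b c) : Trying G d₀ Q s := by
  obtain ⟨U, d, h1, h2⟩ := h
  exact ⟨U, d, h1, h2.imp id fun h3 => ⟨h3.1, fun a b c hq => h3.2 a b c (hQ a b c hq)⟩⟩

theorem Trying.setReg (h : Trying G d₀ P s) (x k : ℕ) (h0 : 0 ≠ x) (h44 : 44 ≠ x) :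
    Trying G d₀ P (s.setReg x k) := by
  obtain ⟨U, d, h1, h2⟩ := h
  exact ⟨U, d, h1.setReg x k h0 h44, h2⟩

/-- Failures are only recorded while the number of exposed vertices is still `d₀`; after a success
the pass counts as useful whatever follows. -/
theorem Trying.attempt (h : Trying G d₀ P s) {a b c : Fin n} (ha : s.reg 41 = a)
    (hb : s.reg 42 = b) (hc : s.reg 43 = c) :
    Trying G d₀ (fun x y z => P x y z ∨ (x = a ∧ y = b ∧ z = c)) (attempt.run n s) := by
  obtain ⟨U, d, h1, h2⟩ := h
  rcases attempt_spec h1 ha hb hc with ⟨h3, h4⟩ | ⟨U', d', h3, h4⟩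
  · refine ⟨U, d, h3, h2.imp id fun h5 => ⟨h5.1, fun x y z hp => hp.elim (h5.2 x y z) ?_⟩⟩
    rintro ⟨rfl, rfl, rfl⟩
    exact h5.1 ▸ h4
  · exact ⟨U', d', h4, Or.inl (h3.trans_le (h2.elim le_of_lt fun h => h.1.le))⟩

theorem Trying.forN_attempt (h : Trying G d₀ P s) {a b : Fin n} (ha : s.reg 41 = a)
    (hb : s.reg 42 = b) :
    Trying G d₀ (fun x y z => P x y z ∨ (x = a ∧ y = b)) ((forN 43 Cmd.attempt).run n s) := by
  refine forN_fin_rule (Q := Trying G d₀ fun x y z => P x y z ∨ (x = a ∧ y = b))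
    (fun k s' => s'.reg 41 = a ∧ s'.reg 42 = b ∧
      Trying G d₀ (fun x y z => P x y z ∨ (x = a ∧ y = b ∧ (z : ℕ) < k)) s')
    ⟨ha, hb, h.mono (by simp)⟩ ?_ ?_
  · rintro k s' ⟨h1, h2, h3⟩
    refine ⟨by rw [run_reg _ _ (by rfl)]; simp [h1], by rw [run_reg _ _ (by rfl)]; simp [h2],
      ((h3.setReg 43 k (by decide) (by decide)).attempt (c := k) (by simpa using h1)
        (by simpa using h2) (by simp)).mono fun x y z => ?_⟩
    rintro (h | ⟨rfl, rfl, hz⟩)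
    · exact Or.inl (Or.inl h)
    · rcases eq_or_ne z k with rfl | hne
      · exact Or.inr ⟨rfl, rfl, rfl⟩
      · have : (z : ℕ) ≠ k := fun h => hne (Fin.ext h)
        exact Or.inl (Or.inr ⟨rfl, rfl, by omega⟩)
  · rintro s' ⟨-, -, h3⟩
    exact (h3.mono fun x y z => Or.imp_right fun h => ⟨h.1, h.2, z.2⟩).setReg _ _ (by decide)
      (by decide)

theorem Trying.forN_forN_attempt (h : Trying G d₀ P s) {a : Fin n} (ha : s.reg 41 = a) :
    Trying G d₀ (fun x y z => P x y z ∨ x = a) ((forN 42 (forN 43 Cmd.attempt)).run n s) := by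
  refine forN_fin_rule (Q := Trying G d₀ fun x y z => P x y z ∨ x = a)
    (fun k s' => s'.reg 41 = a ∧
      Trying G d₀ (fun x y z => P x y z ∨ (x = a ∧ (y : ℕ) < k)) s')
    ⟨ha, h.mono (by simp)⟩ ?_ ?_
  · rintro k s' ⟨h1, h3⟩
    refine ⟨by rw [run_reg _ _ (by rfl)]; simp [h1],
      ((h3.setReg 42 k (by decide) (by decide)).forN_attempt (b := k) (by simpa using h1)
        (by simp)).mono fun x y z => ?_⟩
    rintro (h | ⟨rfl, hy⟩)
    · exact Or.inl (Or.inl h)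
    · rcases eq_or_ne y k with rfl | hne
      · exact Or.inr ⟨rfl, rfl⟩
      · have : (y : ℕ) ≠ k := fun h => hne (Fin.ext h)
        exact Or.inl (Or.inr ⟨rfl, by omega⟩)
  · rintro s' ⟨-, h3⟩
    exact (h3.mono fun x y z => Or.imp_right fun h => ⟨h, y.2⟩).setReg _ _ (by decide) (by decide)

end

theorem Removing.pass (h : Removing G U d s) :
    Trying G d (fun _ _ _ => True) ((forN 41 (forN 42 (forN 43 attempt))).run n s) := by
  refine forN_fin_rule (Q := Trying G d fun _ _ _ => True)
    (fun k s' => Trying G d (fun x _ _ => (x : ℕ) < k) s')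
    ⟨U, d, h, Or.inr ⟨rfl, fun _ _ _ h => absurd h (Nat.not_lt_zero _)⟩⟩ ?_ ?_
  · intro k s' h3
    refine ((h3.setReg 41 k (by decide) (by decide)).forN_forN_attempt (a := k)
        (by simp)).mono fun x y z hx => ?_
    rcases eq_or_ne x k with rfl | hne
    · exact Or.inr rfl
    · have : (x : ℕ) ≠ k := fun h => hne (Fin.ext h)
      exact Or.inl (by omega)
  · intro s' h3
    exact (h3.mono fun x _ _ _ => x.2).setReg _ _ (by decide) (by decide)

/-- In the packable case a pass without success contradicts `Packable.exists_triangle` unless `d' =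
0`, and at most `n` passes can succeed. -/
theorem greedy_spec (h : Removing G U d s) (hd : d ≤ n) :
    ∃ U' d', Removing G U' d' (greedy.run n s) ∧ ((∃ t, Packable G Finset.univ t) → d' = 0) := by
  refine forN_fin_rule (Q := fun s' => ∃ U' d', Removing G U' d' s' ∧
      ((∃ t, Packable G Finset.univ t) → d' = 0))
    (fun k s' => ∃ U' d', Removing G U' d' s' ∧
      ((∃ t, Packable G Finset.univ t) → d' = 0 ∨ d' + k ≤ n))
    ⟨U, d, h, fun _ => Or.inr hd⟩ ?_ ?_
  · rintro k s' ⟨U', d', h1, h2⟩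
    obtain ⟨U'', d'', h3, h4⟩ := (h1.setReg 40 k (by decide) (by decide)).pass
    refine ⟨U'', d'', h3, fun hp => ?_⟩
    rcases h4 with h4 | ⟨rfl, h4⟩
    · exact (h2 hp).elim (fun h => by omega) fun h => Or.inr (by omega)
    · refine Or.inl (by_contra fun hpos => ?_)
      obtain ⟨t, ht⟩ := h3.packable hp
      obtain ⟨m, hm, hmd, hmax⟩ := h3.max
      obtain ⟨τ, hτU, hτ, g, hg, hlt⟩ := ht.exists_triangle hm (fun g hg => hmd ▸ hmax g hg)
        (by omega)
      obtain ⟨a, b, c, -, -, -, rfl⟩ := SimpleGraph.is3Clique_iff.1 hτ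
      exact h4 a b c trivial ⟨hτU, hτ, g, hg, hmd ▸ hlt⟩
  · rintro s' ⟨U', d', h1, h2⟩
    exact ⟨U', d', h1.setReg 40 _ (by decide) (by decide), fun hp => (h2 hp).elim id fun h => by
      omega⟩

/-! ### The main program -/

/-- Compute the offsets of the rows of matrices. -/
def rows : Cmd :=
  -- Without multiplication the offsets are accumulated by addition, starting from the `0` that
  -- register `38` holds on input.
  forN 39 (seq (write 2 (reg 39) (reg 38)) (assign 38 (add (reg 38) (reg 0))))

/-- Label the remaining vertices by the current matching, and the other ones by their triangles. -/
def labels : Cmd :=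
  -- With truncated subtraction, `x - (x - y)` is the minimum, a label on which both ends of a
  -- matching edge agree.
  forN 1 (ite (cell 10 1) (write 1 (reg 1) (sub (reg 1) (sub (reg 1) (cell 3 1))))
    (write 1 (reg 1) (cell 11 1)))

/-- Compute a partition of the vertices into cliques with two or three vertices, or into singletons
if there is none. -/
def main : Cmd :=
  seq rows (seq (forN 1 (write 10 (reg 1) (const 1))) (seq maxmatch (seq count
    (seq (assign 44 (reg 38)) (seq greedy (seq maxmatch
      (ite (reg 44) (forN 1 (write 1 (reg 1) (reg 1))) labels)))))))

theorem rows_spec (h0 : s.reg 0 = n) (h38 : s.reg 38 = 0) (x : Fin n) :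
    (rows.run n s).arr 2 x = x * n := by
  revert x
  refine forN_fin_rule (Q := fun s' => ∀ x : Fin n, s'.arr 2 x = x * n)
    (fun k s' => s'.reg 0 = n ∧ s'.reg 38 = k * n ∧
      ∀ x : Fin n, (x : ℕ) < k → s'.arr 2 x = x * n)
    ⟨h0, by simp [h38], fun _ h => absurd h (Nat.not_lt_zero _)⟩ ?_ fun s' h x => h.2.2 x x.2
  rintro k s' ⟨h1, h2, h3⟩
  refine ⟨by simp [h1], by simp [h1, h2, Nat.succ_mul], fun x hx => ?_⟩
  rcases eq_or_ne x k with rfl | hne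
  · simp [h2]
  · have : (x : ℕ) ≠ k := fun h => hne (Fin.ext h)
    simp [this, h3 x (by omega)]

theorem labels_spec (hU : Alive s U) (hv : Vec s 3 m) (hl : ∀ x ∉ U, s.arr 11 x = l x)
    (x : Fin n) : (labels.run n s).arr 1 x = (if x ∈ U then min x (m x) else l x : Fin n) := by
  revert x
  refine forN_fin_rule
    (Q := fun s' => ∀ x : Fin n, s'.arr 1 x = (if x ∈ U then min x (m x) else l x : Fin n))
    (fun k s' => (∀ b ≠ 1, s'.arr b = s.arr b) ∧
      ∀ x : Fin n, (x : ℕ) < k → s'.arr 1 x = (if x ∈ U then min x (m x) else l x : Fin n))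
    ⟨fun _ _ => rfl, fun _ h => absurd h (Nat.not_lt_zero _)⟩ ?_ fun s' h x => h.2 x x.2
  rintro k s' ⟨h1, h2⟩
  have hrun : (ite (cell 10 1) (write 1 (reg 1) (sub (reg 1) (sub (reg 1) (cell 3 1))))
      (write 1 (reg 1) (cell 11 1))).run n (s'.setReg 1 k) =
      (s'.setReg 1 k).setArr 1 k (if k ∈ U then min k (m k) else l k : Fin n) := by
    by_cases hk : k ∈ U
    · rw [run_ite_of_ne _ _ (by simp [h1, (hU k).2 hk]), if_pos hk, run_write]
      congr 1
      · simp only [eval_sub, eval_reg, eval_cell, State.setReg_reg_self, State.setReg_arr,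
          h1 3 (by decide), hv k, Fin.coe_min]
        omega
    · rw [run_ite_of_eq _ _ (by simp [h1, not_not.1 (mt (hU k).1 hk)]), if_neg hk, run_write]
      congr 1
      simp [h1, hl k hk]
  rw [hrun]
  refine ⟨fun b hb => by simp [hb, h1], fun x hx => ?_⟩
  rcases eq_or_ne x k with rfl | hne
  · simp
  · have : (x : ℕ) ≠ k := fun h => hne (Fin.ext h)
    simp only [State.setArr_arr_self, ne_eq, this, not_false_eq_true, update_of_ne,
      State.setReg_arr]
    exact h2 x (by omega)

/-- The labels of a maximum matching without exposed vertices and of triangles are those of a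
perfect packing. -/
theorem isNClique_labels (hm : IsMatch G U m) (hexp : exposed U m = 0) (hl : Labels G U l)
    (x : Fin n) :
    let C := Finset.univ.filter fun y =>
      (if x ∈ U then min x (m x) else l x) = if y ∈ U then min y (m y) else l y
    G.IsNClique 2 C ∨ G.IsNClique 3 C := by
  intro C
  have hmin : ∀ y ∈ U, min y (m y) ∈ U := fun y hy => by
    rcases min_choice y (m y) with h | h <;> rw [h]
    exacts [hy, hm.mem_image hy]
  by_cases hx : x ∈ U
  · left
    have hmx : m x ≠ x := fun h => by
      rw [exposed, Finset.card_eq_zero] at hexp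
      exact Finset.notMem_empty x (hexp ▸ Finset.mem_filter.2 ⟨hx, h⟩)
    have hC : C = {x, m x} := by
      ext y
      simp only [C, hx, if_true, Finset.mem_filter, Finset.mem_univ, true_and, Finset.mem_insert,
        Finset.mem_singleton]
      constructor
      · intro h
        by_cases hy : y ∈ U
        · rw [if_pos hy] at h
          rcases min_choice x (m x) with h1 | h1 <;> rcases min_choice y (m y) with h2 | h2 <;>
            rw [h1, h2] at h
          · exact Or.inl h.symm
          · exact Or.inr (by rw [h, hm.invol])
          · exact Or.inr h.symm
          · exact Or.inl (hm.invol.injective h.symm)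
        · rw [if_neg hy] at h
          exact ((hl y hy).1 (h ▸ hmin x hx)).elim
      · rintro (rfl | rfl)
        · simp [hx]
        · simp [hm.mem_image hx, hm.invol x, min_comm]
    have hadj := hm.adj x hmx
    rw [hC]
    exact ⟨by simp [SimpleGraph.isClique_iff, Set.pairwise_insert, hadj, hadj.symm],
      Finset.card_pair hadj.ne⟩
  · right
    have hC : C = Finset.univ.filter fun y => y ∉ U ∧ l y = l x := by
      refine Finset.filter_congr fun y _ => ?_
      rw [if_neg hx]
      by_cases hy : y ∈ U
      · simp only [hy, if_true, not_true_eq_false, false_and, iff_false]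
        exact fun h => (hl x hx).1 (h ▸ hmin y hy)
      · simp [hy, eq_comm]
    rw [hC]
    exact (hl x hx).2

/-- The outcome in the memory. -/
theorem exists_holds (s : State) : ∃ π : Outcome n, Holds s π ∧
    ∀ i, π.part i = Finset.univ.filter fun j : Fin n => s.arr 1 i = s.arr 1 j := by
  classical
  let π : Outcome n := Finpartition.ofSetoid (Setoid.ker fun i : Fin n => s.arr 1 i)
  have hπ (i j : Fin n) : j ∈ π.part i ↔ s.arr 1 i = s.arr 1 j :=
    Finpartition.mem_part_ofSetoid_iff_rel
  refine ⟨π, fun i j => ⟨fun h => ?_, fun h => ?_⟩, fun i => ?_⟩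
  · ext k
    rw [hπ, hπ, h]
  · rw [← hπ, h, hπ]
  · ext k
    simp [hπ]

/-- The sum of the two mirrored matrix entries exceeds `1` exactly for mutual friends. -/
theorem env_rows (I : FriendGame n) : Env I.strongGraph (rows.run n (input I)) := by
  have hmat (x y : Fin n) : (input I).arr 0 (x * n + y) = if y ∈ I.friends x then 1 else 0 := by
    have : (∃ i j : Fin n, (x : ℕ) * n + y = i * n + j ∧ j ∈ I.friends i) ↔ y ∈ I.friends x :=
      ⟨fun ⟨i, j, h, hj⟩ => by
        obtain ⟨rfl, rfl⟩ := row_index h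
        exact hj, fun h => ⟨x, y, rfl, h⟩⟩
    simp [input, this]
  refine ⟨by rw [run_reg _ _ (by rfl)]; simp [input], rows_spec (by simp [input])
    (by simp [input]), fun x y => ?_⟩
  rw [run_arr _ _ (by rfl), hmat, hmat]
  change _ ↔ _ ∧ _
  split_ifs <;> simp_all

theorem main_spec (I : FriendGame n) : ∃ π : Outcome n, Holds (main.run n (input I)) π ∧
    (IsPerfectK2K3Packing I.strongGraph π ∨
      (∀ i, π.part i = {i}) ∧ ∀ t, ¬Packable I.strongGraph Finset.univ t) := by
  set s1 := rows.run n (input I) with hs1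
  have henv1 : Env I.strongGraph s1 := env_rows I
  set s2 := (forN 1 (write 10 (reg 1) (const 1))).run n s1 with hs2
  have henv2 := henv1.run (forN 1 (write 10 (reg 1) (const 1))) (by rfl) (by rfl) (by rfl)
  have hal2 : Alive s2 Finset.univ := fun x => by
    rw [hs2, fill_spec (v := fun _ => 1) fun _ _ _ _ => rfl]
    simp
  obtain ⟨m, hv3, hm, hmax⟩ := maxmatch_spec henv2 hal2
  set s3 := maxmatch.run n s2 with hs3
  have hal3 : Alive s3 Finset.univ := hal2.congr (run_arr _ _ (by rfl))
  have h38 := count_spec hal3 hv3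
  set s4 := count.run n s3 with hs4
  have hal4 : Alive s4 Finset.univ := hal3.congr (run_arr _ _ (by rfl))
  have henv4 : Env I.strongGraph s4 := (henv2.run maxmatch (by rfl) (by rfl) (by rfl)).run count
    (by rfl) (by rfl) (by rfl)
  have hrem : Removing I.strongGraph Finset.univ (exposed Finset.univ m)
      (s4.setReg 44 (exposed Finset.univ m)) :=
    ⟨henv4.setReg 44 _ (by decide), hal4, by simp, ⟨m, hm, rfl, hmax⟩,
      -- No vertex has been removed yet, so the labelling is arbitrary.
      ⟨id, fun x hx => (hx (Finset.mem_univ x)).elim, fun x hx => (hx (Finset.mem_univ x)).elim⟩,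
      id⟩
  obtain ⟨U, d, hrem5, hd⟩ := greedy_spec hrem
    ((Finset.card_le_univ _).trans_eq (Fintype.card_fin n))
  set s5 := greedy.run n (s4.setReg 44 (exposed Finset.univ m)) with hs5
  obtain ⟨m', hv6, hm', hmax'⟩ := maxmatch_spec hrem5.env hrem5.alive
  set s6 := maxmatch.run n s5 with hs6
  have h44 : s6.reg 44 = d := by rw [hs6, run_reg _ _ (by rfl), hrem5.reg]
  have hrun : main.run n (input I) =
      (ite (reg 44) (forN 1 (write 1 (reg 1) (reg 1))) labels).run n s6 := by
    simp only [main, run_seq, run_assign, eval_reg, ← hs1, ← hs2, ← hs3, ← hs4, h38, ← hs5, ← hs6]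
  obtain ⟨π, hπ, hpart⟩ := exists_holds (n := n) (main.run n (input I))
  refine ⟨π, hπ, ?_⟩
  rw [hrun] at hpart
  by_cases hd0 : d = 0
  · left
    rw [run_ite_of_eq _ _ (by rw [eval_reg, h44, hd0])] at hpart
    obtain ⟨l, hl, hlab⟩ := hrem5.labels
    have hl6 : ∀ x ∉ U, s6.arr 11 x = l x := fun x hx => by
      rw [hs6, run_arr _ _ (by rfl), hl x hx]
    have hlabels := labels_spec (hrem5.alive.congr (s' := s6) (run_arr _ _ (by rfl))) hv6 hl6
    simp only [hlabels, Fin.val_inj] at hpart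
    obtain ⟨m₀, hm₀, hmd, -⟩ := hrem5.max
    -- The recomputed maximum matching `m'` may differ from the one in the invariant, but it exposes
    -- no more vertices.
    have hexp : exposed U m' = 0 := Nat.le_zero.1 (by rw [← hd0, ← hmd]; exact hmax' m₀ hm₀)
    intro C hC
    obtain ⟨x, hx⟩ := π.nonempty_of_mem_parts hC
    rw [← π.part_eq_of_mem hC hx, hpart]
    exact isNClique_labels hm' hexp hlab x
  · right
    rw [run_ite_of_ne _ _ (by rwa [eval_reg, h44])] at hpart
    have hlabels (x : Fin n) : ((forN 1 (write 1 (reg 1) (reg 1))).run n s6).arr 1 x = x :=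
      fill_spec (e := reg 1) (v := fun i : Fin n => (i : ℕ)) (fun _ _ h _ => h) x
    simp only [hlabels, Fin.val_inj] at hpart
    exact ⟨fun i => by rw [hpart]; ext j; simp [eq_comm], fun t ht => hd0 (hd ⟨t, ht⟩)⟩

end Cmd

end Ram

/-! ### The approximation algorithm -/

theorem mainTheorem2 :
    ∃ (A : Ram.Prog) (T : Polynomial ℕ), ∀ (n : ℕ), 0 < n → ∀ I : FriendGame n,
      ∃ (t : ℕ) (s : Ram.State) (π : Outcome n),
        Ram.Exec A (Ram.input I) t s ∧ t ≤ T.eval n ∧ Ram.Holds s π ∧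
        I.opt ≤ ((n : ℤ) - 1) * I.esw π ∧
        (0 < I.opt → I.OneFriend π) ∧
        ((∃ σ : Outcome n, IsPerfectK2K3Packing I.strongGraph σ) →
          IsPerfectK2K3Packing I.strongGraph π) := by
  refine ⟨Ram.Cmd.main.toProg, Ram.Cmd.main.time, fun n hn I => ?_⟩
  obtain ⟨t, hexec, ht⟩ := Ram.Cmd.main.exec (n := n) (by rfl) (Ram.input I) (by simp [Ram.input])
  obtain ⟨π, hπ, hor⟩ := Ram.Cmd.main_spec I
  refine ⟨t, _, π, hexec, ht, hπ, ?_⟩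
  rcases hor with hperf | ⟨hsing, hno⟩
  · refine ⟨?_, fun _ i => (FriendGame.exists_friend_of_isPerfectK2K3Packing hperf i).1,
      fun _ => hperf⟩
    have h1 := I.opt_le hn
    have h2 := FriendGame.one_le_esw hn hperf
    -- From `opt ≤ n - 1` and `1 ≤ esw`, multiplied by `n - 1 ≥ 0`.
    nlinarith
  · have h := I.opt_nonpos hno
    -- Without a packing the optimum is at most `0`, the welfare of the singletons, and the other
    -- two claims are vacuous.
    refine ⟨by rwa [FriendGame.esw_eq_zero hn hsing, mul_zero],
      fun hpos => (hpos.not_ge h).elim, ?_⟩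
    rintro ⟨σ, hσ⟩
    exact (hσ.packable.elim hno).elim
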